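/- Let $\rho,q\in C^\infty[0,\infty)$ be real functions with $\rho>0$ and $\int_0^\infty\rho^{1/2}dx=\infty$. Put $\tau(x)=\int_0^x\rho^{1/2}(s)\,ds$ and let $x(t)$ be the inverse function of $\tau$. Consider the problem with Neumann control $$\rho u_{tt}-u_{xx}+qu=0\ (x,t>0),\qquad u|_{t=0}=u_t|_{t=0}=0,\qquad u_x|_{x=0}=f .$$ It has a fundamental solution $r(x,t)$: $r$ vanishes for $t<\tau(x)$, is of class $C^2$ in $\{x\ge 0,\ \tau(x)\le t\}$ up to the boundary, and for every smooth control $f$ vanishing near $t=0$ (extended by $0$ to $t<0$) the function $$u^f(x,t)=\int_0^{t-\tau(x)}r(x,t-s)f(s)\,ds$$ is a classical ($C^2$) solution of the problem. For $f\in L_2(0,T)$ the wave $u^f$ is defined by the same formula. For $T>0$ let $\mathcal F^T=L_2(0,T)$ and $\mathcal H^T=L_2((0,x(T));\rho\,dx)$, and define the bounded operators $W^T:\mathcal F^T\to\mathcal H^T$, $W^Tf=u^f(\cdot,T)$; $R^T:\mathcal F^T\to\mathcal F^T$, $R^Tf=u^f(0,\cdot)$; $C^T=(W^T)^*W^T$.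 Let the inner $\frac{d}{dt}$ have the domain $\{f\in H^1[0,T]: f(0)=0\}$ and let the outer $-\frac{d}{dt}$, its adjoint, have the domain $\{f\in H^1[0,T]: f(T)=0\}$. Then $W^T\frac{d}{dt}$ and $-\frac{d}{dt}C^T\frac{d}{dt}$ have unique bounded extensions to $\mathcal F^T$ (denoted by the same symbols), and $W^T\frac{d}{dt}:\mathcal F^T\to\mathcal H^T$ is a bijection. **Theorem.** Let $T>0$ and let $y\in C^2[0,x(T)]$ satisfy $-y''+qy=0$ on $(0,x(T))$. Then the control $f=\left(W^T\frac{d}{dt}\right)^{-1}y$, which steers the velocity $u^f_t(\cdot,T)=W^T\frac{d}{dt}f$ to $y$, is the unique solution in $\mathcal F^T$ of $$-\frac{d}{dt}\,C^T\frac{d}{dt}f=-y(0)\,1^T+y'(0)\,(R^T)^*1^T,\qquad 1^T(t)\equiv 1 .$$ Let, in addition, $q=0$, and put $r(t)=r(0,t)$. (Krein) For $y=-1$ and every $\xi>0$, the control $f^\xi=\left(W^\xi\frac{d}{dt}\right)^{-1}y$ is continuous on $[0,\xi]$, and $g(\xi,t)=f^\xi(\xi-|t|)$ satisfies $$-r(0)g(\xi,t)-\tfrac12\int_{-\xi}^{\xi}r'(|t-s|)\,g(\xi,s)\,ds=1,\qquad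 -\xi\le t\le\xi .$$ (Pariiskii) For $y=-x$ and every $\xi>0$, the control $f^\xi$ is continuous on $[0,\xi]$, and $g(\xi,t)=f^\xi(\xi-|t|)$ satisfies $$-r(0)g(\xi,t)-\tfrac12\int_{-\xi}^{\xi}r'(|t-s|)\,g(\xi,s)\,ds=-\int_0^{|t|}r(s)\,ds,\qquad -\xi\le t\le\xi .$$ Moreover $g(\xi,\xi)\ne0$, $g$ is differentiable in $\xi$ (from the right at $\xi=|t|$), and $G(\xi,t)=g(\xi,\xi)^{-1}g_\xi(\xi,t)$ is continuous in $t\in[-\xi,\xi]$ and satisfies $$-r(0)G(\xi,t)-\tfrac12\int_{-\xi}^{\xi}r'(|t-s|)\,G(\xi,s)\,ds-\tfrac12\left[r'(\xi+t)+r'(\xi-t)\right]=0,\qquad -\xi\le t\le\xi .$$ -/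

import Mathlib

open MeasureTheory Set Filter
open scoped ContDiff

namespace NeumannWave

noncomputable section

/-- The eikonal `τ(x) = ∫₀ˣ ρ(s)^{1/2} ds`. -/
def eikonal (ρ : ℝ → ℝ) (x : ℝ) : ℝ := ∫ s in (0 : ℝ)..x, Real.sqrt (ρ s)

/-- The inverse `x(t)` of the eikonal on the half-axis `x ≥ 0`. -/
def front (ρ : ℝ → ℝ) (t : ℝ) : ℝ := sInf {x : ℝ | 0 ≤ x ∧ t ≤ eikonal ρ x}

/-- `u` is a classical solution of the problem with Neumann control `f`:
`ρ u_tt - u_xx + q u = 0` for `x, t > 0`, `u = u_t = 0` at `t = 0`, `u_x = f` at `x = 0`. -/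
structure IsClassicalWave (ρ q f : ℝ → ℝ) (u : ℝ → ℝ → ℝ) : Prop where
  contDiffOn : ContDiffOn ℝ 2 (fun p : ℝ × ℝ => u p.1 p.2) (Ici 0 ×ˢ Ici 0)
  equation : ∀ x > 0, ∀ t > 0,
    ρ x * iteratedDeriv 2 (fun t' => u x t') t - iteratedDeriv 2 (fun x' => u x' t) x
      + q x * u x t = 0
  initial : ∀ x ≥ 0, u x 0 = 0
  initial_velocity : ∀ x ≥ 0, derivWithin (fun t => u x t) (Ici 0) 0 = 0
  boundary : ∀ t ≥ 0, derivWithin (fun x => u x t) (Ici 0) 0 = f t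

/-- The Duhamel wave `u^f(x,t) = ∫₀^{t-τ(x)} r(x,t-s) f(s) ds`. -/
def duhamel (ρ : ℝ → ℝ) (r : ℝ → ℝ → ℝ) (f : ℝ → ℝ) (x t : ℝ) : ℝ :=
  ∫ s in (0 : ℝ)..(t - eikonal ρ x), r x (t - s) * f s

/-- `r = u^δ` is the fundamental solution (impulse response) of the Neumann problem: it vanishes
ahead of the front `t = τ(x)`, is `C²` up to the boundary in `{x ≥ 0, τ(x) ≤ t}`, and for every
smooth control vanishing near `t = 0` (and extended by zero to `t < 0`) the Duhamel integral is a
classical solution of the Neumann problem. -/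
structure IsFundamentalSolution (ρ q : ℝ → ℝ) (r : ℝ → ℝ → ℝ) : Prop where
  contDiffOn : ContDiffOn ℝ 2 (fun p : ℝ × ℝ => r p.1 p.2)
    {p : ℝ × ℝ | 0 ≤ p.1 ∧ eikonal ρ p.1 ≤ p.2}
  vanishes : ∀ x ≥ 0, ∀ t < eikonal ρ x, r x t = 0
  duhamel_solves : ∀ f : ℝ → ℝ, ContDiff ℝ ∞ f → (∃ ε > 0, ∀ t < ε, f t = 0) →
    IsClassicalWave ρ q f (duhamel ρ r f)

/-- Lebesgue measure on `(0,T)`. -/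
abbrev timeMeasure (T : ℝ) : Measure ℝ := volume.restrict (Ioo 0 T)

/-- The measure `ρ(x) dx` on `(0, x(T))`. -/
abbrev spaceMeasure (ρ : ℝ → ℝ) (T : ℝ) : Measure ℝ :=
  (volume.restrict (Ioo 0 (front ρ T))).withDensity fun x => ENNReal.ofReal (ρ x)

/-- The outer space `F^T = L₂(0,T)` of controls. -/
abbrev Outer (T : ℝ) : Type := Lp ℝ 2 (timeMeasure T)

/-- The inner space `H^T = L_{2,ρ}(0,x(T))` of states. -/
abbrev Inner (ρ : ℝ → ℝ) (T : ℝ) : Type := Lp ℝ 2 (spaceMeasure ρ T)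

/-- `W` is the control operator `f ↦ u^f(·,T)`. -/
def IsControlOperator (ρ : ℝ → ℝ) (r : ℝ → ℝ → ℝ) (T : ℝ)
    (W : Outer T →L[ℝ] Inner ρ T) : Prop :=
  ∀ f : Outer T, W f =ᵐ[spaceMeasure ρ T] fun x => duhamel ρ r f x T

/-- `R` is the response operator `f ↦ u^f(0,·)`. -/
def IsResponseOperator (ρ : ℝ → ℝ) (r : ℝ → ℝ → ℝ) (T : ℝ)
    (R : Outer T →L[ℝ] Outer T) : Prop :=
  ∀ f : Outer T, R f =ᵐ[timeMeasure T] fun t => duhamel ρ r f 0 t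

/-- The connecting operator `C^T = (W^T)^* W^T`. -/
def connecting {ρ : ℝ → ℝ} {T : ℝ} (W : Outer T →L[ℝ] Inner ρ T) : Outer T →L[ℝ] Outer T :=
  (ContinuousLinearMap.adjoint W).comp W

/-- `f ∈ H¹[0,T]` with derivative `h ∈ L₂(0,T)`, and `φ` is the continuous representative of `f`
on `[0,T]`. -/
def HasH1Deriv (T : ℝ) (f h : Outer T) (φ : ℝ → ℝ) : Prop :=
  (f =ᵐ[timeMeasure T] φ) ∧ ∀ t ∈ Icc 0 T, φ t = φ 0 + ∫ s in (0 : ℝ)..t, h s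

/-- `h = df/dt`, where `Dom d/dt = {f ∈ H¹[0,T] | f(0) = 0}`. -/
def IsTimeDeriv (T : ℝ) (f h : Outer T) : Prop :=
  ∃ φ : ℝ → ℝ, HasH1Deriv T f h φ ∧ φ 0 = 0

/-- `h = (d/dt)^* f = - df/dt`, where `Dom (d/dt)^* = {f ∈ H¹[0,T] | f(T) = 0}`. -/
def IsAdjointTimeDeriv (T : ℝ) (f h : Outer T) : Prop :=
  ∃ φ : ℝ → ℝ, HasH1Deriv T f (-h) φ ∧ φ T = 0

/-- The bounded operator `B` extends `W^T d/dt`, defined on `Dom d/dt`. -/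
def ExtendsVelocity {ρ : ℝ → ℝ} {T : ℝ} (W B : Outer T →L[ℝ] Inner ρ T) : Prop :=
  ∀ f h : Outer T, IsTimeDeriv T f h → B f = W h

/-- The bounded operator `A` extends `-(d/dt) C^T (d/dt)`, defined on `Dom d/dt`; in particular
`C^T (df/dt)` lies in the domain of the outer derivative. -/
def ExtendsSandwich {T : ℝ} (C A : Outer T →L[ℝ] Outer T) : Prop :=
  ∀ f h : Outer T, IsTimeDeriv T f h → IsAdjointTimeDeriv T (C h) (A f)

/-- The constant function `1^T` in `L₂(0,T)`. -/
def one (T : ℝ) : Outer T := Lp.const 2 (timeMeasure T) (1 : ℝ)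

/-- The derivative `r'(t)`, `t ≥ 0`, of the response function `r(t) = r(0,t)`. -/
def responseDeriv (r : ℝ → ℝ → ℝ) (t : ℝ) : ℝ := derivWithin (fun s => r 0 s) (Ici 0) t

/-- `g(ξ,t) = f^ξ(ξ - |t|)`: the even function on `[-ξ,ξ]` obtained from `f^ξ` on `[0,ξ]`. -/
def evenShift (φ : ℝ → ℝ → ℝ) (ξ t : ℝ) : ℝ := φ ξ (ξ - |t|)

/-- `G(ξ,t) = g(ξ,ξ)⁻¹ g_ξ(ξ,t)` for `|t| ≤ ξ`, the derivative being one-sided at `|t| = ξ`. -/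
def logShift (φ : ℝ → ℝ → ℝ) (ξ t : ℝ) : ℝ :=
  (evenShift φ ξ ξ)⁻¹ * derivWithin (fun η => evenShift φ η t) (Ici |t|) ξ

end

end NeumannWave

/-!
The proof reduces every assertion to properties of the operator `B = W d/dt`.

*The fundamental solution.* The substitution `u = ρ^{-1/4} v` and the optical depth `τ(x)` as a new
variable turn the wave equation into one with constant principal part, whose fundamental solution is
found from a characteristic (Goursat) problem by Picard iterations (`exists_goursat_kernel`). The
resulting `r` is, behind the front `t = τ(x)`, the restriction of a `C²` function `k` that does not
vanish on the front (`exists_fundamentalSolution`).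

*The operators.* Differentiation of the Duhamel formula gives
`(B f)(x) = k(x,τ(x)) f(T - τ(x)) + ∫₀^{T - τ(x)} k_t(x,T - s) f(s) ds`. In the variable `T - τ(x)`
this is a Volterra operator of the second kind, so `B` is bijective
(`IsFrontKernel.exists_operators`). If `V` denotes integration from `0`, the inverse of `d/dt`, then
`W = B V`, and `-(d/dt) C d/dt` extends to `B†B`. Both extensions are unique because `V` has dense range
and `V†` is injective.

*Uniqueness of `r`.* The statement concerns an arbitrary fundamental solution. Let `w` be the
difference of the waves that two of them produce from one control. Green's identity with a wave that is
odd with respect to `t = T`, and satisfies the homogeneous Neumann condition, shows that `w(·,T)` is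
orthogonal to the range of `B`, so it vanishes
(`IsFundamentalSolution.duhamel_eqOn`, `IsFundamentalSolution.isFrontKernel`).

*The control problem.* Green's identity with the separated solution `(t - T) y(x)` gives
`B†Y = -y(0) 1 + y'(0) R†1` (`SystemOperators.adjoint_state`), and injectivity of `B†` makes the
equation `B†B f = B†Y` equivalent to `B f = Y`.

*The Krein and Pariiskii equations.* Green's identity with the reflected wave yields the kernel of
`B†B` (`SystemOperators.adjoint_comp`): with `κ(s,σ) = ½ (r'(|s - σ|) + r'(s + σ))` and
`p(s) = f(T - s)`, the equation `B†B f = F(T - ·)` reads `-r(0) p - ∫₀^T κ(·,σ) p(σ) dσ = F`. The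
kernel does not depend on `T`, and neither does `F` for `y = -1` and `y = -x`. Coercivity of `B†B`
on a large interval, applied to functions extended by zero, gives stability of these equations
uniformly in `T` (`IsFrontKernel.stability`). Stability shows that `p(ξ,·)` is differentiable in `ξ` with the
derivative `p(ξ,ξ) G`, where `G` solves the equation with right-hand side `κ(·,ξ)`
(`hasDerivWithinAt_solution`). For `y = -x`, the value of the velocity at the front gives
`p(ξ,ξ) ≠ 0`. Folding the equations on `[-ξ,ξ]` for even functions to `[0,ξ]` gives the stated forms.
-/

namespace NeumannWave

open scoped Topology Interval RealInnerProductSpace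

section

/-! ### Calculus of functions of two real variables -/

/-- `F₁` and `F₂` are the partial derivatives of `F`, everywhere defined and jointly continuous. -/
structure HasPartials (F F₁ F₂ : ℝ → ℝ → ℝ) : Prop where
  fst : ∀ x y, HasDerivAt (fun x' => F x' y) (F₁ x y) x
  snd : ∀ x y, HasDerivAt (fun y' => F x y') (F₂ x y) y
  cont_fst : Continuous (Function.uncurry F₁)
  cont_snd : Continuous (Function.uncurry F₂)

namespace HasPartials

variable {F F₁ F₂ G G₁ G₂ : ℝ → ℝ → ℝ}

theorem hasFDerivAt (h : HasPartials F F₁ F₂) (p : ℝ × ℝ) :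
    HasFDerivAt (Function.uncurry F)
      ((ContinuousLinearMap.toSpanSingleton ℝ (F₁ p.1 p.2)).coprod
        (ContinuousLinearMap.toSpanSingleton ℝ (F₂ p.1 p.2))) p := by
  have cts : Continuous (fun c : ℝ => ContinuousLinearMap.toSpanSingleton ℝ c) :=
    (ContinuousLinearMap.toSpanSingletonCLE (𝕜 := ℝ) (E := ℝ)).continuous
  exact (hasStrictFDerivAt_uncurry_coprod (u := p) (f := F)
    (f₁ := fun x y => ContinuousLinearMap.toSpanSingleton ℝ (F₁ x y))
    (f₂ := fun x y => ContinuousLinearMap.toSpanSingleton ℝ (F₂ x y))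
    (Eventually.of_forall fun v => h.fst v.1 v.2) (Eventually.of_forall fun v => h.snd v.1 v.2)
    (cts.comp h.cont_fst).continuousAt (cts.comp h.cont_snd).continuousAt).hasFDerivAt

theorem continuous (h : HasPartials F F₁ F₂) : Continuous (Function.uncurry F) :=
  continuous_iff_continuousAt.2 fun p => (h.hasFDerivAt p).continuousAt

theorem contDiff_succ {n : ℕ} (h : HasPartials F F₁ F₂)
    (h₁ : ContDiff ℝ n (Function.uncurry F₁)) (h₂ : ContDiff ℝ n (Function.uncurry F₂)) :
    ContDiff ℝ (n + 1) (Function.uncurry F) := by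
  refine contDiff_succ_iff_hasFDerivAt.2 ⟨_, ?_, h.hasFDerivAt⟩
  have cts : ContDiff ℝ n (fun c : ℝ => ContinuousLinearMap.toSpanSingleton ℝ c) :=
    (ContinuousLinearMap.toSpanSingletonCLE (𝕜 := ℝ) (E := ℝ)).contDiff
  have e : ∀ p : ℝ × ℝ, (ContinuousLinearMap.toSpanSingleton ℝ (F₁ p.1 p.2)).coprod
        (ContinuousLinearMap.toSpanSingleton ℝ (F₂ p.1 p.2)) =
      (ContinuousLinearMap.toSpanSingleton ℝ (F₁ p.1 p.2)).comp (ContinuousLinearMap.fst ℝ ℝ ℝ) +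
      (ContinuousLinearMap.toSpanSingleton ℝ (F₂ p.1 p.2)).comp
        (ContinuousLinearMap.snd ℝ ℝ ℝ) := by
    intro p; ext <;> simp
  simp_rw [e]
  exact ((cts.comp h₁).clm_comp contDiff_const).add ((cts.comp h₂).clm_comp contDiff_const)

theorem contDiff_one (h : HasPartials F F₁ F₂) : ContDiff ℝ 1 (Function.uncurry F) := by
  have := h.contDiff_succ (n := 0) (contDiff_zero.2 h.cont_fst) (contDiff_zero.2 h.cont_snd)
  simpa using this

theorem contDiff_two {F₁₁ F₁₂ F₂₁ F₂₂ : ℝ → ℝ → ℝ} (h : HasPartials F F₁ F₂)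
    (h₁ : HasPartials F₁ F₁₁ F₁₂) (h₂ : HasPartials F₂ F₂₁ F₂₂) :
    ContDiff ℝ 2 (Function.uncurry F) := by
  have := h.contDiff_succ (n := 1) (by simpa using h₁.contDiff_one) (by simpa using h₂.contDiff_one)
  simpa [one_add_one_eq_two] using this

/-- The chain rule along a curve. -/
theorem comp_curve (h : HasPartials F F₁ F₂) {a b : ℝ → ℝ} {a' b' t : ℝ}
    (ha : HasDerivAt a a' t) (hb : HasDerivAt b b' t) :
    HasDerivAt (fun t => F (a t) (b t)) (F₁ (a t) (b t) * a' + F₂ (a t) (b t) * b') t := by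
  have := (h.hasFDerivAt (a t, b t)).comp_hasDerivAt t (ha.prodMk hb)
  convert! this using 1
  simp [mul_comm]

theorem add (h : HasPartials F F₁ F₂) (g : HasPartials G G₁ G₂) :
    HasPartials (fun x y => F x y + G x y) (fun x y => F₁ x y + G₁ x y)
      (fun x y => F₂ x y + G₂ x y) where
  fst x y := (h.fst x y).add (g.fst x y)
  snd x y := (h.snd x y).add (g.snd x y)
  cont_fst := h.cont_fst.add g.cont_fst
  cont_snd := h.cont_snd.add g.cont_snd

theorem mul (h : HasPartials F F₁ F₂) (g : HasPartials G G₁ G₂) :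
    HasPartials (fun x y => F x y * G x y) (fun x y => F₁ x y * G x y + F x y * G₁ x y)
      (fun x y => F₂ x y * G x y + F x y * G₂ x y) where
  fst x y := (h.fst x y).mul (g.fst x y)
  snd x y := (h.snd x y).mul (g.snd x y)
  cont_fst := (h.cont_fst.mul g.continuous).add (h.continuous.mul g.cont_fst)
  cont_snd := (h.cont_snd.mul g.continuous).add (h.continuous.mul g.cont_snd)

end HasPartials

/-- Differentiation under the integral sign with fixed limits. -/
theorem hasDerivAt_integral_param {F F' : ℝ → ℝ → ℝ}
    (hF : ∀ x s, HasDerivAt (fun x' => F x' s) (F' x s) x) (hFc : ∀ x, Continuous (F x))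
    (hF' : Continuous (Function.uncurry F')) (a b x : ℝ) :
    HasDerivAt (fun x => ∫ s in a..b, F x s) (∫ s in a..b, F' x s) x := by
  obtain ⟨C, hC⟩ := ((isCompact_Icc (a := x - 1) (b := x + 1)).prod
    (isCompact_uIcc (a := a) (b := b))).exists_bound_of_continuousOn hF'.continuousOn
  refine (intervalIntegral.hasDerivAt_integral_of_dominated_loc_of_deriv_le (bound := fun _ => C)
    (s := Icc (x - 1) (x + 1)) (Icc_mem_nhds (by linarith) (by linarith))
    (Eventually.of_forall fun x => (hFc x).aestronglyMeasurable) ((hFc x).intervalIntegrable _ _)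
    (hF'.uncurry_left x).aestronglyMeasurable ?_ (by simp) ?_).2
  · exact Eventually.of_forall fun t ht x' hx' => hC (x', t) ⟨hx', uIoc_subset_uIcc ht⟩
  · exact Eventually.of_forall fun t _ x' _ => hF x' t

/-- The Leibniz rule: differentiation under the integral sign with a moving upper limit. -/
theorem hasDerivAt_integral_param_endpoint {F F' : ℝ → ℝ → ℝ}
    (hF : ∀ x s, HasDerivAt (fun x' => F x' s) (F' x s) x)
    (hFc : Continuous (Function.uncurry F)) (hF' : Continuous (Function.uncurry F'))
    (a : ℝ) {e : ℝ → ℝ} {e' x : ℝ} (he : HasDerivAt e e' x) :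
    HasDerivAt (fun x => ∫ s in a..e x, F x s) ((∫ s in a..e x, F' x s) + F x (e x) * e') x := by
  have hP : HasPartials (fun x b => ∫ s in a..b, F x s) (fun x b => ∫ s in a..b, F' x s) F :=
    { fst := fun x b => hasDerivAt_integral_param hF (fun x => hFc.uncurry_left x) hF' a b x
      snd := fun x b => by
        have := hFc.uncurry_left x
        exact intervalIntegral.integral_hasDerivAt_right (this.intervalIntegrable _ _)
          (this.stronglyMeasurableAtFilter _ _) this.continuousAt
      cont_fst := intervalIntegral.continuous_parametric_primitive_of_continuous hF'
      cont_snd := hFc }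
  simpa using hP.comp_curve (hasDerivAt_id x) he

/-- A convolution of a `C¹` function along the diagonal direction with a continuous function is `C¹`,
since the variables enter only through `N` and through the limit of integration. -/
theorem HasPartials.diagonal_convolution {N N₁ N₂ : ℝ → ℝ → ℝ} (h : HasPartials N N₁ N₂)
    {f : ℝ → ℝ} (hf : Continuous f) :
    HasPartials (fun ξ η => ∫ s in (0 : ℝ)..η, N (ξ - s) (η - s) * f s)
      (fun ξ η => ∫ s in (0 : ℝ)..η, N₁ (ξ - s) (η - s) * f s)
      (fun ξ η => (∫ s in (0 : ℝ)..η, N₂ (ξ - s) (η - s) * f s) + N (ξ - η) 0 * f η) where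
  fst ξ η := by
    have hN := h.continuous
    have hN1 := h.cont_fst
    refine hasDerivAt_integral_param (F := fun ξ s => N (ξ - s) (η - s) * f s)
      (F' := fun ξ s => N₁ (ξ - s) (η - s) * f s) (fun x s => ?_) (fun x => ?_) ?_ _ _ _
    · have := ((h.fst (x - s) (η - s)).comp x ((hasDerivAt_id x).sub_const s)).mul_const (f s)
      simpa using this
    · exact (hN.comp (by fun_prop : Continuous fun s : ℝ => (x - s, η - s))).mul hf
    · exact (hN1.comp (by fun_prop : Continuous fun p : ℝ × ℝ => (p.1 - p.2, η - p.2))).mul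
        (hf.comp continuous_snd)
  snd ξ η := by
    have hN := h.continuous
    have hN2 := h.cont_snd
    have := hasDerivAt_integral_param_endpoint (F := fun η s => N (ξ - s) (η - s) * f s)
      (F' := fun η s => N₂ (ξ - s) (η - s) * f s) (fun x s => ?_) ?_ ?_ 0 (hasDerivAt_id η)
    · simpa using this
    · have := ((h.snd (ξ - s) (x - s)).comp x ((hasDerivAt_id x).sub_const s)).mul_const (f s)
      simpa using this
    · exact (hN.comp (by fun_prop : Continuous fun p : ℝ × ℝ => (ξ - p.2, p.1 - p.2))).mul
        (hf.comp continuous_snd)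
    · exact (hN2.comp (by fun_prop : Continuous fun p : ℝ × ℝ => (ξ - p.2, p.1 - p.2))).mul
        (hf.comp continuous_snd)
  cont_fst := by
    have hN1 := h.cont_fst
    refine intervalIntegral.continuous_parametric_intervalIntegral_of_continuous
      (f := fun (p : ℝ × ℝ) s => N₁ (p.1 - s) (p.2 - s) * f s) (a₀ := 0) ?_ continuous_snd
    exact (hN1.comp (by fun_prop : Continuous fun p : (ℝ × ℝ) × ℝ =>
      (p.1.1 - p.2, p.1.2 - p.2))).mul (hf.comp continuous_snd)
  cont_snd := by
    have hN := h.continuous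
    have hN2 := h.cont_snd
    refine Continuous.add (intervalIntegral.continuous_parametric_intervalIntegral_of_continuous
      (f := fun (p : ℝ × ℝ) s => N₂ (p.1 - s) (p.2 - s) * f s) (a₀ := 0) ?_ continuous_snd) ?_
    · exact (hN2.comp (by fun_prop : Continuous fun p : (ℝ × ℝ) × ℝ =>
        (p.1.1 - p.2, p.1.2 - p.2))).mul (hf.comp continuous_snd)
    · exact (hN.comp (by fun_prop : Continuous fun p : ℝ × ℝ => (p.1 - p.2, (0 : ℝ)))).mul
        (hf.comp continuous_snd)

/-- A `Cⁿ` function on a closed half-line extends to a `Cⁿ` function on the line: integrate an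
extension of its derivative. -/
theorem exists_contDiff_extension (n : ℕ) : ∀ f : ℝ → ℝ, ContDiffOn ℝ n f (Ici 0) →
    ∃ g : ℝ → ℝ, ContDiff ℝ n g ∧ EqOn g f (Ici 0) := by
  induction n with
  | zero =>
    intro f hf
    refine ⟨fun x => f (max x 0), ?_, fun x hx => by simp [mem_Ici.1 hx]⟩
    simp only [Nat.cast_zero, contDiff_zero]
    exact hf.continuousOn.comp_continuous (by fun_prop) (fun x => mem_Ici.2 (le_max_right _ _))
  | succ n ih =>
    intro f hf
    have hu : UniqueDiffOn ℝ (Ici (0 : ℝ)) := uniqueDiffOn_Ici 0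
    have hf' : ContDiffOn ℝ n (derivWithin f (Ici 0)) (Ici 0) :=
      hf.derivWithin hu (by push_cast; exact le_rfl)
    obtain ⟨d, hd, hdf⟩ := ih _ hf'
    have hg : ∀ x, HasDerivAt (fun x => f 0 + ∫ s in (0 : ℝ)..x, d s) (d x) x := fun x =>
      (intervalIntegral.integral_hasDerivAt_right (hd.continuous.intervalIntegrable _ _)
        (hd.continuous.stronglyMeasurableAtFilter _ _) hd.continuous.continuousAt).const_add _
    refine ⟨_, contDiff_succ_iff_deriv (n := (n : ℕ)) |>.2
      ⟨fun x => (hg x).differentiableAt, by simp, ?_⟩, ?_⟩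
    · rwa [show deriv (fun x => f 0 + ∫ s in (0 : ℝ)..x, d s) = d from funext fun x => (hg x).deriv]
    · intro x hx
      have hx : 0 ≤ x := hx
      have hfc : ContinuousOn f (Icc 0 x) := hf.continuousOn.mono Icc_subset_Ici_self
      have key : ∫ s in (0 : ℝ)..x, d s = f x - f 0 := by
        refine intervalIntegral.integral_eq_sub_of_hasDerivAt_of_le hx hfc (fun y hy => ?_)
          (hd.continuous.intervalIntegrable _ _)
        have h1 : DifferentiableWithinAt ℝ f (Ici 0) y :=
          hf.differentiableOn (by simp) y hy.1.le
        have := h1.hasDerivWithinAt.hasDerivAt (Ici_mem_nhds hy.1)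
        rwa [← hdf (mem_Ici.2 hy.1.le)] at this
      change f 0 + ∫ s in (0 : ℝ)..x, d s = f x
      rw [key]; ring

end

section

/-! ### The characteristic problem for the fundamental kernel -/

theorem continuous_integral_between {X : Type*} [TopologicalSpace X] {f : X → ℝ → ℝ}
    (hf : Continuous (Function.uncurry f)) {s t : X → ℝ} (hs : Continuous s) (ht : Continuous t) :
    Continuous fun x => ∫ y in s x..t x, f x y := by
  have e : ∀ x, ∫ y in s x..t x, f x y = (∫ y in (0 : ℝ)..t x, f x y) - ∫ y in (0 : ℝ)..s x, f x y :=
    fun x => by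
      have := hf.uncurry_left x
      rw [intervalIntegral.integral_interval_sub_left] <;> exact this.intervalIntegrable _ _
  simp_rw [e]
  exact (intervalIntegral.continuous_parametric_intervalIntegral_of_continuous hf ht).sub
    (intervalIntegral.continuous_parametric_intervalIntegral_of_continuous hf hs)

theorem abs_integral_le_of_abs_le_pow {g : ℝ → ℝ} {A η : ℝ} {n : ℕ}
    (h : ∀ b ∈ Ι 0 η, |g b| ≤ A * |b| ^ n) :
    |∫ b in (0 : ℝ)..η, g b| ≤ A * (|η| ^ (n + 1) / (n + 1)) := by
  have hA : 0 ≤ A ∨ η = 0 := by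
    by_cases hη : η = 0
    · exact Or.inr hη
    · left
      by_contra! hA
      have hmem : η / 2 ∈ Ι 0 η := by
        rcases lt_or_gt_of_ne hη with h0 | h0
        · rw [uIoc_of_ge h0.le]; constructor <;> linarith
        · rw [uIoc_of_le h0.le]; constructor <;> linarith
      have h1 := h _ hmem
      have h2 : 0 < |η / 2| ^ n := pow_pos (abs_pos.2 (by simpa using hη)) _
      nlinarith [abs_nonneg (g (η / 2))]
  rcases hA with hA | rfl
  · have h1 := intervalIntegral.norm_integral_le_abs_of_norm_le (a := 0) (b := η) (μ := volume)
      (f := g) (g := fun b => A * |b| ^ n)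
      ((ae_restrict_iff' measurableSet_uIoc).2 (Eventually.of_forall h))
      ((by fun_prop : Continuous fun b : ℝ => A * |b| ^ n).intervalIntegrable _ _)
    refine h1.trans (le_of_eq ?_)
    have h2 := integral_pow_abs_sub_uIoc (a := 0) (b := η) n
    simp only [sub_zero] at h2
    rw [intervalIntegral.abs_intervalIntegral_eq, integral_const_mul, h2, abs_of_nonneg]
    positivity
  · simp

/-- The integral `∫₀^η ∫_b^ξ J(a,b) da db` over the characteristic quadrilateral cut off by the
diagonal. -/
noncomputable def charIntegral (J : ℝ → ℝ → ℝ) (ξ η : ℝ) : ℝ :=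
  ∫ b in (0 : ℝ)..η, ∫ a in b..ξ, J a b

theorem continuous_inner_charIntegral {J : ℝ → ℝ → ℝ} (hJ : Continuous (Function.uncurry J)) :
    Continuous fun p : ℝ × ℝ => ∫ a in p.2..p.1, J a p.2 :=
  continuous_integral_between (f := fun (p : ℝ × ℝ) a => J a p.2)
    (hJ.comp (by fun_prop : Continuous fun q : (ℝ × ℝ) × ℝ => (q.2, q.1.2)))
    continuous_snd continuous_fst

theorem hasPartials_charIntegral {J : ℝ → ℝ → ℝ} (hJ : Continuous (Function.uncurry J)) :
    HasPartials (charIntegral J) (fun ξ η => ∫ b in (0 : ℝ)..η, J ξ b)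
      (fun ξ η => ∫ a in η..ξ, J a η) where
  fst ξ η := by
    refine hasDerivAt_integral_param (F := fun ξ b => ∫ a in b..ξ, J a b) (F' := J)
      (fun x s => ?_) (fun x => ?_) hJ 0 η ξ
    · have := hJ.uncurry_right s
      exact intervalIntegral.integral_hasDerivAt_right (this.intervalIntegrable _ _)
          (this.stronglyMeasurableAtFilter _ _) this.continuousAt
    · exact (continuous_inner_charIntegral hJ).uncurry_left (f := fun x s => ∫ a in s..x, J a s) x
  snd ξ η := by
    have : Continuous fun b => ∫ a in b..ξ, J a b :=
      (continuous_inner_charIntegral hJ).uncurry_left (f := fun x s => ∫ a in s..x, J a s) ξ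
    exact intervalIntegral.integral_hasDerivAt_right (this.intervalIntegrable _ _)
      (this.stronglyMeasurableAtFilter _ _) this.continuousAt
  cont_fst := intervalIntegral.continuous_parametric_primitive_of_continuous hJ
  cont_snd := continuous_inner_charIntegral hJ

theorem hasPartials_integral_snd {J J₁ J₂ : ℝ → ℝ → ℝ} (hJ : HasPartials J J₁ J₂) :
    HasPartials (fun ξ η => ∫ b in (0 : ℝ)..η, J ξ b) (fun ξ η => ∫ b in (0 : ℝ)..η, J₁ ξ b) J where
  fst ξ η := hasDerivAt_integral_param hJ.fst (fun x => hJ.continuous.uncurry_left x)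
    hJ.cont_fst _ _ _
  snd ξ η := by
    have := hJ.continuous.uncurry_left ξ
    exact intervalIntegral.integral_hasDerivAt_right (this.intervalIntegrable _ _)
      (this.stronglyMeasurableAtFilter _ _) this.continuousAt
  cont_fst := intervalIntegral.continuous_parametric_primitive_of_continuous hJ.cont_fst
  cont_snd := hJ.continuous

theorem HasPartials.swap {J J₁ J₂ : ℝ → ℝ → ℝ} (hJ : HasPartials J J₁ J₂) :
    HasPartials (fun y x => J x y) (fun y x => J₂ x y) (fun y x => J₁ x y) where
  fst y x := hJ.snd x y
  snd y x := hJ.fst x y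
  cont_fst := hJ.cont_snd.comp continuous_swap
  cont_snd := hJ.cont_fst.comp continuous_swap

theorem hasPartials_integral_fst {J J₁ J₂ : ℝ → ℝ → ℝ} (hJ : HasPartials J J₁ J₂) :
    HasPartials (fun ξ η => ∫ a in η..ξ, J a η) J
      (fun ξ η => (∫ a in η..ξ, J₂ a η) - J η η) where
  fst ξ η := by
    have := hJ.continuous.uncurry_right η
    exact intervalIntegral.integral_hasDerivAt_right (this.intervalIntegrable _ _)
      (this.stronglyMeasurableAtFilter _ _) this.continuousAt
  snd ξ η := by
    have h1 : ∀ η, ∫ a in η..ξ, J a η = -∫ a in ξ..η, J a η :=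
      fun η => intervalIntegral.integral_symm _ _
    simp_rw [h1]
    have := (hasDerivAt_integral_param_endpoint (F := fun η a => J a η) (F' := fun η a => J₂ a η)
      (fun x s => hJ.snd s x) hJ.swap.continuous hJ.swap.cont_fst ξ (hasDerivAt_id η)).neg
    convert! this using 1
    rw [intervalIntegral.integral_symm]
    simp only [id]; ring
  cont_fst := hJ.continuous
  cont_snd := (continuous_inner_charIntegral hJ.cont_snd).sub
    (hJ.continuous.comp (by fun_prop : Continuous fun p : ℝ × ℝ => (p.2, p.2)))

/-- The Volterra operator whose fixed point equation `K = K₀ - goursatOp K` is equivalent to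
`K_ξη = -p K`, `K(ξ,0) = K₀` together with the Robin condition `K_ξ - K_η = h K` on the diagonal. -/
noncomputable def goursatOp (p : ℝ → ℝ → ℝ) (h : ℝ) (K : ℝ → ℝ → ℝ) (ξ η : ℝ) : ℝ :=
  (∫ b in (0 : ℝ)..η, h * K b b) + charIntegral (fun a b => p a b * K a b) η η
    + charIntegral (fun a b => p a b * K a b) ξ η

variable {p : ℝ → ℝ → ℝ} {h : ℝ}

theorem continuous_goursatOp (hp : Continuous (Function.uncurry p)) {K : ℝ → ℝ → ℝ}
    (hK : Continuous (Function.uncurry K)) : Continuous (Function.uncurry (goursatOp p h K)) := by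
  have hJ : Continuous (Function.uncurry fun a b => p a b * K a b) := hp.mul hK
  have h1 := (hasPartials_charIntegral hJ).continuous
  have h0 : Continuous fun b => h * K b b :=
    (hK.comp (by fun_prop : Continuous fun b : ℝ => (b, b))).const_mul h
  refine Continuous.add (Continuous.add ?_ ?_) h1
  · exact (intervalIntegral.continuous_primitive (fun a b => h0.intervalIntegrable a b) 0).comp
      continuous_snd
  · exact h1.comp (by fun_prop : Continuous fun p : ℝ × ℝ => (p.2, p.2))

theorem charIntegral_sub {J J' : ℝ → ℝ → ℝ} (hJ : Continuous (Function.uncurry J))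
    (hJ' : Continuous (Function.uncurry J')) (ξ η : ℝ) :
    charIntegral (fun a b => J a b - J' a b) ξ η = charIntegral J ξ η - charIntegral J' ξ η := by
  unfold charIntegral
  rw [← intervalIntegral.integral_sub]
  · refine intervalIntegral.integral_congr fun b _ => ?_
    exact intervalIntegral.integral_sub ((hJ.uncurry_right b).intervalIntegrable _ _)
      ((hJ'.uncurry_right b).intervalIntegrable _ _)
  · exact ((continuous_inner_charIntegral hJ).uncurry_left
      (f := fun x s => ∫ a in s..x, J a s) ξ).intervalIntegrable _ _
  · exact ((continuous_inner_charIntegral hJ').uncurry_left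
      (f := fun x s => ∫ a in s..x, J' a s) ξ).intervalIntegrable _ _

theorem goursatOp_sub (hp : Continuous (Function.uncurry p)) {K K' : ℝ → ℝ → ℝ}
    (hK : Continuous (Function.uncurry K)) (hK' : Continuous (Function.uncurry K')) (ξ η : ℝ) :
    goursatOp p h (fun a b => K a b - K' a b) ξ η = goursatOp p h K ξ η - goursatOp p h K' ξ η := by
  unfold goursatOp
  have hd : Continuous fun b : ℝ => (b, b) := by fun_prop
  simp_rw [mul_sub]
  have hJ : Continuous (Function.uncurry fun a b => p a b * K a b) := hp.mul hK
  have hJ' : Continuous (Function.uncurry fun a b => p a b * K' a b) := hp.mul hK'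
  have h0 : Continuous fun b => h * K b b := (hK.comp hd).const_mul h
  have h0' : Continuous fun b => h * K' b b := (hK'.comp hd).const_mul h
  rw [charIntegral_sub hJ hJ', charIntegral_sub hJ hJ',
    intervalIntegral.integral_sub (h0.intervalIntegrable _ _) (h0'.intervalIntegrable _ _)]
  ring

/-- Each application of the Volterra operator gains a factor `|η| / (n + 1)`; this gives factorial
convergence of the Picard iterates on every square `[-L,L]²`. -/
theorem abs_goursatOp_le {L P A : ℝ} {n : ℕ} (hP : ∀ a b, |a| ≤ L → |b| ≤ L → |p a b| ≤ P)
    {K : ℝ → ℝ → ℝ} (hK : ∀ a b, |a| ≤ L → |b| ≤ L → |K a b| ≤ A * |b| ^ n)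
    {ξ η : ℝ} (hξ : |ξ| ≤ L) (hη : |η| ≤ L) :
    |goursatOp p h K ξ η| ≤ (|h| + 4 * L * P) * A * (|η| ^ (n + 1) / (n + 1)) := by
  have hL : 0 ≤ L := (abs_nonneg _).trans hξ
  have hP0 : 0 ≤ P := (abs_nonneg _).trans (hP ξ η hξ hη)
  have hmem : ∀ {c d b : ℝ}, |c| ≤ L → |d| ≤ L → b ∈ Ι c d → |b| ≤ L := by
    intro c d b hc hd hb
    rw [abs_le] at *
    rcases mem_uIoc.1 hb with h | h <;> constructor <;> linarith
  have hchar : ∀ ξ, |ξ| ≤ L → |charIntegral (fun a b => p a b * K a b) ξ η| ≤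
      (2 * L * P * A) * (|η| ^ (n + 1) / (n + 1)) := by
    intro ξ hξ
    refine abs_integral_le_of_abs_le_pow fun b hb => ?_
    have hbL : |b| ≤ L := hmem (by simpa using hL) hη hb
    have h1 : |∫ a in b..ξ, p a b * K a b| ≤ (P * (A * |b| ^ n)) * |ξ - b| :=
      intervalIntegral.norm_integral_le_of_norm_le_const (C := P * (A * |b| ^ n)) fun a ha => by
        have haL := hmem hbL hξ ha
        rw [Real.norm_eq_abs, abs_mul]
        exact mul_le_mul (hP _ _ haL hbL) (hK _ _ haL hbL) (abs_nonneg _) hP0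
    have h2 : |ξ - b| ≤ 2 * L := (abs_sub _ _).trans (by linarith)
    have h3 : 0 ≤ A * |b| ^ n := (abs_nonneg _).trans (hK _ _ hξ hbL)
    calc _ ≤ _ := h1
      _ ≤ (P * (A * |b| ^ n)) * (2 * L) := mul_le_mul_of_nonneg_left h2 (mul_nonneg hP0 h3)
      _ = _ := by ring
  have hdiag : |∫ b in (0 : ℝ)..η, h * K b b| ≤ (|h| * A) * (|η| ^ (n + 1) / (n + 1)) := by
    refine abs_integral_le_of_abs_le_pow fun b hb => ?_
    have hbL : |b| ≤ L := hmem (by simpa using hL) hη hb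
    rw [abs_mul, mul_assoc]
    exact mul_le_mul_of_nonneg_left (hK _ _ hbL hbL) (abs_nonneg _)
  unfold goursatOp
  refine (abs_add_le _ _).trans ((add_le_add ((abs_add_le _ _).trans (add_le_add hdiag
    (hchar η hη))) (hchar ξ hξ)).trans (le_of_eq ?_))
  ring

/-- The Picard iterates of the characteristic problem. -/
noncomputable def goursatIter (p : ℝ → ℝ → ℝ) (h K₀ : ℝ) : ℕ → ℝ → ℝ → ℝ
  | 0 => fun _ _ => K₀
  | n + 1 => fun ξ η => K₀ - goursatOp p h (goursatIter p h K₀ n) ξ η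

theorem continuous_goursatIter (hp : Continuous (Function.uncurry p)) (K₀ : ℝ) (n : ℕ) :
    Continuous (Function.uncurry (goursatIter p h K₀ n)) := by
  induction n with
  | zero => exact continuous_const
  | succ n ih => exact continuous_const.sub (continuous_goursatOp hp ih)

/-- The Picard iterates converge locally uniformly on the plane to a fixed point. -/
theorem exists_goursat_fixedPoint (hp : Continuous (Function.uncurry p)) (h K₀ : ℝ) :
    ∃ K : ℝ → ℝ → ℝ, Continuous (Function.uncurry K) ∧
      ∀ ξ η, K ξ η = K₀ - goursatOp p h K ξ η := by
  set S := goursatIter p h K₀ with hS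
  have hSc := continuous_goursatIter (h := h) hp K₀
  have hbd : ∀ L : ℝ, ∃ P, ∀ a b, |a| ≤ L → |b| ≤ L → |p a b| ≤ P := fun L => by
    obtain ⟨P, hP⟩ := ((isCompact_Icc (a := -L) (b := L)).prod
      (isCompact_Icc (a := -L) (b := L))).exists_bound_of_continuousOn hp.continuousOn
    exact ⟨P, fun a b ha hb => hP (a, b) ⟨abs_le.1 ha, abs_le.1 hb⟩⟩
  choose P hP using hbd
  have hstep : ∀ L ξ η, |ξ| ≤ L → |η| ≤ L → ∀ n, |S (n + 1) ξ η - S n ξ η| ≤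
      (|K₀| * (|h| + 4 * L * P L) ^ (n + 1) * L) * (L ^ n / n.factorial) := by
    intro L ξ η hξ hη n
    set c := |h| + 4 * L * P L with hc
    have hL : 0 ≤ L := (abs_nonneg _).trans hξ
    have hc0 : 0 ≤ c := by
      have := (abs_nonneg _).trans (hP L ξ η hξ hη)
      positivity
    have main : ∀ n, ∀ ξ η, |ξ| ≤ L → |η| ≤ L → |S (n + 1) ξ η - S n ξ η| ≤
        (|K₀| * c ^ (n + 1) / (n + 1).factorial) * |η| ^ (n + 1) := by
      intro n
      induction n with
      | zero =>
        intro ξ η hξ hη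
        have := abs_goursatOp_le (h := h) (n := 0) (A := |K₀|) (K := S 0) (hP L)
          (fun a b _ _ => by simp [hS, goursatIter]) hξ hη
        simp only [hS, goursatIter, Nat.factorial] at this ⊢
        rw [sub_right_comm, sub_self, zero_sub, abs_neg]
        refine this.trans (le_of_eq ?_)
        simp only [← hc]
        push_cast; ring
      | succ n ih =>
        intro ξ η hξ hη
        have := abs_goursatOp_le (h := h) (n := n + 1) (K := fun a b => S (n + 1) a b - S n a b)
          (hP L) ih hξ hη
        have e : S (n + 1 + 1) ξ η - S (n + 1) ξ η =
            -goursatOp p h (fun a b => S (n + 1) a b - S n a b) ξ η := by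
          rw [goursatOp_sub hp (hSc _) (hSc _)]
          simp only [hS, goursatIter]; ring
        rw [e, abs_neg]
        refine this.trans (le_of_eq ?_)
        rw [← hc, Nat.factorial_succ (n + 1)]
        have : ((n + 1).factorial : ℝ) ≠ 0 := by positivity
        push_cast
        field_simp
        ring
    refine (main n ξ η hξ hη).trans ?_
    have h1 : |η| ^ (n + 1) ≤ L ^ (n + 1) := pow_le_pow_left₀ (abs_nonneg _) hη _
    have h2 : (n.factorial : ℝ) ≤ (n + 1).factorial := by
      exact_mod_cast Nat.factorial_le (Nat.le_succ n)
    have h3 : (0 : ℝ) < n.factorial := by positivity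
    calc _ ≤ (|K₀| * c ^ (n + 1) / n.factorial) * L ^ (n + 1) := by gcongr
      _ = _ := by ring
  have hsum : ∀ L : ℝ, Summable fun n : ℕ =>
      (|K₀| * (|h| + 4 * L * P L) ^ (n + 1) * L) * (L ^ n / n.factorial) := fun L => by
    have := (Real.summable_pow_div_factorial ((|h| + 4 * L * P L) * L)).mul_left
      (|K₀| * (|h| + 4 * L * P L) * L)
    refine this.congr fun n => ?_
    rw [mul_pow]; ring
  -- the steps are dominated by the terms of an exponential series, uniformly on `[-L,L]²`
  have hcauchy : ∀ ξ η, ∃ k, Tendsto (fun n => S n ξ η) atTop (𝓝 k) := fun ξ η => by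
    refine cauchySeq_tendsto_of_complete (cauchySeq_of_dist_le_of_summable _ (fun n => ?_)
      (hsum (max |ξ| |η|)))
    rw [dist_comm]
    exact hstep _ ξ η (le_max_left _ _) (le_max_right _ _) n
  choose K hK using hcauchy
  have hunif : ∀ L : ℝ, ∀ ε > 0, ∃ N, ∀ n ≥ N, ∀ ξ η, |ξ| ≤ L → |η| ≤ L →
      |S n ξ η - K ξ η| < ε := by
    intro L ε hε
    have ht := tendsto_sum_nat_add fun n : ℕ =>
      (|K₀| * (|h| + 4 * L * P L) ^ (n + 1) * L) * (L ^ n / n.factorial)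
    obtain ⟨N, hN⟩ := eventually_atTop.1 (ht.eventually (gt_mem_nhds hε))
    refine ⟨N, fun n hn ξ η hξ hη => lt_of_le_of_lt ?_ (hN n hn)⟩
    have := dist_le_tsum_of_dist_le_of_tendsto _ (fun n => by
      rw [dist_comm]; exact hstep L ξ η hξ hη n) (hsum L) (hK ξ η) n
    simp only [add_comm n] at this
    exact this
  have hKc : Continuous (Function.uncurry K) := by
    refine continuous_iff_continuousAt.2 fun q => ?_
    set L := max |q.1| |q.2| + 1 with hL
    set B : Set (ℝ × ℝ) := Icc (-L) L ×ˢ Icc (-L) L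
    have hB : B ∈ 𝓝 q := by
      have h1 : |q.1| < L := lt_of_le_of_lt (le_max_left _ _) (lt_add_one _)
      have h2 : |q.2| < L := lt_of_le_of_lt (le_max_right _ _) (lt_add_one _)
      rw [abs_lt] at h1 h2
      exact prod_mem_nhds (Icc_mem_nhds h1.1 h1.2) (Icc_mem_nhds h2.1 h2.2)
    have : TendstoUniformlyOn (fun n => Function.uncurry (S n)) (Function.uncurry K) atTop B := by
      rw [Metric.tendstoUniformlyOn_iff]
      intro ε hε
      obtain ⟨N, hN⟩ := hunif L ε hε
      filter_upwards [eventually_ge_atTop N] with n hn x hx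
      rw [dist_comm]
      exact hN n hn x.1 x.2 (abs_le.2 hx.1) (abs_le.2 hx.2)
    exact (this.continuousOn (Eventually.of_forall fun n => (hSc n).continuousOn).frequently).continuousAt
      hB
  refine ⟨K, hKc, fun ξ η => ?_⟩
  -- the residual of the limit is compared with the vanishing residual of a late iterate
  have key : ∀ ε > 0, |K ξ η - (K₀ - goursatOp p h K ξ η)| ≤
      ε * (1 + (|h| + 4 * (max |ξ| |η|) * P (max |ξ| |η|)) * |η|) := by
    intro ε hε
    set L := max |ξ| |η|
    obtain ⟨N, hN⟩ := hunif L ε hε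
    have h1 := hN (N + 1) (by omega) ξ η (le_max_left _ _) (le_max_right _ _)
    have h2 := abs_goursatOp_le (h := h) (n := 0) (A := ε) (K := fun a b => S N a b - K a b) (hP L)
      (fun a b ha hb => by simpa using (hN N le_rfl a b ha hb).le) (le_max_left |ξ| |η|)
      (le_max_right |ξ| |η|)
    rw [goursatOp_sub hp (hSc _) hKc] at h2
    have e : K ξ η - (K₀ - goursatOp p h K ξ η) = -(S (N + 1) ξ η - K ξ η) -
        (goursatOp p h (S N) ξ η - goursatOp p h K ξ η) := by
      simp only [hS, goursatIter]; ring
    rw [e]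
    refine (abs_sub _ _).trans ?_
    rw [abs_neg]
    refine (add_le_add h1.le h2).trans (le_of_eq ?_)
    push_cast; ring
  by_contra hne
  have hpos : 0 < |K ξ η - (K₀ - goursatOp p h K ξ η)| := abs_pos.2 (sub_ne_zero.2 hne)
  set M := 1 + (|h| + 4 * (max |ξ| |η|) * P (max |ξ| |η|)) * |η|
  set D := |K ξ η - (K₀ - goursatOp p h K ξ η)|
  have h1 := key (D / (2 * (|M| + 1))) (by positivity)
  have h2 : D / (2 * (|M| + 1)) * M ≤ D / (2 * (|M| + 1)) * (|M| + 1) :=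
    mul_le_mul_of_nonneg_left (by linarith [le_abs_self M]) (by positivity)
  have h3 : D / (2 * (|M| + 1)) * (|M| + 1) = D / 2 := by
    have : |M| + 1 ≠ 0 := by positivity
    field_simp
  linarith

/-- Solution of the characteristic problem: `K_ξη = -p K`, `K(ξ,0) = K₀`, and the Robin condition
`K_ξ - K_η = h K` on the diagonal, with `K` of class `C²` on the whole plane. -/
theorem exists_goursat_kernel {p₁ p₂ : ℝ → ℝ → ℝ} (hp : HasPartials p p₁ p₂) (h K₀ : ℝ) :
    ∃ K K₁ K₂ K₁₁ K₂₂ : ℝ → ℝ → ℝ, HasPartials K K₁ K₂ ∧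
      HasPartials K₁ K₁₁ (fun ξ η => -(p ξ η * K ξ η)) ∧
      HasPartials K₂ (fun ξ η => -(p ξ η * K ξ η)) K₂₂ ∧
      (∀ ξ, K ξ 0 = K₀) ∧ (∀ ξ, K₁ ξ 0 = 0) ∧ ∀ η, K₁ η η - K₂ η η = h * K η η := by
  obtain ⟨K, hKc, hK⟩ := exists_goursat_fixedPoint hp.continuous h K₀
  set J : ℝ → ℝ → ℝ := fun a b => p a b * K a b with hJdef
  have hJ : Continuous (Function.uncurry J) := hp.continuous.mul hKc
  have hd : Continuous fun b : ℝ => (b, b) := by fun_prop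
  have hE := hasPartials_charIntegral hJ
  have hdiag : ∀ η, HasDerivAt (fun η => charIntegral J η η) (∫ b in (0 : ℝ)..η, J η b) η := by
    intro η
    simpa using hE.comp_curve (hasDerivAt_id η) (hasDerivAt_id η)
  set K₁ : ℝ → ℝ → ℝ := fun ξ η => -∫ b in (0 : ℝ)..η, J ξ b with hK1
  set K₂ : ℝ → ℝ → ℝ := fun ξ η =>
    -(h * K η η + (∫ b in (0 : ℝ)..η, J η b) + ∫ a in η..ξ, J a η) with hK2
  have H : HasPartials K K₁ K₂ :=
    { fst := fun x y => by
        have e : (fun ξ => K ξ y) = fun ξ => K₀ - goursatOp p h K ξ y := funext fun ξ => hK ξ y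
        rw [e]
        exact ((hE.fst x y).const_add _).const_sub K₀
      snd := fun x y => by
        have e : (fun η => K x η) = fun η => K₀ - goursatOp p h K x η := funext fun η => hK x η
        rw [e]
        have h0 : Continuous fun b => h * K b b := (hKc.comp hd).const_mul h
        have h1 := intervalIntegral.integral_hasDerivAt_right (h0.intervalIntegrable 0 y)
          (h0.stronglyMeasurableAtFilter _ _) h0.continuousAt
        exact ((h1.add (hdiag y)).add (hE.snd x y)).const_sub K₀
      cont_fst := hE.cont_fst.neg
      cont_snd := by
        refine Continuous.neg (Continuous.add (Continuous.add ?_ ?_) hE.cont_snd)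
        · exact ((hKc.comp hd).const_mul h).comp continuous_snd
        · exact hE.cont_fst.comp (by fun_prop : Continuous fun q : ℝ × ℝ => (q.2, q.2)) }
  have HJ := hp.mul H
  have HA := hasPartials_integral_snd HJ
  have HB := hasPartials_integral_fst HJ
  refine ⟨K, K₁, K₂, fun ξ η => -∫ b in (0 : ℝ)..η, (p₁ ξ b * K ξ b + p ξ b * K₁ ξ b),
    fun ξ η => -(h * (K₁ η η + K₂ η η) +
      ((∫ b in (0 : ℝ)..η, (p₁ η b * K η b + p η b * K₁ η b)) + p η η * K η η) +
      ((∫ a in η..ξ, (p₂ a η * K a η + p a η * K₂ a η)) - p η η * K η η)), H, ?_, ?_, ?_, ?_, ?_⟩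
  · exact ⟨fun x y => (HA.fst x y).neg, fun x y => (HA.snd x y).neg, HA.cont_fst.neg,
      HA.cont_snd.neg⟩
  · refine ⟨fun x y => ?_, fun x y => ?_, HB.cont_fst.neg, ?_⟩
    · exact ((HB.fst x y).const_add _).neg
    · have h1 : HasDerivAt (fun η => K η η) (K₁ y y + K₂ y y) y := by
        simpa using H.comp_curve (hasDerivAt_id y) (hasDerivAt_id y)
      have h2 := HA.comp_curve (hasDerivAt_id y) (hasDerivAt_id y)
      simp only [id, mul_one] at h2
      exact (((h1.const_mul h).add h2).add (HB.snd x y)).neg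
    · have hd2 : Continuous fun q : ℝ × ℝ => (q.2, q.2) := by fun_prop
      refine Continuous.neg (Continuous.add (Continuous.add ?_ (Continuous.add ?_ ?_)) HB.cont_snd)
      · exact ((H.cont_fst.comp hd2).add (H.cont_snd.comp hd2)).const_mul h
      · exact HA.cont_fst.comp hd2
      · exact HJ.continuous.comp hd2
  · intro ξ
    rw [hK]; simp [goursatOp, charIntegral]
  · intro ξ
    simp [hK1]
  · intro η
    simp [hK1, hK2]

end

section

/-! ### The eikonal and its inverse -/

theorem eikonal_zero (ρ : ℝ → ℝ) : eikonal ρ 0 = 0 := by simp [eikonal]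

theorem front_nonneg (ρ : ℝ → ℝ) (t : ℝ) : 0 ≤ front ρ t :=
  Real.sInf_nonneg fun _ hx => hx.1

/-- A density on the half-axis: continuous, positive, and with infinite optical length. -/
structure IsDensity (ρ : ℝ → ℝ) : Prop where
  continuousOn : ContinuousOn ρ (Ici 0)
  pos : ∀ x ≥ 0, 0 < ρ x
  tendsto : Tendsto (eikonal ρ) atTop atTop

namespace IsDensity

variable {ρ : ℝ → ℝ}

theorem intervalIntegrable_sqrt (hρ : IsDensity ρ) {a b : ℝ} (ha : 0 ≤ a) (hb : 0 ≤ b) :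
    IntervalIntegrable (fun s => Real.sqrt (ρ s)) volume a b :=
  ((hρ.continuousOn.sqrt).mono fun _ hx => (le_min ha hb).trans hx.1).intervalIntegrable

theorem strictMonoOn_eikonal (hρ : IsDensity ρ) : StrictMonoOn (eikonal ρ) (Ici 0) := by
  intro x hx y hy hxy
  have hx : 0 ≤ x := hx
  have hy : 0 ≤ y := hy
  have h := intervalIntegral.integral_add_adjacent_intervals
    (hρ.intervalIntegrable_sqrt le_rfl hx) (hρ.intervalIntegrable_sqrt hx hy)
  have hpos : 0 < ∫ s in x..y, Real.sqrt (ρ s) :=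
    intervalIntegral.intervalIntegral_pos_of_pos_on (hρ.intervalIntegrable_sqrt hx hy)
      (fun s hs => Real.sqrt_pos.2 (hρ.pos s (hx.trans hs.1.le))) hxy
  simp only [eikonal]
  linarith

theorem eikonal_le_iff (hρ : IsDensity ρ) {x y : ℝ} (hx : 0 ≤ x) (hy : 0 ≤ y) :
    eikonal ρ x ≤ eikonal ρ y ↔ x ≤ y := hρ.strictMonoOn_eikonal.le_iff_le hx hy

theorem eikonal_lt_iff (hρ : IsDensity ρ) {x y : ℝ} (hx : 0 ≤ x) (hy : 0 ≤ y) :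
    eikonal ρ x < eikonal ρ y ↔ x < y := hρ.strictMonoOn_eikonal.lt_iff_lt hx hy

theorem eikonal_nonneg (hρ : IsDensity ρ) {x : ℝ} (hx : 0 ≤ x) : 0 ≤ eikonal ρ x := by
  rw [← eikonal_zero ρ]; exact (hρ.eikonal_le_iff le_rfl hx).2 hx

theorem front_eikonal (hρ : IsDensity ρ) {x : ℝ} (hx : 0 ≤ x) : front ρ (eikonal ρ x) = x := by
  have : {y : ℝ | 0 ≤ y ∧ eikonal ρ x ≤ eikonal ρ y} = Ici x := by
    ext y
    constructor
    · rintro ⟨h0, h1⟩; exact (hρ.eikonal_le_iff hx h0).1 h1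
    · intro h; exact ⟨hx.trans h, (hρ.eikonal_le_iff hx (hx.trans h)).2 h⟩
  rw [front, this, csInf_Ici]

theorem continuousOn_eikonal (hρ : IsDensity ρ) : ContinuousOn (eikonal ρ) (Ici 0) := by
  intro x hx
  have hx : 0 ≤ x := hx
  have h1 : ContinuousOn (eikonal ρ) (uIcc 0 (x + 1)) :=
    intervalIntegral.continuousOn_primitive_interval
      ((intervalIntegrable_iff' (by simp)).1 (hρ.intervalIntegrable_sqrt le_rfl (by linarith)))
  rw [uIcc_of_le (by linarith)] at h1
  exact (h1 x ⟨hx, by linarith⟩).mono_of_mem_nhdsWithin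
    (mem_nhdsWithin.2 ⟨Iio (x + 1), isOpen_Iio, by simp, fun y hy => ⟨hy.2, le_of_lt hy.1⟩⟩)

theorem exists_eikonal_eq (hρ : IsDensity ρ) {t : ℝ} (ht : 0 ≤ t) : ∃ x ≥ 0, eikonal ρ x = t := by
  obtain ⟨b, hb⟩ := ((hρ.tendsto.eventually_ge_atTop t).and (eventually_ge_atTop 0)).exists
  obtain ⟨x, hx, hxt⟩ := intermediate_value_Icc hb.2
    (hρ.continuousOn_eikonal.mono Icc_subset_Ici_self) ⟨by rwa [eikonal_zero], hb.1⟩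
  exact ⟨x, hx.1, hxt⟩

theorem eikonal_front (hρ : IsDensity ρ) {t : ℝ} (ht : 0 ≤ t) : eikonal ρ (front ρ t) = t := by
  obtain ⟨x, hx, rfl⟩ := hρ.exists_eikonal_eq ht
  rw [hρ.front_eikonal hx]

theorem front_of_nonpos (hρ : IsDensity ρ) {t : ℝ} (ht : t ≤ 0) : front ρ t = 0 := by
  have : {y : ℝ | 0 ≤ y ∧ t ≤ eikonal ρ y} = Ici 0 := by
    ext y
    exact ⟨fun h => h.1, fun h => ⟨h, ht.trans (hρ.eikonal_nonneg h)⟩⟩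
  rw [front, this, csInf_Ici]

theorem front_pos (hρ : IsDensity ρ) {t : ℝ} (ht : 0 < t) : 0 < front ρ t := by
  refine lt_of_le_of_ne (front_nonneg ρ t) fun h => ?_
  have := hρ.eikonal_front ht.le
  rw [← h, eikonal_zero] at this
  exact ht.ne this

theorem monotone_front (hρ : IsDensity ρ) : Monotone (front ρ) := by
  intro s t hst
  rcases le_total s 0 with hs | hs
  · rw [hρ.front_of_nonpos hs]; exact front_nonneg ρ t
  · rw [← hρ.eikonal_le_iff (front_nonneg ρ _) (front_nonneg ρ _), hρ.eikonal_front hs,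
      hρ.eikonal_front (hs.trans hst)]
    exact hst

theorem continuous_front (hρ : IsDensity ρ) : Continuous (front ρ) := by
  -- the term `min t 0` makes the monotone function surjective onto the line
  have hmono : Monotone fun t => front ρ t + min t 0 := fun s t h =>
    add_le_add (hρ.monotone_front h) (min_le_min_right 0 h)
  have hsurj : Function.Surjective fun t => front ρ t + min t 0 := by
    intro y
    rcases le_total 0 y with hy | hy
    · exact ⟨eikonal ρ y, by simp [hρ.front_eikonal hy, hρ.eikonal_nonneg hy]⟩
    · exact ⟨y, by simp [hρ.front_of_nonpos hy, hy]⟩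
  have := (hmono.continuous_of_surjective hsurj).sub
    (by fun_prop : Continuous fun t : ℝ => min t 0)
  exact this.congr fun t => by simp

theorem eikonal_lt_iff_lt_front (hρ : IsDensity ρ) {x t : ℝ} (hx : 0 ≤ x) (ht : 0 ≤ t) :
    eikonal ρ x < t ↔ x < front ρ t := by
  conv_lhs => rw [← hρ.eikonal_front ht]
  exact hρ.eikonal_lt_iff hx (front_nonneg ρ t)

end IsDensity

/-! ### Existence of the fundamental solution -/

/-- The wave in characteristic coordinates: the diagonal convolution of the kernel of the
characteristic problem with a smooth control. -/
theorem exists_characteristic_wave {p K K₁ K₂ K₁₁ K₂₂ : ℝ → ℝ → ℝ} {h K₀ : ℝ}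
    (hpt : ∀ a b s, p (a - s) (b - s) = p a b)
    (hK : HasPartials K K₁ K₂) (hK₁ : HasPartials K₁ K₁₁ (fun ξ η => -(p ξ η * K ξ η)))
    (hK₂ : HasPartials K₂ (fun ξ η => -(p ξ η * K ξ η)) K₂₂) (h0 : ∀ ξ, K ξ 0 = K₀)
    (h10 : ∀ ξ, K₁ ξ 0 = 0) (hrob : ∀ η, K₁ η η - K₂ η η = h * K η η) {f : ℝ → ℝ}
    (hf : ContDiff ℝ ∞ f) :
    let V : ℝ → ℝ → ℝ := fun ξ η => ∫ s in (0 : ℝ)..η, K (ξ - s) (η - s) * f s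
    let V₁ : ℝ → ℝ → ℝ := fun ξ η => ∫ s in (0 : ℝ)..η, K₁ (ξ - s) (η - s) * f s
    let V₂ : ℝ → ℝ → ℝ := fun ξ η => (∫ s in (0 : ℝ)..η, K₂ (ξ - s) (η - s) * f s) + K₀ * f η
    HasPartials V V₁ V₂ ∧ (∃ V₁₁, HasPartials V₁ V₁₁ (fun ξ η => -(p ξ η * V ξ η))) ∧
      (∃ V₂₂, HasPartials V₂ (fun ξ η => -(p ξ η * V ξ η)) V₂₂) ∧
      ∀ η, V₁ η η - V₂ η η = h * V η η - K₀ * f η := by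
  intro V V₁ V₂
  have hfc := hf.continuous
  have hmix : ∀ ξ η, ∫ s in (0 : ℝ)..η, -(p (ξ - s) (η - s) * K (ξ - s) (η - s)) * f s =
      -(p ξ η * V ξ η) := by
    intro ξ η
    simp only [V, hpt]
    rw [← neg_mul, ← intervalIntegral.integral_const_mul]
    exact intervalIntegral.integral_congr fun s _ => by ring
  have hV := hK.diagonal_convolution hfc
  have hV1 := hK₁.diagonal_convolution hfc
  have hV2 := hK₂.diagonal_convolution hfc
  simp only [h0] at hV
  simp only [h10, zero_mul, add_zero, hmix] at hV1
  simp only [hmix] at hV2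
  have hff : HasPartials (fun _ η => K₀ * f η) (fun _ _ => 0) (fun _ η => K₀ * deriv f η) :=
    { fst := fun x y => hasDerivAt_const _ _
      snd := fun x y => ((hf.differentiable (by simp)) y).hasDerivAt.const_mul K₀
      cont_fst := continuous_const
      cont_snd := ((hf.continuous_deriv (by simp)).comp continuous_snd).const_mul K₀ }
  refine ⟨hV, ⟨_, hV1⟩, ⟨_, by simpa using hV2.add hff⟩, fun η => ?_⟩
  have hcK : ∀ {N : ℝ → ℝ → ℝ}, Continuous (Function.uncurry N) →
      IntervalIntegrable (fun s => N (η - s) (η - s) * f s) volume 0 η := fun hN =>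
    ((hN.comp (by fun_prop : Continuous fun s : ℝ => (η - s, η - s))).mul
      hfc).intervalIntegrable _ _
  simp only [V, V₁, V₂]
  rw [← intervalIntegral.integral_const_mul, ← sub_sub, ← intervalIntegral.integral_sub
    (hcK hK₁.continuous) (hcK hK₂.continuous)]
  congr 1
  refine intervalIntegral.integral_congr fun s _ => ?_
  have := hrob (η - s)
  rw [← sub_mul, this, mul_assoc]

theorem iteratedDeriv_two_eq_of_mem_nhds {g g' : ℝ → ℝ} {g'' x : ℝ} {s : Set ℝ} (hs : s ∈ 𝓝 x)
    (h : ∀ y ∈ s, HasDerivAt g (g' y) y) (h' : HasDerivAt g' g'' x) :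
    iteratedDeriv 2 g x = g'' := by
  rw [iteratedDeriv_succ, iteratedDeriv_one]
  have : deriv g =ᶠ[𝓝 x] g' := by filter_upwards [hs] with y hy using (h y hy).deriv
  rw [this.deriv_eq, h'.deriv]

/-- Existence of the fundamental solution. The substitution `u = ρ^{-1/4} v` and passage to the
optical depth `τ(x)` turn the equation into `v_tt - v_zz + Q(z) v = 0`, whose fundamental solution in
the characteristic coordinates `ξ = t + z`, `η = t - z` is the kernel `K` of the characteristic
problem. The solution continues as a `C²` function `k` across the front, where it does not vanish,
and `r` is `k` cut off to the region behind the front. -/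
theorem exists_fundamentalSolution {ρ q : ℝ → ℝ} (hρs : ContDiffOn ℝ ∞ ρ (Ici 0))
    (hρ : IsDensity ρ) (hq : ContDiffOn ℝ ∞ q (Ici 0)) :
    ∃ k k' : ℝ → ℝ → ℝ, ContDiff ℝ 2 (Function.uncurry k) ∧ (∀ x t, HasDerivAt (k x) (k' x t) t) ∧
      Continuous (Function.uncurry k') ∧ (∀ x ≥ 0, k x (eikonal ρ x) ≠ 0) ∧
      IsFundamentalSolution ρ q
        (fun x t => if 0 ≤ x ∧ eikonal ρ x ≤ t then k x t else 0) := by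
  -- smooth extensions of the coefficients to the whole line
  obtain ⟨ℓ, hℓ, hℓρ⟩ := exists_contDiff_extension 3 (fun x => Real.log (ρ x))
    ((contDiffOn_infty.1 hρs 3).log fun x hx => (hρ.pos x hx).ne')
  obtain ⟨q', hq', hqq⟩ := exists_contDiff_extension 1 q (contDiffOn_infty.1 hq 1)
  have hρexp : ∀ x ≥ 0, ρ x = Real.exp (ℓ x) := fun x hx => by
    rw [hℓρ hx, Real.exp_log (hρ.pos x hx)]
  have hℓ1 : ContDiff ℝ 2 (deriv ℓ) := (contDiff_succ_iff_deriv (n := 2).1 (by exact_mod_cast hℓ)).2.2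
  have hℓ2 : ContDiff ℝ 1 (deriv (deriv ℓ)) :=
    (contDiff_succ_iff_deriv (n := 1).1 (by simpa [one_add_one_eq_two] using hℓ1)).2.2
  have dℓ : ∀ x, HasDerivAt ℓ (deriv ℓ x) x := fun x => (hℓ.differentiable (by simp) x).hasDerivAt
  have dℓ1 : ∀ x, HasDerivAt (deriv ℓ) (deriv (deriv ℓ) x) x := fun x =>
    (hℓ1.differentiable (by simp) x).hasDerivAt
  -- `σ = ρ^{1/2}` and `m = ρ^{-1/4}`, with `m'' = w m`
  set σ : ℝ → ℝ := fun x => Real.exp (ℓ x / 2) with hσ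
  set m : ℝ → ℝ := fun x => Real.exp (-(ℓ x / 4)) with hm
  have σpos : ∀ x, 0 < σ x := fun x => Real.exp_pos _
  have mpos : ∀ x, 0 < m x := fun x => Real.exp_pos _
  have hσC : ContDiff ℝ 3 σ := (hℓ.div_const 2).exp
  have hmC : ContDiff ℝ 3 m := (hℓ.div_const 4).neg.exp
  set m' : ℝ → ℝ := fun x => -(deriv ℓ x / 4) * m x with hm'
  set σ' : ℝ → ℝ := fun x => deriv ℓ x / 2 * σ x with hσ'
  have dσ : ∀ x, HasDerivAt σ (σ' x) x := fun x => by
    have := ((dℓ x).div_const 2).exp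
    exact this.congr_deriv (by simp only [hσ', hσ]; ring)
  have dm : ∀ x, HasDerivAt m (m' x) x := fun x => by
    have := ((dℓ x).div_const 4).neg.exp
    exact this.congr_deriv (by simp only [hm', hm, Pi.neg_apply]; ring)
  set w : ℝ → ℝ := fun x => deriv ℓ x ^ 2 / 16 - deriv (deriv ℓ) x / 4 with hw
  have dm' : ∀ x, HasDerivAt m' (w x * m x) x := fun x => by
    have := (((dℓ1 x).div_const 4).neg).mul (dm x)
    exact this.congr_deriv (by simp only [hm', hw, Pi.neg_apply]; ring)
  set τ : ℝ → ℝ := fun x => ∫ s in (0 : ℝ)..x, σ s with hτ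
  have dτ : ∀ x, HasDerivAt τ (σ x) x := fun x =>
    intervalIntegral.integral_hasDerivAt_right (hσC.continuous.intervalIntegrable _ _)
      (hσC.continuous.stronglyMeasurableAtFilter _ _) hσC.continuous.continuousAt
  have hσρ : ∀ x ≥ 0, Real.sqrt (ρ x) = σ x := fun x hx => by
    rw [hρexp x hx, hσ]
    rw [Real.sqrt_eq_iff_mul_self_eq (Real.exp_pos _).le (Real.exp_pos _).le, ← Real.exp_add]
    congr 1; ring
  have hτe : ∀ x ≥ 0, eikonal ρ x = τ x := fun x hx =>
    intervalIntegral.integral_congr fun s hs => hσρ s (by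
      rw [uIcc_of_le hx] at hs; exact hs.1)
  have hσσ : ∀ x ≥ 0, ρ x = σ x ^ 2 := fun x hx => by
    rw [← hσρ x hx, Real.sq_sqrt (hρ.pos x hx).le]
  have hτC : ContDiff ℝ 2 τ := by
    have : ContDiff ℝ (1 + 1) τ := contDiff_succ_iff_deriv.2
      ⟨fun x => (dτ x).differentiableAt, by simp, by
        rw [show deriv τ = σ from funext fun x => (dτ x).deriv]
        exact hσC.of_le (by exact_mod_cast (by norm_num : (1 : ℕ) ≤ 3))⟩
    simpa [one_add_one_eq_two] using this
  -- the potential of the Liouville normal form, as a function of optical depth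
  set Q₁ : ℝ → ℝ := fun x => (q' x - w x) * Real.exp (-ℓ x) with hQ₁
  have hQ₁C : ContDiff ℝ 1 Q₁ := by
    have h1 : ContDiff ℝ 1 (deriv ℓ) := hℓ1.of_le (by exact_mod_cast (by norm_num : (1 : ℕ) ≤ 2))
    have h2 : ContDiff ℝ 1 ℓ := hℓ.of_le (by exact_mod_cast (by norm_num : (1 : ℕ) ≤ 3))
    exact ((show ContDiff ℝ 1 q' by exact_mod_cast hq').sub
      (((h1.pow 2).div_const 16).sub (hℓ2.div_const 4))).mul h2.neg.exp
  -- `Q₁` has only one derivative, so `Q = Q₁ ∘ τ⁻¹` is defined as the integral of its derivative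
  set D : ℝ → ℝ := fun z => deriv Q₁ (front ρ z) / σ (front ρ z) with hD
  have hDc : Continuous D :=
    ((hQ₁C.continuous_deriv le_rfl).comp hρ.continuous_front).div
      (hσC.continuous.comp hρ.continuous_front) fun z => (σpos _).ne'
  set Q : ℝ → ℝ := fun z => Q₁ 0 + ∫ s in (0 : ℝ)..z, D s with hQ
  have dQ : ∀ z, HasDerivAt Q (D z) z := fun z =>
    (intervalIntegral.integral_hasDerivAt_right (hDc.intervalIntegrable _ _)
      (hDc.stronglyMeasurableAtFilter _ _) hDc.continuousAt).const_add _
  have hQc : Continuous Q := continuous_iff_continuousAt.2 fun z => (dQ z).continuousAt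
  have hQτ : ∀ x ≥ 0, Q (τ x) = Q₁ x := by
    intro x hx
    have hd : ∀ y ∈ uIcc 0 x, HasDerivAt (fun y => Q (τ y) - Q₁ y) 0 y := by
      intro y hy
      rw [uIcc_of_le hx] at hy
      have h1 := (dQ (τ y)).comp y (dτ y)
      have h2 := (hQ₁C.differentiable (by simp) y).hasDerivAt
      have h3 : D (τ y) * σ y = deriv Q₁ y := by
        simp only [hD]
        rw [← hτe y hy.1, hρ.front_eikonal hy.1]
        exact div_mul_cancel₀ _ (σpos _).ne'
      have := h1.sub h2
      rw [h3, sub_self] at this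
      exact this
    have := intervalIntegral.integral_eq_sub_of_hasDerivAt hd (by simp)
    have h0 : Q (τ 0) = Q₁ 0 := by simp [hQ, hτ]
    simp only [intervalIntegral.integral_zero, h0, sub_self, sub_zero] at this
    linarith
  set p : ℝ → ℝ → ℝ := fun a b => Q ((a - b) / 2) / 4 with hp
  have hpP : HasPartials p (fun a b => D ((a - b) / 2) / 8) (fun a b => -(D ((a - b) / 2) / 8)) :=
    { fst := fun x y => by
        have := ((dQ ((x - y) / 2)).comp x (((hasDerivAt_id x).sub_const y).div_const 2)).div_const 4
        convert! this using 1; ring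
      snd := fun x y => by
        have := ((dQ ((x - y) / 2)).comp y (((hasDerivAt_id y).const_sub x).div_const 2)).div_const 4
        convert! this using 1; ring
      cont_fst := by simp only [Function.uncurry_def]; fun_prop
      cont_snd := by simp only [Function.uncurry_def]; fun_prop }
  -- the Robin constant `h = -m'(0) / (m(0) τ'(0))` makes the wave satisfy the Neumann condition, and
  -- `K₀` normalizes it to the control `f`
  set h : ℝ := deriv ℓ 0 / 4 / σ 0 with hh
  set K₀ : ℝ := -(1 / (m 0 * σ 0)) with hK₀
  obtain ⟨K, K₁, K₂, K₁₁, K₂₂, hK, hK₁, hK₂, hK0, hK10, hrob⟩ := exists_goursat_kernel hpP h K₀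
  have hKC := hK.contDiff_two hK₁ hK₂
  set k : ℝ → ℝ → ℝ := fun x t => m x * K (t + τ x) (t - τ x) with hk
  have hchar : ContDiff ℝ 2 fun z : ℝ × ℝ => (z.2 + τ z.1, z.2 - τ z.1) :=
    (contDiff_snd.add (hτC.comp contDiff_fst)).prodMk (contDiff_snd.sub (hτC.comp contDiff_fst))
  have hm2 : ContDiff ℝ 2 fun z : ℝ × ℝ => m z.1 :=
    (hmC.of_le (by exact_mod_cast (by norm_num : (2 : ℕ) ≤ 3))).comp contDiff_fst
  have hkC : ContDiff ℝ 2 (Function.uncurry k) := hm2.mul (hKC.comp hchar)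
  refine ⟨k, fun x t => m x * (K₁ (t + τ x) (t - τ x) + K₂ (t + τ x) (t - τ x)), hkC, ?_, ?_, ?_, ?_⟩
  · intro x t
    have := (hK.comp_curve ((hasDerivAt_id t).add_const (τ x))
      ((hasDerivAt_id t).sub_const (τ x))).const_mul (m x)
    simpa using this
  · exact (hm2.continuous).mul
      ((hK₁.continuous.comp hchar.continuous).add (hK₂.continuous.comp hchar.continuous))
  · intro x hx
    rw [hτe x hx]
    simp only [hk, sub_self, hK0]
    exact mul_ne_zero (mpos x).ne' (neg_ne_zero.2 (one_div_ne_zero (mul_pos (mpos 0) (σpos 0)).ne'))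
  · refine ⟨?_, ?_, ?_⟩
    · refine hkC.contDiffOn.congr fun z hz => ?_
      exact if_pos hz
    · intro x hx t ht
      simp [not_le.2 ht]
    · intro f hf ⟨ε, hε, hfε⟩
      obtain ⟨hV, ⟨V₁₁, hV1⟩, ⟨V₂₂, hV2⟩, hVrob⟩ := exists_characteristic_wave (p := p)
        (fun a b s => by simp [hp]) hK hK₁ hK₂ hK0 hK10 hrob hf
      set V : ℝ → ℝ → ℝ := fun ξ η => ∫ s in (0 : ℝ)..η, K (ξ - s) (η - s) * f s with hVdef
      set V₁ : ℝ → ℝ → ℝ := fun ξ η => ∫ s in (0 : ℝ)..η, K₁ (ξ - s) (η - s) * f s with hV1def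
      set V₂ : ℝ → ℝ → ℝ := fun ξ η =>
        (∫ s in (0 : ℝ)..η, K₂ (ξ - s) (η - s) * f s) + K₀ * f η with hV2def
      have hzero : ∀ (N : ℝ → ℝ → ℝ) (ξ η : ℝ), η ≤ 0 →
          ∫ s in (0 : ℝ)..η, N (ξ - s) (η - s) * f s = 0 := by
        intro N ξ η hη
        refine (intervalIntegral.integral_congr fun s hs => ?_).trans intervalIntegral.integral_zero
        rw [uIcc_of_ge hη] at hs
        simp [hfε s (by linarith [hs.2])]
      set U : ℝ → ℝ → ℝ := fun x t => m x * V (t + τ x) (t - τ x) with hU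
      have hUC : ContDiff ℝ 2 (Function.uncurry U) := hm2.mul ((hV.contDiff_two hV1 hV2).comp hchar)
      have hdU : ∀ x ≥ 0, ∀ t, duhamel ρ
          (fun x t => if 0 ≤ x ∧ eikonal ρ x ≤ t then k x t else 0) f x t = U x t := by
        intro x hx t
        simp only [duhamel, hU, hVdef]
        rw [hτe x hx]
        rcases le_total 0 (t - τ x) with h0 | h0
        · rw [← intervalIntegral.integral_const_mul]
          refine intervalIntegral.integral_congr fun s hs => ?_
          rw [uIcc_of_le h0] at hs
          have : τ x ≤ t - s := by linarith [hs.2]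
          simp only [hk, hx, this, and_self, if_true, mul_assoc]
          rw [sub_add_eq_add_sub, sub_right_comm]
        · rw [hzero _ _ _ h0, mul_zero]
          refine (intervalIntegral.integral_congr fun s hs => ?_).trans
            intervalIntegral.integral_zero
          rw [uIcc_of_ge h0] at hs
          simp [hfε s (by linarith [hs.2])]
      have dξt : ∀ x t, HasDerivAt (fun t => t + τ x) 1 t := fun x t =>
        (hasDerivAt_id t).add_const _
      have dηt : ∀ x t, HasDerivAt (fun t => t - τ x) 1 t := fun x t =>
        (hasDerivAt_id t).sub_const _
      have dξx : ∀ x t, HasDerivAt (fun x => t + τ x) (σ x) x := fun x t =>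
        (dτ x).const_add _
      have dηx : ∀ x t, HasDerivAt (fun x => t - τ x) (-σ x) x := fun x t =>
        (dτ x).const_sub _
      have dUt : ∀ x t, HasDerivAt (U x)
          (m x * (V₁ (t + τ x) (t - τ x) + V₂ (t + τ x) (t - τ x))) t := fun x t => by
        simpa using (hV.comp_curve (dξt x t) (dηt x t)).const_mul (m x)
      have dUx : ∀ t x, HasDerivAt (fun x => U x t) (m' x * V (t + τ x) (t - τ x) +
          m x * (σ x * (V₁ (t + τ x) (t - τ x) - V₂ (t + τ x) (t - τ x)))) x := fun t x => by
        have := (dm x).mul (hV.comp_curve (dξx x t) (dηx x t))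
        convert! this using 1; ring
      refine ⟨hUC.contDiffOn.congr fun z hz => hdU z.1 hz.1 z.2, ?_, ?_, ?_, ?_⟩
      · intro x hx t ht
        have e1 : (fun t' => duhamel ρ
            (fun x t => if 0 ≤ x ∧ eikonal ρ x ≤ t then k x t else 0) f x t') = U x :=
          funext fun t => hdU x hx.le t
        have e2 : (fun x' => duhamel ρ
            (fun x t => if 0 ≤ x ∧ eikonal ρ x ≤ t then k x t else 0) f x' t) =ᶠ[𝓝 x]
            fun x => U x t := by
          filter_upwards [Ioi_mem_nhds hx] with y hy using hdU y (le_of_lt hy) t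
        rw [e1, e2.iteratedDeriv_eq, hdU x hx.le]
        have h1 := iteratedDeriv_two_eq_of_mem_nhds univ_mem (fun t _ => dUt x t)
          (((hV1.comp_curve (dξt x t) (dηt x t)).add
            (hV2.comp_curve (dξt x t) (dηt x t))).const_mul (m x))
        have h2 := iteratedDeriv_two_eq_of_mem_nhds univ_mem (fun x _ => dUx t x)
          (((dm' x).mul (hV.comp_curve (dξx x t) (dηx x t))).add
            ((dm x).mul ((dσ x).mul ((hV1.comp_curve (dξx x t) (dηx x t)).sub
            (hV2.comp_curve (dξx x t) (dηx x t))))))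
        rw [h1, h2]
        have hpQ : p (t + τ x) (t - τ x) = Q₁ x / 4 := by
          simp only [hp]
          rw [show (t + τ x - (t - τ x)) / 2 = τ x by ring, hQτ x hx.le]
        have hρQ : σ x ^ 2 * Q₁ x = q x - w x := by
          rw [← hσσ x hx.le, hρexp x hx.le]
          simp only [hQ₁]
          rw [hqq hx.le, mul_comm, mul_assoc, ← Real.exp_add]
          simp
        rw [hσσ x hx.le, hpQ, show q x = σ x ^ 2 * Q₁ x + w x by rw [hρQ]; ring]
        simp only [hU, hm', hσ']
        ring
      · intro x hx
        rw [hdU x hx]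
        have hη : 0 - τ x ≤ 0 := by
          have := hρ.eikonal_nonneg hx
          rw [hτe x hx] at this; linarith
        simp only [hU, hVdef]
        rw [hzero _ _ _ hη, mul_zero]
      · intro x hx
        have e1 : (fun t' => duhamel ρ
            (fun x t => if 0 ≤ x ∧ eikonal ρ x ≤ t then k x t else 0) f x t') = U x :=
          funext fun t => hdU x hx t
        have hη : 0 - τ x ≤ 0 := by
          have := hρ.eikonal_nonneg hx
          rw [hτe x hx] at this; linarith
        rw [e1, (dUt x 0).hasDerivWithinAt.derivWithin (uniqueDiffOn_Ici 0 0 self_mem_Ici)]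
        simp only [hV1def, hV2def]
        rw [hzero _ _ _ hη, hzero _ _ _ hη, hfε _ (by linarith)]
        simp
      · intro t ht
        have e : EqOn (fun x' => duhamel ρ
            (fun x t => if 0 ≤ x ∧ eikonal ρ x ≤ t then k x t else 0) f x' t)
            (fun x => U x t) (Ici 0) := fun x hx => hdU x hx t
        rw [derivWithin_congr e (e self_mem_Ici),
          (dUx t 0).hasDerivWithinAt.derivWithin (uniqueDiffOn_Ici 0 0 self_mem_Ici)]
        have hτ0 : τ 0 = 0 := by simp [hτ]
        rw [hτ0, add_zero, sub_zero, hVrob t]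
        simp only [hm', hh, hK₀]
        have h1 := (σpos 0).ne'
        have h2 := (mpos 0).ne'
        field_simp
        ring

end

section

/-! ### Integral operators on the space of controls -/

variable {T : ℝ}

theorem inner_outer_eq (f g : Outer T) : ⟪f, g⟫ = ∫ t, f t * g t ∂timeMeasure T := by
  rw [L2.inner_def]
  exact integral_congr_ae (Eventually.of_forall fun t => by simp [mul_comm])

theorem integrable_outer (f : Outer T) : Integrable f (timeMeasure T) :=
  (Lp.memLp f).integrable one_le_two

theorem intervalIntegral_eq_timeMeasure (hT : 0 ≤ T) (F : ℝ → ℝ) :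
    ∫ t in (0 : ℝ)..T, F t = ∫ t, F t ∂timeMeasure T := by
  rw [intervalIntegral.integral_of_le hT, integral_Ioc_eq_integral_Ioo]

theorem ae_Ioc_of_ae_timeMeasure {p : ℝ → Prop} (h : ∀ᵐ t ∂timeMeasure T, p t) {a b : ℝ}
    (ha : 0 ≤ a) (hb : b ≤ T) : ∀ᵐ t ∂volume.restrict (Ioc a b), p t := by
  rw [← Measure.restrict_congr_set Ioo_ae_eq_Ioc]
  exact ae_mono (Measure.restrict_mono (Ioo_subset_Ioo ha hb) le_rfl) h

theorem integral_congr_timeMeasure {F G : ℝ → ℝ} (h : F =ᵐ[timeMeasure T] G) {a b : ℝ}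
    (ha : a ∈ Icc 0 T) (hb : b ∈ Icc 0 T) : ∫ t in a..b, F t = ∫ t in a..b, G t := by
  refine intervalIntegral.integral_congr_ae ?_
  rw [← ae_restrict_iff' measurableSet_uIoc]
  exact ae_Ioc_of_ae_timeMeasure h (le_min ha.1 hb.1) (max_le ha.2 hb.2)

theorem intervalIntegrable_outer (f : Outer T) {a b : ℝ} (ha : a ∈ Icc 0 T) (hb : b ∈ Icc 0 T) :
    IntervalIntegrable f volume a b := by
  rw [intervalIntegrable_iff, IntegrableOn]
  rw [uIoc, ← Measure.restrict_congr_set Ioo_ae_eq_Ioc]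
  exact (integrable_outer f).mono_measure
    (Measure.restrict_mono (Ioo_subset_Ioo (le_min ha.1 hb.1) (max_le ha.2 hb.2)) le_rfl)

theorem exists_bound_Icc {F : ℝ → ℝ} (hF : ContinuousOn F (Icc 0 T)) :
    ∃ C, 0 ≤ C ∧ ∀ t ∈ Icc 0 T, |F t| ≤ C := by
  obtain ⟨C, hC⟩ := isCompact_Icc.exists_bound_of_continuousOn hF
  exact ⟨max C 0, le_max_right _ _, fun t ht => (hC t ht).trans (le_max_left _ _)⟩

theorem ae_mem_timeMeasure : ∀ᵐ t ∂timeMeasure T, t ∈ Ioo 0 T :=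
  ae_restrict_mem measurableSet_Ioo

theorem memLp_of_continuousOn {F : ℝ → ℝ} (hF : ContinuousOn F (Icc 0 T)) :
    MemLp F 2 (timeMeasure T) := by
  obtain ⟨C, -, hC⟩ := exists_bound_Icc hF
  refine MemLp.of_bound ((hF.mono Ioo_subset_Icc_self).aestronglyMeasurable measurableSet_Ioo) C ?_
  filter_upwards [ae_mem_timeMeasure] with t ht using hC t (Ioo_subset_Icc_self ht)

open Classical in
/-- The class in `L₂(0,T)` of a square integrable function (zero for other functions). -/
noncomputable def toOuter (T : ℝ) (F : ℝ → ℝ) : Outer T :=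
  if h : MemLp F 2 (timeMeasure T) then h.toLp F else 0

theorem coeFn_toOuter {F : ℝ → ℝ} (hF : ContinuousOn F (Icc 0 T)) :
    toOuter T F =ᵐ[timeMeasure T] F := by
  have h := memLp_of_continuousOn hF
  rw [toOuter, dif_pos h]
  exact h.coeFn_toLp

/-- `k` is jointly measurable, and bounded on the square `(0,T)²`. -/
structure IsBoundedKernel (T : ℝ) (k : ℝ → ℝ → ℝ) : Prop where
  measurable : StronglyMeasurable (Function.uncurry k)
  bound : ∃ M, ∀ t ∈ Ioo 0 T, ∀ s ∈ Ioo 0 T, |k t s| ≤ M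

theorem IsBoundedKernel.memLp {k : ℝ → ℝ → ℝ} (hk : IsBoundedKernel T k) {t : ℝ}
    (ht : t ∈ Ioo 0 T) : MemLp (k t) 2 (timeMeasure T) := by
  obtain ⟨M, hM⟩ := hk.bound
  refine MemLp.of_bound (hk.measurable.comp_measurable measurable_prodMk_left).aestronglyMeasurable
    M ?_
  filter_upwards [ae_mem_timeMeasure] with s hs using hM t ht s hs

theorem IsBoundedKernel.integrable_mul {k : ℝ → ℝ → ℝ} (hk : IsBoundedKernel T k) {t : ℝ}
    (ht : t ∈ Ioo 0 T) (f : Outer T) : Integrable (fun s => k t s * f s) (timeMeasure T) := by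
  exact (hk.memLp ht).integrable_mul (Lp.memLp f)

/-- The Cauchy–Schwarz estimate for an integral operator with `‖k(t,·)‖ ≤ b`. -/
theorem IsBoundedKernel.abs_integral_le {k : ℝ → ℝ → ℝ} (hk : IsBoundedKernel T k) {t b : ℝ}
    (ht : t ∈ Ioo 0 T) (hb : 0 ≤ b) (hkb : ∫ s, k t s ^ 2 ∂timeMeasure T ≤ b ^ 2) (f : Outer T) :
    |∫ s, k t s * f s ∂timeMeasure T| ≤ b * ‖f‖ := by
  set K : Outer T := (hk.memLp ht).toLp _
  have hK : K =ᵐ[timeMeasure T] k t := (hk.memLp ht).coeFn_toLp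
  have h1 : ∫ s, k t s * f s ∂timeMeasure T = ⟪K, f⟫ := by
    rw [inner_outer_eq]
    exact integral_congr_ae (by filter_upwards [hK] with s hs; rw [hs])
  have h2 : ‖K‖ ≤ b := by
    refine abs_le_of_sq_le_sq' ?_ hb |>.2
    rw [← real_inner_self_eq_norm_sq, inner_outer_eq]
    refine le_trans (le_of_eq (integral_congr_ae ?_)) hkb
    filter_upwards [hK] with s hs
    rw [hs]; ring
  rw [h1]
  exact (abs_real_inner_le_norm _ _).trans (mul_le_mul_of_nonneg_right h2 (norm_nonneg _))

/-- A kernel with `‖k(t,·)‖ ≤ b` for all `t` defines an operator on `L₂(0,T)` of norm at most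
`T^{1/2} b`. -/
theorem exists_kernelOp {k : ℝ → ℝ → ℝ} (hk : IsBoundedKernel T k) {b : ℝ} (hb : 0 ≤ b)
    (hkb : ∀ t ∈ Ioo 0 T, ∫ s, k t s ^ 2 ∂timeMeasure T ≤ b ^ 2) :
    ∃ K : Outer T →L[ℝ] Outer T,
      (∀ f, K f =ᵐ[timeMeasure T] fun t => ∫ s, k t s * f s ∂timeMeasure T) ∧
      ‖K‖ ≤ measureUnivNNReal (timeMeasure T) ^ (2 : ENNReal).toReal⁻¹ * b := by
  have hmeas : ∀ f : Outer T,
      StronglyMeasurable fun t => ∫ s, k t s * f s ∂timeMeasure T := fun f =>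
    (hk.measurable.mul ((Lp.stronglyMeasurable f).comp_measurable
      measurable_snd)).integral_prod_right
  have hbd : ∀ f : Outer T, ∀ᵐ t ∂timeMeasure T,
      ‖∫ s, k t s * f s ∂timeMeasure T‖ ≤ b * ‖f‖ := fun f => by
    filter_upwards [ae_mem_timeMeasure] with t ht
    exact hk.abs_integral_le ht hb (hkb t ht) f
  have hmem : ∀ f : Outer T, MemLp (fun t => ∫ s, k t s * f s ∂timeMeasure T) 2 (timeMeasure T) :=
    fun f => MemLp.of_bound (hmeas f).aestronglyMeasurable _ (hbd f)
  let L : Outer T →ₗ[ℝ] Outer T :=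
    { toFun := fun f => (hmem f).toLp _
      map_add' := fun f g => by
        ext1
        filter_upwards [(hmem (f + g)).coeFn_toLp, (hmem f).coeFn_toLp, (hmem g).coeFn_toLp,
          Lp.coeFn_add ((hmem f).toLp _) ((hmem g).toLp _), ae_mem_timeMeasure]
          with t h1 h2 h3 h4 ht
        rw [h1, h4, Pi.add_apply, h2, h3, ← integral_add (hk.integrable_mul ht f)
          (hk.integrable_mul ht g)]
        refine integral_congr_ae ?_
        filter_upwards [Lp.coeFn_add f g] with s hs
        rw [hs, Pi.add_apply, mul_add]
      map_smul' := fun c f => by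
        ext1
        filter_upwards [(hmem (c • f)).coeFn_toLp, (hmem f).coeFn_toLp,
          Lp.coeFn_smul c ((hmem f).toLp _)] with t h1 h2 h3
        rw [h1, RingHom.id_apply, h3, Pi.smul_apply, h2, smul_eq_mul, ← integral_const_mul]
        refine integral_congr_ae ?_
        filter_upwards [Lp.coeFn_smul c f] with s hs
        rw [hs, Pi.smul_apply, smul_eq_mul]; ring }
  have hL : ∀ f, ‖L f‖ ≤ (measureUnivNNReal (timeMeasure T) ^ (2 : ENNReal).toReal⁻¹ * b) * ‖f‖ := by
    intro f
    rw [mul_assoc]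
    refine Lp.norm_le_of_ae_bound (by positivity) ?_
    filter_upwards [(hmem f).coeFn_toLp, hbd f] with t h1 h2
    change ‖((hmem f).toLp _ : Outer T) t‖ ≤ _
    rw [h1]; exact h2
  exact ⟨L.mkContinuous _ hL, fun f => (hmem f).coeFn_toLp,
    L.mkContinuous_norm_le (by positivity) hL⟩

open Classical in
/-- The integral operator on `L₂(0,T)` with the kernel `k` (zero if there is no such operator). -/
noncomputable def kernelOp (T : ℝ) (k : ℝ → ℝ → ℝ) : Outer T →L[ℝ] Outer T :=
  if h : ∃ K : Outer T →L[ℝ] Outer T,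
    ∀ f, K f =ᵐ[timeMeasure T] fun t => ∫ s, k t s * f s ∂timeMeasure T then h.choose else 0

theorem IsBoundedKernel.exists_sq_le {k : ℝ → ℝ → ℝ} (hk : IsBoundedKernel T k) :
    ∃ b, 0 ≤ b ∧ ∀ t ∈ Ioo 0 T, ∫ s, k t s ^ 2 ∂timeMeasure T ≤ b ^ 2 := by
  obtain ⟨M, hM⟩ := hk.bound
  refine ⟨Real.sqrt (∫ _, M ^ 2 ∂timeMeasure T), Real.sqrt_nonneg _, fun t ht => ?_⟩
  rw [Real.sq_sqrt (integral_nonneg fun _ => sq_nonneg _)]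
  refine integral_mono_ae (hk.memLp ht).integrable_sq (integrable_const _) ?_
  filter_upwards [ae_mem_timeMeasure] with s hs
  exact sq_le_sq.2 ((hM t ht s hs).trans (le_abs_self _))

theorem coeFn_kernelOp {k : ℝ → ℝ → ℝ} (hk : IsBoundedKernel T k) (f : Outer T) :
    kernelOp T k f =ᵐ[timeMeasure T] fun t => ∫ s, k t s * f s ∂timeMeasure T := by
  obtain ⟨b, hb, hkb⟩ := hk.exists_sq_le
  obtain ⟨K, hK, -⟩ := exists_kernelOp hk hb hkb
  have h : ∃ K : Outer T →L[ℝ] Outer T,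
    ∀ f, K f =ᵐ[timeMeasure T] fun t => ∫ s, k t s * f s ∂timeMeasure T := ⟨K, hK⟩
  rw [kernelOp, dif_pos h]
  exact h.choose_spec f

theorem norm_kernelOp_le {k : ℝ → ℝ → ℝ} (hk : IsBoundedKernel T k) {b : ℝ} (hb : 0 ≤ b)
    (hkb : ∀ t ∈ Ioo 0 T, ∫ s, k t s ^ 2 ∂timeMeasure T ≤ b ^ 2) :
    ‖kernelOp T k‖ ≤ measureUnivNNReal (timeMeasure T) ^ (2 : ENNReal).toReal⁻¹ * b := by
  obtain ⟨K, hK, hKb⟩ := exists_kernelOp hk hb hkb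
  have : kernelOp T k = K := by
    ext1 f; ext1
    exact (coeFn_kernelOp hk f).trans (hK f).symm
  rwa [this]

theorem IsBoundedKernel.swap {k : ℝ → ℝ → ℝ} (hk : IsBoundedKernel T k) :
    IsBoundedKernel T fun t s => k s t where
  measurable := hk.measurable.comp_measurable measurable_swap
  bound := by
    obtain ⟨M, hM⟩ := hk.bound
    exact ⟨M, fun t ht s hs => hM s hs t ht⟩

/-- The adjoint of an integral operator has the transposed kernel. -/
theorem adjoint_kernelOp {k : ℝ → ℝ → ℝ} (hk : IsBoundedKernel T k) :
    ContinuousLinearMap.adjoint (kernelOp T k) = kernelOp T fun t s => k s t := by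
  symm
  rw [ContinuousLinearMap.eq_adjoint_iff]
  intro g f
  rw [inner_outer_eq, inner_outer_eq]
  have h1 : ∫ t, kernelOp T (fun t s => k s t) g t * f t ∂timeMeasure T =
      ∫ t, ∫ s, k s t * g s * f t ∂timeMeasure T ∂timeMeasure T := by
    refine integral_congr_ae ?_
    filter_upwards [coeFn_kernelOp hk.swap g] with t ht
    rw [ht, ← integral_mul_const]
  have h2 : ∫ s, g s * kernelOp T k f s ∂timeMeasure T =
      ∫ s, ∫ t, k s t * g s * f t ∂timeMeasure T ∂timeMeasure T := by
    refine integral_congr_ae ?_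
    filter_upwards [coeFn_kernelOp hk f] with s hs
    rw [hs, ← integral_const_mul]
    exact integral_congr_ae (Eventually.of_forall fun t => by simp only; ring)
  rw [h1, h2]
  refine integral_integral_swap ?_
  obtain ⟨M, hM⟩ := hk.bound
  have hfg : Integrable (fun z : ℝ × ℝ => f z.1 * g z.2) ((timeMeasure T).prod (timeMeasure T)) :=
    (integrable_outer f).mul_prod (integrable_outer g)
  have hfgk := hfg.bdd_mul (f := fun z : ℝ × ℝ => k z.2 z.1) (c := M)
    (hk.swap.measurable.aestronglyMeasurable) (by
      rw [Measure.prod_restrict]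
      filter_upwards [ae_restrict_mem (measurableSet_Ioo.prod measurableSet_Ioo)] with z hz
      exact hM _ hz.2 _ hz.1)
  refine hfgk.congr (Eventually.of_forall fun z => ?_)
  simp only [Function.uncurry]; ring

/-- The kernel `k` cut off to the triangle `s ≤ t`. -/
noncomputable def triangle (k : ℝ → ℝ → ℝ) (t s : ℝ) : ℝ := if s ≤ t then k t s else 0

theorem isBoundedKernel_of_continuous {k : ℝ → ℝ → ℝ} (hk : Continuous (Function.uncurry k)) :
    IsBoundedKernel T k where
  measurable := hk.stronglyMeasurable
  bound := by
    obtain ⟨M, hM⟩ := ((isCompact_Icc (a := 0) (b := T)).prod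
      (isCompact_Icc (a := 0) (b := T))).exists_bound_of_continuousOn hk.continuousOn
    exact ⟨M, fun t ht s hs => hM (t, s) ⟨Ioo_subset_Icc_self ht, Ioo_subset_Icc_self hs⟩⟩

theorem isBoundedKernel_triangle {k : ℝ → ℝ → ℝ} (hk : Continuous (Function.uncurry k)) :
    IsBoundedKernel T (triangle k) where
  measurable := by
    have : Function.uncurry (triangle k) = fun p : ℝ × ℝ => if p.2 ≤ p.1 then k p.1 p.2 else 0 := rfl
    rw [this]
    exact StronglyMeasurable.ite (measurableSet_le measurable_snd measurable_fst)
      hk.stronglyMeasurable stronglyMeasurable_const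
  bound := by
    obtain ⟨M, hM⟩ := (isBoundedKernel_of_continuous (T := T) hk).bound
    refine ⟨M, fun t ht s hs => ?_⟩
    unfold triangle
    split_ifs
    · exact hM t ht s hs
    · simpa using (abs_nonneg _).trans (hM t ht s hs)

theorem integral_triangle {k : ℝ → ℝ → ℝ} (F : ℝ → ℝ → ℝ → ℝ) (h0 : ∀ t s, F t s 0 = 0) {t : ℝ}
    (ht : t ∈ Ioo 0 T) :
    ∫ s, F t s (triangle k t s) ∂timeMeasure T = ∫ s in (0 : ℝ)..t, F t s (k t s) := by
  rw [intervalIntegral.integral_of_le ht.1.le]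
  have e : ∀ s, F t s (triangle k t s) = (Iic t).indicator (fun s => F t s (k t s)) s := by
    intro s
    by_cases hs : s ≤ t
    · simp [triangle, hs]
    · simp [triangle, hs, h0]
  simp_rw [e]
  rw [integral_indicator measurableSet_Iic, Measure.restrict_restrict measurableSet_Iic]
  congr 2
  ext s
  simp only [mem_inter_iff, mem_Iic, mem_Ioo, mem_Ioc]
  constructor
  · rintro ⟨h1, h2, h3⟩; exact ⟨h2, h1⟩
  · rintro ⟨h1, h2⟩; exact ⟨h2, h1, h2.trans_lt ht.2⟩

/-- The Volterra operator `f ↦ ∫₀ᵗ k(t,s) f(s) ds` on `L₂(0,T)`. -/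
noncomputable def volterraOp (T : ℝ) (k : ℝ → ℝ → ℝ) : Outer T →L[ℝ] Outer T :=
  kernelOp T (triangle k)

theorem coeFn_volterraOp {k : ℝ → ℝ → ℝ} (hk : Continuous (Function.uncurry k)) (f : Outer T) :
    volterraOp T k f =ᵐ[timeMeasure T] fun t => ∫ s in (0 : ℝ)..t, k t s * f s := by
  filter_upwards [coeFn_kernelOp (isBoundedKernel_triangle hk) f, ae_mem_timeMeasure] with t h ht
  rw [volterraOp, h]
  exact integral_triangle (fun _ s x => x * f s) (by simp) ht

theorem exists_mulOp (T : ℝ) {β : ℝ → ℝ} (hβ : Continuous β) :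
    ∃ M : Outer T →L[ℝ] Outer T, ∀ f, M f =ᵐ[timeMeasure T] fun t => β t * f t := by
  obtain ⟨C, hC0, hC⟩ := exists_bound_Icc (T := T) hβ.continuousOn
  have hbd : ∀ f : Outer T, ∀ᵐ t ∂timeMeasure T, ‖β t * f t‖ ≤ C * ‖f t‖ := fun f => by
    filter_upwards [ae_mem_timeMeasure] with t ht
    rw [norm_mul]
    exact mul_le_mul_of_nonneg_right (hC t (Ioo_subset_Icc_self ht)) (norm_nonneg _)
  have hmem : ∀ f : Outer T, MemLp (fun t => β t * f t) 2 (timeMeasure T) := fun f =>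
    (Lp.memLp f).of_le_mul (hβ.aestronglyMeasurable.mul (Lp.aestronglyMeasurable f)) (hbd f)
  let L : Outer T →ₗ[ℝ] Outer T :=
    { toFun := fun f => (hmem f).toLp _
      map_add' := fun f g => by
        ext1
        filter_upwards [(hmem (f + g)).coeFn_toLp, (hmem f).coeFn_toLp, (hmem g).coeFn_toLp,
          Lp.coeFn_add ((hmem f).toLp _) ((hmem g).toLp _), Lp.coeFn_add f g]
          with t h1 h2 h3 h4 h5
        rw [h1, h4, Pi.add_apply, h2, h3, h5, Pi.add_apply, mul_add]
      map_smul' := fun c f => by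
        ext1
        filter_upwards [(hmem (c • f)).coeFn_toLp, (hmem f).coeFn_toLp,
          Lp.coeFn_smul c ((hmem f).toLp _), Lp.coeFn_smul c f] with t h1 h2 h3 h4
        rw [h1, RingHom.id_apply, h3, Pi.smul_apply, h2, h4, Pi.smul_apply]
        simp only [smul_eq_mul]; ring }
  refine ⟨L.mkContinuous C fun f => Lp.norm_le_mul_norm_of_ae_le_mul ?_, fun f =>
    (hmem f).coeFn_toLp⟩
  filter_upwards [(hmem f).coeFn_toLp, hbd f] with t h1 h2
  change ‖((hmem f).toLp _ : Outer T) t‖ ≤ _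
  rw [h1]; exact h2

theorem integral_exp_triangle_le {lam t : ℝ} (hl : 0 < lam) :
    ∫ s in (0 : ℝ)..t, Real.exp (-(2 * lam) * (t - s)) ≤ 1 / (2 * lam) := by
  have hd : ∀ s ∈ uIcc 0 t, HasDerivAt (fun s => Real.exp (-(2 * lam) * (t - s)) / (2 * lam))
      (Real.exp (-(2 * lam) * (t - s))) s := fun s _ => by
    have := ((((hasDerivAt_id s).const_sub t).const_mul (-(2 * lam))).exp).div_const (2 * lam)
    refine this.congr_deriv ?_
    simp only [id]
    field_simp
  rw [intervalIntegral.integral_eq_sub_of_hasDerivAt hd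
    ((by fun_prop : Continuous fun s => Real.exp (-(2 * lam) * (t - s))).intervalIntegrable _ _)]
  have : 0 < Real.exp (-(2 * lam) * (t - 0)) / (2 * lam) := by positivity
  simp only [sub_self, mul_zero, Real.exp_zero]
  linarith

/-- Conjugation by `e^{-λt}` with a large `λ` makes the norm of a Volterra operator less than one. -/
theorem exists_norm_volterraOp_lt_one (T : ℝ) {N : ℝ → ℝ → ℝ}
    (hN : Continuous (Function.uncurry N)) :
    ∃ lam : ℝ, ‖volterraOp T fun t s => Real.exp (-lam * (t - s)) * N t s‖ < 1 := by
  obtain ⟨M, hM⟩ := (isBoundedKernel_of_continuous (T := T) hN).bound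
  set D : ℝ := measureUnivNNReal (timeMeasure T) ^ (2 : ENNReal).toReal⁻¹ with hD
  have hD0 : 0 ≤ D := by positivity
  -- `D² M² / (2λ) < 1` for this `λ`, where `D = T^{1/2}`
  set lam : ℝ := (M ^ 2 + 1) * (D ^ 2 + 1) / 2 with hlam
  have hl : 0 < lam := by positivity
  refine ⟨lam, ?_⟩
  have hc : Continuous (Function.uncurry fun t s => Real.exp (-lam * (t - s)) * N t s) :=
    (by fun_prop : Continuous fun p : ℝ × ℝ => Real.exp (-lam * (p.1 - p.2))).mul hN
  have hle := norm_kernelOp_le (isBoundedKernel_triangle (T := T) hc)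
    (b := Real.sqrt (M ^ 2 / (2 * lam))) (Real.sqrt_nonneg _) (fun t ht => by
      rw [integral_triangle (fun _ _ x => x ^ 2) (by simp) ht, Real.sq_sqrt (by positivity)]
      have h1 : ∫ s in (0 : ℝ)..t, (Real.exp (-lam * (t - s)) * N t s) ^ 2 ≤
          ∫ s in (0 : ℝ)..t, M ^ 2 * Real.exp (-(2 * lam) * (t - s)) := by
        refine intervalIntegral.integral_mono_on_of_le_Ioo ht.1.le
          (((hc.uncurry_left t).pow 2).intervalIntegrable _ _)
          ((by fun_prop : Continuous fun s =>
            M ^ 2 * Real.exp (-(2 * lam) * (t - s))).intervalIntegrable _ _) fun s hs => ?_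
        have h2 : N t s ^ 2 ≤ M ^ 2 :=
          sq_le_sq.2 ((hM t ht s ⟨hs.1, hs.2.trans ht.2⟩).trans (le_abs_self _))
        have h3 : Real.exp (-lam * (t - s)) ^ 2 = Real.exp (-(2 * lam) * (t - s)) := by
          rw [sq, ← Real.exp_add]; congr 1; ring
        rw [mul_pow, h3, mul_comm]
        exact mul_le_mul_of_nonneg_right h2 (Real.exp_pos _).le
      refine h1.trans ?_
      rw [intervalIntegral.integral_const_mul, div_eq_mul_one_div (M ^ 2)]
      exact mul_le_mul_of_nonneg_left (integral_exp_triangle_le hl) (sq_nonneg _))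
  refine lt_of_le_of_lt hle ?_
  rw [← hD]
  have h2 : (D * Real.sqrt (M ^ 2 / (2 * lam))) ^ 2 < 1 ^ 2 := by
    rw [mul_pow, Real.sq_sqrt (by positivity), mul_div_assoc', div_lt_iff₀ (by positivity), hlam]
    nlinarith [sq_nonneg M, sq_nonneg D]
  exact lt_of_pow_lt_pow_left₀ 2 zero_le_one h2

theorem bijective_of_isUnit_one_add {E : Type*} [NormedAddCommGroup E] [NormedSpace ℝ E]
    [CompleteSpace E] {S : E →L[ℝ] E} (hS : ‖S‖ < 1) : Function.Bijective fun f => f + S f := by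
  have : IsUnit (1 - (-S)) := isUnit_one_sub_of_norm_lt_one (by rwa [norm_neg])
  rw [ContinuousLinearMap.isUnit_iff_bijective] at this
  convert this using 1
  ext f; simp

/-- Volterra operators of the second kind with a nonvanishing coefficient are bijective. -/
theorem exists_volterra_second_kind (T : ℝ) {β : ℝ → ℝ} {κ : ℝ → ℝ → ℝ} (hβ : Continuous β)
    (hβ0 : ∀ t, β t ≠ 0) (hκ : Continuous (Function.uncurry κ)) :
    ∃ L : Outer T →L[ℝ] Outer T, Function.Bijective L ∧
      ∀ f, L f =ᵐ[timeMeasure T] fun t => β t * f t + ∫ s in (0 : ℝ)..t, κ t s * f s := by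
  obtain ⟨Mβ, hMβ⟩ := exists_mulOp T hβ
  have hLf : ∀ f, (Mβ + volterraOp T κ) f =ᵐ[timeMeasure T]
      fun t => β t * f t + ∫ s in (0 : ℝ)..t, κ t s * f s := fun f => by
    filter_upwards [Lp.coeFn_add (Mβ f) (volterraOp T κ f), hMβ f, coeFn_volterraOp hκ f]
      with t h1 h2 h3
    rw [add_apply, h1, Pi.add_apply, h2, h3]
  refine ⟨Mβ + volterraOp T κ, ?_, hLf⟩
  set N : ℝ → ℝ → ℝ := fun t s => κ t s / β t
  have hN : Continuous (Function.uncurry N) := hκ.div (hβ.comp continuous_fst) fun p => hβ0 _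
  obtain ⟨lam, hlam⟩ := exists_norm_volterraOp_lt_one T hN
  set Nl : ℝ → ℝ → ℝ := fun t s => Real.exp (-lam * (t - s)) * N t s
  have hNl : Continuous (Function.uncurry Nl) :=
    (by fun_prop : Continuous fun p : ℝ × ℝ => Real.exp (-lam * (p.1 - p.2))).mul hN
  -- `L = E (1 + N_λ) F`, where `F` and `E` multiply by `e^{-λt}` and `β e^{λt}`
  have hbij : ∀ γ : ℝ → ℝ, Continuous γ → (∀ t, γ t ≠ 0) → ∃ M : Outer T →L[ℝ] Outer T,
      Function.Bijective M ∧ ∀ f, M f =ᵐ[timeMeasure T] fun t => γ t * f t := by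
    intro γ hγ hγ0
    obtain ⟨M, hM⟩ := exists_mulOp T hγ
    obtain ⟨M', hM'⟩ := exists_mulOp T (hγ.inv₀ hγ0)
    refine ⟨M, Function.bijective_iff_has_inverse.2 ⟨M', fun f => ?_, fun f => ?_⟩, hM⟩
    · ext1
      filter_upwards [hM f, hM' (M f)] with t h1 h2
      rw [h2, h1, Pi.inv_apply, inv_mul_cancel_left₀ (hγ0 t)]
    · ext1
      filter_upwards [hM' f, hM (M' f)] with t h1 h2
      rw [h2, h1, Pi.inv_apply, mul_inv_cancel_left₀ (hγ0 t)]
  obtain ⟨F, hFb, hF⟩ := hbij (fun t => Real.exp (-lam * t)) (by fun_prop)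
    fun t => (Real.exp_pos _).ne'
  obtain ⟨E, hEb, hE⟩ := hbij (fun t => β t * Real.exp (lam * t)) (by fun_prop)
    fun t => mul_ne_zero (hβ0 t) (Real.exp_pos _).ne'
  have hcomp := hEb.comp ((bijective_of_isUnit_one_add hlam).comp hFb)
  convert hcomp using 1
  ext1 f
  ext1
  filter_upwards [hLf f, hE (F f + volterraOp T Nl (F f)), hF f,
    Lp.coeFn_add (F f) (volterraOp T Nl (F f)), coeFn_volterraOp hNl (F f), ae_mem_timeMeasure]
    with t h1 h2 h3 h4 h5 ht
  simp only [Function.comp_apply]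
  rw [h1, h2, h4, Pi.add_apply, h3, h5]
  have h6 : ∫ s in (0 : ℝ)..t, Nl t s * F f s =
      ∫ s in (0 : ℝ)..t, Nl t s * (Real.exp (-lam * s) * f s) :=
    integral_congr_timeMeasure (T := T) (by filter_upwards [hF f] with s hs; rw [hs])
      ⟨le_rfl, ht.1.le.trans ht.2.le⟩ ⟨ht.1.le, ht.2.le⟩
  have h7 : ∀ s, Nl t s * (Real.exp (-lam * s) * f s) =
      (Real.exp (-lam * t) / β t) * (κ t s * f s) := by
    intro s
    have : Real.exp (-lam * (t - s)) * Real.exp (-lam * s) = Real.exp (-lam * t) := by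
      rw [← Real.exp_add]; congr 1; ring
    simp only [Nl, N]
    rw [← this]; ring
  rw [h6]
  simp_rw [h7]
  rw [intervalIntegral.integral_const_mul]
  have h8 : Real.exp (-lam * t) = (Real.exp (lam * t))⁻¹ := by rw [← Real.exp_neg]; congr 1; ring
  rw [h8]
  have := Real.exp_pos (lam * t)
  have := hβ0 t
  field_simp

end

section

/-! ### Time derivatives and test controls -/

variable {T : ℝ}

/-- Integration `f ↦ ∫₀ᵗ f`, the inverse of `d/dt` with the initial condition `f(0) = 0`. -/
noncomputable def integOp (T : ℝ) : Outer T →L[ℝ] Outer T := volterraOp T fun _ _ => 1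

theorem coeFn_integOp (f : Outer T) :
    integOp T f =ᵐ[timeMeasure T] fun t => ∫ s in (0 : ℝ)..t, f s := by
  refine (coeFn_volterraOp (T := T) (k := fun _ _ => 1) continuous_const f).trans ?_
  simp only [one_mul]
  exact EventuallyEq.rfl

theorem integral_triangle_swap (k : ℝ → ℝ → ℝ) (f : ℝ → ℝ) {t : ℝ} (ht : t ∈ Ioo 0 T) :
    ∫ s, triangle k s t * f s ∂timeMeasure T = ∫ s in t..T, k s t * f s := by
  rw [intervalIntegral.integral_of_le ht.2.le, integral_Ioc_eq_integral_Ioo]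
  have e : ∀ s, triangle k s t * f s = (Ici t).indicator (fun s => k s t * f s) s := by
    intro s
    by_cases hs : t ≤ s
    · simp [triangle, hs]
    · simp [triangle, hs]
  simp_rw [e]
  rw [integral_indicator measurableSet_Ici, Measure.restrict_restrict measurableSet_Ici]
  rw [← integral_Ico_eq_integral_Ioo]
  congr 2
  ext s
  simp only [mem_inter_iff, mem_Ici, mem_Ioo, mem_Ico]
  constructor
  · rintro ⟨h1, h2, h3⟩; exact ⟨h1, h3⟩
  · rintro ⟨h1, h2⟩; exact ⟨h1, ht.1.trans_le h1, h2⟩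

theorem coeFn_adjoint_integOp (f : Outer T) :
    ContinuousLinearMap.adjoint (integOp T) f =ᵐ[timeMeasure T] fun t => ∫ s in t..T, f s := by
  have hk := isBoundedKernel_triangle (T := T) (k := fun _ _ => 1) continuous_const
  rw [integOp, volterraOp, adjoint_kernelOp hk]
  filter_upwards [coeFn_kernelOp hk.swap f, ae_mem_timeMeasure] with t h ht
  rw [h, integral_triangle_swap _ _ ht]
  simp only [one_mul]

/-- The relation `h = df/dt` with `f(0) = 0` is the graph of the inverse of `integOp`. -/
theorem isTimeDeriv_iff (f h : Outer T) : IsTimeDeriv T f h ↔ f = integOp T h := by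
  constructor
  · rintro ⟨φ, ⟨hf, hφ⟩, h0⟩
    ext1
    filter_upwards [hf, coeFn_integOp h, ae_mem_timeMeasure] with t h1 h2 ht
    rw [h1, h2, hφ t (Ioo_subset_Icc_self ht), h0, zero_add]
  · rintro rfl
    exact ⟨_, ⟨coeFn_integOp h, fun t _ => by simp⟩, by simp⟩

/-- The relation `h = -df/dt` with `f(T) = 0` is the graph of the inverse of the adjoint of
`integOp`. -/
theorem isAdjointTimeDeriv_iff (hT : 0 < T) (f h : Outer T) :
    IsAdjointTimeDeriv T f h ↔ f = ContinuousLinearMap.adjoint (integOp T) h := by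
  have h0T : (0 : ℝ) ∈ Icc 0 T := ⟨le_rfl, hT.le⟩
  have hTT : T ∈ Icc 0 T := ⟨hT.le, le_rfl⟩
  have hneg : ∀ t ∈ Icc 0 T, ∫ s in (0 : ℝ)..t, (-h : Outer T) s = -∫ s in (0 : ℝ)..t, h s := by
    intro t ht
    rw [integral_congr_timeMeasure (Lp.coeFn_neg h) h0T ht, ← intervalIntegral.integral_neg]
    rfl
  have hsplit : ∀ t ∈ Icc 0 T, (∫ s in (0 : ℝ)..t, h s) + ∫ s in t..T, h s =
      ∫ s in (0 : ℝ)..T, h s := fun t ht =>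
    intervalIntegral.integral_add_adjacent_intervals (intervalIntegrable_outer h h0T ht)
      (intervalIntegrable_outer h ht hTT)
  constructor
  · rintro ⟨φ, ⟨hf, hφ⟩, hφT⟩
    ext1
    filter_upwards [hf, coeFn_adjoint_integOp h, ae_mem_timeMeasure] with t h1 h2 ht
    have ht := Ioo_subset_Icc_self ht
    have h3 := hφ T hTT
    rw [hneg T hTT, hφT] at h3
    rw [h1, h2, hφ t ht, hneg t ht]
    linarith [hsplit t ht]
  · rintro rfl
    refine ⟨_, ⟨coeFn_adjoint_integOp h, fun t ht => ?_⟩, by simp⟩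
    rw [hneg t ht]
    linarith [hsplit t ht]

/-- Smooth controls vanishing near both ends of `(0,T)`, extended by zero to the line. -/
structure IsTest (T : ℝ) (g : ℝ → ℝ) : Prop where
  contDiff : ContDiff ℝ ∞ g
  vanishes : ∃ ε > 0, (∀ t < ε, g t = 0) ∧ ∀ t > T - ε, g t = 0

theorem IsTest.deriv {g : ℝ → ℝ} (hg : IsTest T g) : IsTest T (deriv g) where
  contDiff := (contDiff_infty_iff_deriv.1 hg.contDiff).2
  vanishes := by
    obtain ⟨ε, hε, h0, h1⟩ := hg.vanishes
    refine ⟨ε, hε, fun t ht => ?_, fun t ht => ?_⟩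
    · have : g =ᶠ[𝓝 t] fun _ => 0 := by filter_upwards [Iio_mem_nhds ht] with s hs using h0 s hs
      rw [this.deriv_eq]; simp
    · have : g =ᶠ[𝓝 t] fun _ => 0 := by filter_upwards [Ioi_mem_nhds ht] with s hs using h1 s hs
      rw [this.deriv_eq]; simp

theorem IsTest.hasDerivAt {g : ℝ → ℝ} (hg : IsTest T g) (t : ℝ) :
    HasDerivAt g (_root_.deriv g t) t :=
  (hg.contDiff.differentiable (by simp) t).hasDerivAt

theorem IsTest.continuousOn {g : ℝ → ℝ} (hg : IsTest T g) : ContinuousOn g (Icc 0 T) :=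
  hg.contDiff.continuous.continuousOn

theorem IsTest.apply_zero {g : ℝ → ℝ} (hg : IsTest T g) : g 0 = 0 := by
  obtain ⟨ε, hε, h0, h1⟩ := hg.vanishes
  exact h0 0 hε

theorem IsTest.apply_of_ge {g : ℝ → ℝ} (hg : IsTest T g) {t : ℝ} (ht : T ≤ t) : g t = 0 := by
  obtain ⟨ε, hε, h0, h1⟩ := hg.vanishes
  exact h1 t (by linarith)

theorem IsTest.of_tsupport {g : ℝ → ℝ} (hg : ContDiff ℝ ∞ g) (hc : HasCompactSupport g)
    (hs : tsupport g ⊆ Ioo 0 T) : IsTest T g where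
  contDiff := hg
  vanishes := by
    obtain ⟨δ, hδ, h⟩ := hc.isCompact.exists_thickening_subset_open isOpen_Ioo hs
    have key : ∀ t, g t ≠ 0 → ∀ s, |s - t| < δ → s ∈ Ioo 0 T := fun t ht s hst =>
      h (Metric.mem_thickening_iff.2 ⟨t, subset_tsupport g ht, by rwa [Real.dist_eq]⟩)
    refine ⟨δ / 2, by linarith, fun t ht => ?_, fun t ht => ?_⟩
    · by_contra hne
      have := (key t hne (t - δ / 2) (by rw [abs_lt]; constructor <;> linarith)).1
      linarith
    · by_contra hne
      have := (key t hne (t + δ / 2) (by rw [abs_lt]; constructor <;> linarith)).2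
      linarith

/-- The fundamental lemma of the calculus of variations in `L₂(0,T)`. -/
theorem eq_zero_of_forall_test (f : Outer T)
    (h : ∀ g, IsTest T g → ∫ t, g t * f t ∂timeMeasure T = 0) : f = 0 := by
  have h1 : ∀ᵐ t, t ∈ Ioo 0 T → f t = 0 := by
    refine isOpen_Ioo.ae_eq_zero_of_integral_contDiff_smul_eq_zero
      (IntegrableOn.locallyIntegrableOn (integrable_outer f)) fun g hg hc hs => ?_
    rw [← h g (IsTest.of_tsupport hg hc hs)]
    refine (setIntegral_eq_integral_of_forall_compl_eq_zero fun t ht => ?_).symm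
    simp [image_eq_zero_of_notMem_tsupport fun h => ht (hs h)]
  ext1
  filter_upwards [(ae_restrict_iff' measurableSet_Ioo).2 h1, Lp.coeFn_zero ℝ 2 (timeMeasure T)]
    with t h2 h3
  rw [h2, h3, Pi.zero_apply]

theorem inner_toOuter {F : ℝ → ℝ} (hF : ContinuousOn F (Icc 0 T)) (f : Outer T) :
    ⟪toOuter T F, f⟫ = ∫ t, F t * f t ∂timeMeasure T := by
  rw [inner_outer_eq]
  exact integral_congr_ae (by filter_upwards [coeFn_toOuter hF] with t ht; rw [ht])

theorem dense_span_test :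
    Dense (Submodule.span ℝ (toOuter T '' {g | IsTest T g}) : Set (Outer T)) := by
  rw [Submodule.dense_iff_topologicalClosure_eq_top, Submodule.topologicalClosure_eq_top_iff,
    Submodule.eq_bot_iff]
  intro f hf
  refine eq_zero_of_forall_test f fun g hg => ?_
  rw [← inner_toOuter hg.continuousOn]
  exact (Submodule.mem_orthogonal _ f).1 hf _ (Submodule.subset_span ⟨g, hg, rfl⟩)

/-- Bounded operators that agree on the test controls are equal. -/
theorem ext_test {E : Type*} [NormedAddCommGroup E] [NormedSpace ℝ E] {S S' : Outer T →L[ℝ] E}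
    (h : ∀ g, IsTest T g → S (toOuter T g) = S' (toOuter T g)) : S = S' :=
  ContinuousLinearMap.ext_on dense_span_test (by rintro _ ⟨g, hg, rfl⟩; exact h g hg)

theorem integral_deriv_test {g : ℝ → ℝ} (hg : IsTest T g) (t : ℝ) :
    ∫ s in (0 : ℝ)..t, deriv g s = g t := by
  rw [intervalIntegral.integral_eq_sub_of_hasDerivAt (fun s _ => hg.hasDerivAt s)
    (hg.deriv.contDiff.continuous.intervalIntegrable _ _), hg.apply_zero, sub_zero]

theorem integral_congr_toOuter {F : ℝ → ℝ} (hF : ContinuousOn F (Icc 0 T)) (k : ℝ → ℝ) {a b : ℝ}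
    (ha : a ∈ Icc 0 T) (hb : b ∈ Icc 0 T) :
    ∫ s in a..b, k s * toOuter T F s = ∫ s in a..b, k s * F s :=
  integral_congr_timeMeasure (by filter_upwards [coeFn_toOuter hF] with s hs; rw [hs]) ha hb

theorem integOp_deriv_test {g : ℝ → ℝ} (hg : IsTest T g) :
    integOp T (toOuter T (deriv g)) = toOuter T g := by
  ext1
  filter_upwards [coeFn_integOp (toOuter T (deriv g)), coeFn_toOuter hg.continuousOn,
    ae_mem_timeMeasure] with t h1 h2 ht
  have := integral_congr_toOuter hg.deriv.continuousOn (fun _ => 1)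
    (⟨le_rfl, ht.1.le.trans ht.2.le⟩ : (0 : ℝ) ∈ Icc 0 T) (Ioo_subset_Icc_self ht)
  simp only [one_mul] at this
  rw [h1, h2, this, integral_deriv_test hg]

/-- Bounded operators that agree on the domain of `d/dt` are equal. -/
theorem ext_comp_integOp {E : Type*} [NormedAddCommGroup E] [NormedSpace ℝ E]
    {S S' : Outer T →L[ℝ] E} (h : ∀ f, S (integOp T f) = S' (integOp T f)) : S = S' :=
  ext_test fun g hg => by rw [← integOp_deriv_test hg]; exact h _

theorem adjoint_integOp_injective :
    Function.Injective (ContinuousLinearMap.adjoint (integOp T)) := by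
  refine (injective_iff_map_eq_zero _).2 fun f hf => ?_
  refine eq_zero_of_forall_test f fun g hg => ?_
  rw [← inner_toOuter hg.continuousOn, ← integOp_deriv_test hg,
    ← ContinuousLinearMap.adjoint_inner_right, hf, inner_zero_right]

/-! ### Passage from optical time to the space variable -/

/-- Composition with a map whose image measure is dominated. -/
noncomputable def compOp {α β : Type*} [MeasurableSpace α] [MeasurableSpace β] {μ : Measure α}
    {ν : Measure β} {ψ : α → β} (hψ : Measurable ψ) {c : ENNReal} (hc : c ≠ ⊤)
    (h : μ.map ψ ≤ c • ν) : Lp ℝ 2 ν →L[ℝ] Lp ℝ 2 μ :=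
  (Lp.compMeasurePreservingₗᵢ ℝ ψ (⟨hψ, rfl⟩ : MeasurePreserving ψ μ
    (μ.map ψ))).toContinuousLinearMap.comp (Lp.LpToLpOfMeasureLeSMul hc h)

theorem coeFn_compOp {α β : Type*} [MeasurableSpace α] [MeasurableSpace β] {μ : Measure α}
    {ν : Measure β} {ψ : α → β} (hψ : Measurable ψ) {c : ENNReal} (hc : c ≠ ⊤)
    (h : μ.map ψ ≤ c • ν) (f : Lp ℝ 2 ν) : compOp hψ hc h f =ᵐ[μ] fun x => f (ψ x) := by
  have h1 := Lp.coeFn_compMeasurePreserving (Lp.LpToLpOfMeasureLeSMul hc h f)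
    (⟨hψ, rfl⟩ : MeasurePreserving ψ μ (μ.map ψ))
  exact h1.trans (ae_of_ae_map hψ.aemeasurable (Lp.coeFn_LpToLpOfMeasureLeSMul hc h f))

/-- The map `x ↦ T - τ(x)`, with `τ` frozen on the negative half-axis. -/
noncomputable def delay (ρ : ℝ → ℝ) (T x : ℝ) : ℝ := T - eikonal ρ (max x 0)

theorem ae_mem_spaceMeasure (ρ : ℝ → ℝ) (T : ℝ) : ∀ᵐ x ∂spaceMeasure ρ T, x ∈ Ioo 0 (front ρ T) :=
  (withDensity_absolutelyContinuous _ _).ae_le (ae_restrict_mem measurableSet_Ioo)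

namespace IsDensity

variable {ρ : ℝ → ℝ}

theorem continuous_eikonal_max (hρ : IsDensity ρ) : Continuous fun x => eikonal ρ (max x 0) :=
  hρ.continuousOn_eikonal.comp_continuous (by fun_prop) fun x => mem_Ici.2 (le_max_right _ _)

theorem continuous_delay (hρ : IsDensity ρ) : Continuous (delay ρ T) :=
  continuous_const.sub hρ.continuous_eikonal_max

theorem hasDerivAt_eikonal (hρ : IsDensity ρ) {x : ℝ} (hx : 0 < x) :
    HasDerivAt (eikonal ρ) (Real.sqrt (ρ x)) x := by
  have hc : ContinuousOn (fun s => Real.sqrt (ρ s)) (Ioi 0) :=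
    (hρ.continuousOn.mono Ioi_subset_Ici_self).sqrt
  exact intervalIntegral.integral_hasDerivAt_right (hρ.intervalIntegrable_sqrt le_rfl hx.le)
    (hc.stronglyMeasurableAtFilter isOpen_Ioi _ hx) (hc.continuousAt (Ioi_mem_nhds hx))

theorem delay_mem (hρ : IsDensity ρ) (hT : 0 < T) {x : ℝ} (hx : x ∈ Ioo 0 (front ρ T)) :
    delay ρ T x ∈ Ioo 0 T := by
  have h1 := (hρ.eikonal_lt_iff_lt_front hx.1.le hT.le).2 hx.2
  have h2 := (hρ.eikonal_lt_iff le_rfl hx.1.le).2 hx.1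
  rw [eikonal_zero] at h2
  rw [delay, max_eq_left hx.1.le]
  constructor <;> linarith

theorem front_sub_delay (hρ : IsDensity ρ) {x : ℝ} (hx : 0 ≤ x) :
    front ρ (T - delay ρ T x) = x := by
  rw [delay, max_eq_left hx, sub_sub_cancel, hρ.front_eikonal hx]

theorem front_sub_mem (hρ : IsDensity ρ) (hT : 0 < T) {t : ℝ} (ht : t ∈ Ioo 0 T) :
    front ρ (T - t) ∈ Ioo 0 (front ρ T) := by
  refine ⟨hρ.front_pos (by linarith [ht.2]), ?_⟩
  rw [← hρ.eikonal_lt_iff_lt_front (front_nonneg ρ _) hT.le, hρ.eikonal_front (by linarith [ht.2])]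
  linarith [ht.1]

theorem delay_front (hρ : IsDensity ρ) {t : ℝ} (ht : t ≤ T) : delay ρ T (front ρ (T - t)) = t := by
  rw [delay, max_eq_left (front_nonneg ρ _), hρ.eikonal_front (by linarith)]
  ring

/-- The map `x ↦ T - τ(x)` carries the measure `ρ^{1/2} dx` to Lebesgue measure. -/
theorem volume_image_delay (hρ : IsDensity ρ) {S : Set ℝ} (hS : MeasurableSet S)
    (hSs : S ⊆ Ioo 0 (front ρ T)) :
    volume (delay ρ T '' S) = ∫⁻ x in S, ENNReal.ofReal (Real.sqrt (ρ x)) := by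
  have h1 := lintegral_image_eq_lintegral_abs_deriv_mul (f := delay ρ T)
    (f' := fun x => -Real.sqrt (ρ x)) hS (fun x hx => ?_) (fun x hx y hy hxy => ?_) fun _ => 1
  · simpa [abs_of_nonneg (Real.sqrt_nonneg _)] using h1
  · have hx0 := (hSs hx).1
    have : HasDerivAt (fun x => T - eikonal ρ x) (-Real.sqrt (ρ x)) x :=
      (hρ.hasDerivAt_eikonal hx0).const_sub T
    refine (this.congr_of_eventuallyEq ?_).hasDerivWithinAt
    filter_upwards [Ioi_mem_nhds hx0] with y hy
    rw [delay, max_eq_left (le_of_lt hy)]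
  · rw [← hρ.front_sub_delay (T := T) (hSs hx).1.le, hxy, hρ.front_sub_delay (hSs hy).1.le]

theorem exists_sqrt_bounds (hρ : IsDensity ρ) (X : ℝ) :
    ∃ C : ℝ, 0 ≤ C ∧ ∀ x ∈ Ioo 0 X, ρ x ≤ C * Real.sqrt (ρ x) ∧ Real.sqrt (ρ x) ≤ C * ρ x := by
  have hc : ContinuousOn (fun x => Real.sqrt (ρ x)) (Icc 0 X) :=
    (hρ.continuousOn.mono Icc_subset_Ici_self).sqrt
  have hpos : ∀ x ∈ Icc 0 X, 0 < Real.sqrt (ρ x) := fun x hx => Real.sqrt_pos.2 (hρ.pos x hx.1)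
  obtain ⟨C₁, hC₁, h₁⟩ := exists_bound_Icc hc
  obtain ⟨C₂, hC₂, h₂⟩ := exists_bound_Icc (hc.inv₀ fun x hx => (hpos x hx).ne')
  refine ⟨max C₁ C₂, hC₁.trans (le_max_left _ _), fun x hx => ?_⟩
  have hx := Ioo_subset_Icc_self hx
  have hp := hpos x hx
  have hsq := Real.mul_self_sqrt (hρ.pos x hx.1).le
  have h3 : Real.sqrt (ρ x) ≤ max C₁ C₂ := ((le_abs_self _).trans (h₁ x hx)).trans (le_max_left _ _)
  have h4 : (Real.sqrt (ρ x))⁻¹ ≤ max C₁ C₂ :=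
    ((le_abs_self _).trans (h₂ x hx)).trans (le_max_right _ _)
  refine ⟨?_, ?_⟩
  · nlinarith
  · have h5 : 1 ≤ max C₁ C₂ * Real.sqrt (ρ x) := by
      have := mul_le_mul_of_nonneg_right h4 hp.le
      rwa [inv_mul_cancel₀ hp.ne'] at this
    nlinarith

theorem measurable_density (hρ : IsDensity ρ) :
    AEMeasurable (fun x => ENNReal.ofReal (ρ x)) (volume.restrict (Ioo 0 (front ρ T))) :=
  ((hρ.continuousOn.mono fun _ hx => mem_Ici.2 hx.1.le).aemeasurable measurableSet_Ioo).ennreal_ofReal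

/-- On a bounded interval `ρ` and `ρ^{1/2}` are comparable, so that the change of variables and its
inverse are bounded for the measures of `L₂(0,T)` and of the space of states. -/
theorem exists_map_delay_le (hρ : IsDensity ρ) (hT : 0 < T) :
    ∃ c : ENNReal, c ≠ ⊤ ∧ (spaceMeasure ρ T).map (delay ρ T) ≤ c • timeMeasure T ∧
      (timeMeasure T).map (fun t => front ρ (T - t)) ≤ c • spaceMeasure ρ T := by
  obtain ⟨C, hC, hCb⟩ := hρ.exists_sqrt_bounds (front ρ T)
  refine ⟨ENNReal.ofReal C, ENNReal.ofReal_ne_top, ?_, ?_⟩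
  · refine Measure.le_iff.2 fun A hA => ?_
    have hpre : MeasurableSet (delay ρ T ⁻¹' A) := hρ.continuous_delay.measurable hA
    have hS : MeasurableSet (delay ρ T ⁻¹' A ∩ Ioo 0 (front ρ T)) := hpre.inter measurableSet_Ioo
    rw [Measure.map_apply hρ.continuous_delay.measurable hA, withDensity_apply _ hpre,
      Measure.restrict_restrict hpre, Measure.smul_apply, Measure.restrict_apply hA, smul_eq_mul]
    calc ∫⁻ x in delay ρ T ⁻¹' A ∩ Ioo 0 (front ρ T), ENNReal.ofReal (ρ x)
        ≤ ∫⁻ x in delay ρ T ⁻¹' A ∩ Ioo 0 (front ρ T),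
            ENNReal.ofReal C * ENNReal.ofReal (Real.sqrt (ρ x)) := by
          refine setLIntegral_mono' hS fun x hx => ?_
          rw [← ENNReal.ofReal_mul hC]
          exact ENNReal.ofReal_le_ofReal (hCb x hx.2).1
      _ = ENNReal.ofReal C * volume (delay ρ T '' (delay ρ T ⁻¹' A ∩ Ioo 0 (front ρ T))) := by
          rw [lintegral_const_mul' _ _ ENNReal.ofReal_ne_top,
            hρ.volume_image_delay hS inter_subset_right]
      _ ≤ ENNReal.ofReal C * volume (A ∩ Ioo 0 T) := by
          gcongr
          rintro _ ⟨x, ⟨h1, h2⟩, rfl⟩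
          exact ⟨h1, hρ.delay_mem hT h2⟩
  · have hm : Measurable fun t => front ρ (T - t) :=
      (hρ.continuous_front.comp (by fun_prop : Continuous fun t : ℝ => T - t)).measurable
    refine Measure.le_iff.2 fun A hA => ?_
    have hS : MeasurableSet (A ∩ Ioo 0 (front ρ T)) := hA.inter measurableSet_Ioo
    rw [Measure.map_apply hm hA, Measure.restrict_apply (hm hA), Measure.smul_apply,
      withDensity_apply _ hA, Measure.restrict_restrict hA, smul_eq_mul]
    calc volume ((fun t => front ρ (T - t)) ⁻¹' A ∩ Ioo 0 T)
        ≤ volume (delay ρ T '' (A ∩ Ioo 0 (front ρ T))) := by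
          refine measure_mono fun t ht => ⟨front ρ (T - t), ⟨ht.1, hρ.front_sub_mem hT ht.2⟩,
            hρ.delay_front ht.2.2.le⟩
      _ = ∫⁻ x in A ∩ Ioo 0 (front ρ T), ENNReal.ofReal (Real.sqrt (ρ x)) :=
          hρ.volume_image_delay hS inter_subset_right
      _ ≤ ∫⁻ x in A ∩ Ioo 0 (front ρ T), ENNReal.ofReal C * ENNReal.ofReal (ρ x) := by
          refine setLIntegral_mono' hS fun x hx => ?_
          rw [← ENNReal.ofReal_mul hC]
          exact ENNReal.ofReal_le_ofReal (hCb x hx.2).2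
      _ = _ := lintegral_const_mul' _ _ ENNReal.ofReal_ne_top

theorem ae_delay (hρ : IsDensity ρ) (hT : 0 < T) {p : ℝ → Prop} (h : ∀ᵐ t ∂timeMeasure T, p t) :
    ∀ᵐ x ∂spaceMeasure ρ T, p (T - eikonal ρ x) := by
  obtain ⟨c, hc, h1, -⟩ := hρ.exists_map_delay_le hT
  have h2 := ae_of_ae_map hρ.continuous_delay.measurable.aemeasurable
    ((Measure.absolutelyContinuous_of_le_smul h1).ae_le h)
  filter_upwards [h2, ae_mem_spaceMeasure ρ T] with x hx hx'
  rwa [delay, max_eq_left hx'.1.le] at hx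

/-- The change of variables `x ↦ T - τ(x)` identifies `L₂(0,T)` with the space of states. -/
theorem exists_transport (hρ : IsDensity ρ) (hT : 0 < T) :
    ∃ Φ : Outer T →L[ℝ] Inner ρ T, Function.Bijective Φ ∧
      ∀ g, Φ g =ᵐ[spaceMeasure ρ T] fun x => g (T - eikonal ρ x) := by
  obtain ⟨c, hc, h1, h2⟩ := hρ.exists_map_delay_le hT
  have hm1 : Measurable (delay ρ T) := hρ.continuous_delay.measurable
  have hm2 : Measurable fun t => front ρ (T - t) :=
      (hρ.continuous_front.comp (by fun_prop : Continuous fun t : ℝ => T - t)).measurable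
  have hΦ := coeFn_compOp hm1 hc h1
  have hΨ := coeFn_compOp hm2 hc h2
  refine ⟨compOp hm1 hc h1, Function.bijective_iff_has_inverse.2 ⟨compOp hm2 hc h2, fun g => ?_,
    fun y => ?_⟩, fun g => ?_⟩
  · ext1
    have h3 := ae_of_ae_map hm2.aemeasurable
      ((Measure.absolutelyContinuous_of_le_smul h2).ae_le (hΦ g))
    filter_upwards [hΨ (compOp hm1 hc h1 g), h3, ae_mem_timeMeasure] with t h4 h5 ht
    rw [h4, h5, hρ.delay_front ht.2.le]
  · ext1
    have h3 := ae_of_ae_map hm1.aemeasurable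
      ((Measure.absolutelyContinuous_of_le_smul h1).ae_le (hΨ y))
    filter_upwards [hΦ (compOp hm2 hc h2 y), h3, ae_mem_spaceMeasure ρ T] with x h4 h5 hx
    rw [h4, h5, hρ.front_sub_delay hx.1.le]
  · filter_upwards [hΦ g, ae_mem_spaceMeasure ρ T] with x hx hx'
    rw [hx, delay, max_eq_left hx'.1.le]

end IsDensity

end

section

/-! ### Green's identity for waves on a rectangle -/

/-- `u` solves `ρ u_tt - u_xx + q u = 0` on `(0,X) × (0,T)`, with the derivatives `u_x`, `u_xx`,
`u_t`, `u_tt` extending continuously to the closed rectangle. -/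
structure WaveOn (ρ q : ℝ → ℝ) (X T : ℝ) (u ux uxx ut utt : ℝ → ℝ → ℝ) : Prop where
  cont : ContinuousOn (Function.uncurry u) (Icc 0 X ×ˢ Icc 0 T)
  cont_x : ContinuousOn (Function.uncurry ux) (Icc 0 X ×ˢ Icc 0 T)
  cont_xx : ContinuousOn (Function.uncurry uxx) (Icc 0 X ×ˢ Icc 0 T)
  cont_t : ContinuousOn (Function.uncurry ut) (Icc 0 X ×ˢ Icc 0 T)
  cont_tt : ContinuousOn (Function.uncurry utt) (Icc 0 X ×ˢ Icc 0 T)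
  deriv_x : ∀ x ∈ Ioo 0 X, ∀ t ∈ Ioo 0 T, HasDerivAt (fun x => u x t) (ux x t) x
  deriv_xx : ∀ x ∈ Ioo 0 X, ∀ t ∈ Ioo 0 T, HasDerivAt (fun x => ux x t) (uxx x t) x
  deriv_t : ∀ x ∈ Ioo 0 X, ∀ t ∈ Ioo 0 T, HasDerivAt (fun t => u x t) (ut x t) t
  deriv_tt : ∀ x ∈ Ioo 0 X, ∀ t ∈ Ioo 0 T, HasDerivAt (fun t => ut x t) (utt x t) t
  equation : ∀ x ∈ Ioo 0 X, ∀ t ∈ Ioo 0 T, ρ x * utt x t - uxx x t + q x * u x t = 0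

variable {ρ q : ℝ → ℝ} {X T : ℝ}

theorem WaveOn.sub {u ux uxx ut utt v vx vxx vt vtt : ℝ → ℝ → ℝ}
    (hu : WaveOn ρ q X T u ux uxx ut utt) (hv : WaveOn ρ q X T v vx vxx vt vtt) :
    WaveOn ρ q X T (fun x t => u x t - v x t) (fun x t => ux x t - vx x t)
      (fun x t => uxx x t - vxx x t) (fun x t => ut x t - vt x t)
      (fun x t => utt x t - vtt x t) where
  cont := hu.cont.sub hv.cont
  cont_x := hu.cont_x.sub hv.cont_x
  cont_xx := hu.cont_xx.sub hv.cont_xx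
  cont_t := hu.cont_t.sub hv.cont_t
  cont_tt := hu.cont_tt.sub hv.cont_tt
  deriv_x x hx t ht := (hu.deriv_x x hx t ht).sub (hv.deriv_x x hx t ht)
  deriv_xx x hx t ht := (hu.deriv_xx x hx t ht).sub (hv.deriv_xx x hx t ht)
  deriv_t x hx t ht := (hu.deriv_t x hx t ht).sub (hv.deriv_t x hx t ht)
  deriv_tt x hx t ht := (hu.deriv_tt x hx t ht).sub (hv.deriv_tt x hx t ht)
  equation x hx t ht := by
    have h1 := hu.equation x hx t ht
    have h2 := hv.equation x hx t ht
    linear_combination h1 - h2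

theorem WaveOn.mono {u ux uxx ut utt : ℝ → ℝ → ℝ} {X' T' : ℝ}
    (hu : WaveOn ρ q X T u ux uxx ut utt) (hX : X' ≤ X) (hT : T' ≤ T) :
    WaveOn ρ q X' T' u ux uxx ut utt := by
  have h : Icc 0 X' ×ˢ Icc 0 T' ⊆ Icc 0 X ×ˢ Icc 0 T :=
    prod_mono (Icc_subset_Icc_right hX) (Icc_subset_Icc_right hT)
  have hx : ∀ {x}, x ∈ Ioo 0 X' → x ∈ Ioo 0 X := fun h => Ioo_subset_Ioo_right hX h
  have ht : ∀ {t}, t ∈ Ioo 0 T' → t ∈ Ioo 0 T := fun h => Ioo_subset_Ioo_right hT h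
  exact ⟨hu.cont.mono h, hu.cont_x.mono h, hu.cont_xx.mono h, hu.cont_t.mono h, hu.cont_tt.mono h,
    fun x h1 t h2 => hu.deriv_x x (hx h1) t (ht h2), fun x h1 t h2 => hu.deriv_xx x (hx h1) t (ht h2),
    fun x h1 t h2 => hu.deriv_t x (hx h1) t (ht h2), fun x h1 t h2 => hu.deriv_tt x (hx h1) t (ht h2),
    fun x h1 t h2 => hu.equation x (hx h1) t (ht h2)⟩

/-- The wave equation is invariant under reversal of time. -/
theorem WaveOn.reverse {u ux uxx ut utt : ℝ → ℝ → ℝ} (hu : WaveOn ρ q X T u ux uxx ut utt) :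
    WaveOn ρ q X T (fun x t => u x (T - t)) (fun x t => ux x (T - t)) (fun x t => uxx x (T - t))
      (fun x t => -ut x (T - t)) (fun x t => utt x (T - t)) := by
  have hc : ∀ {w : ℝ → ℝ → ℝ}, ContinuousOn (Function.uncurry w) (Icc 0 X ×ˢ Icc 0 T) →
      ContinuousOn (Function.uncurry fun x t => w x (T - t)) (Icc 0 X ×ˢ Icc 0 T) := by
    intro w hw
    refine hw.comp (f := fun p : ℝ × ℝ => (p.1, T - p.2)) (by fun_prop) ?_
    rintro ⟨x, t⟩ ⟨hx, ht⟩
    exact ⟨hx, by constructor <;> linarith [ht.1, ht.2]⟩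
  have ht : ∀ {t}, t ∈ Ioo 0 T → T - t ∈ Ioo 0 T := fun h => by
    constructor <;> linarith [h.1, h.2]
  have hd : ∀ t, HasDerivAt (fun t => T - t) (-1) t := fun t => (hasDerivAt_id t).const_sub T
  exact ⟨hc hu.cont, hc hu.cont_x, hc hu.cont_xx, (hc hu.cont_t).neg, hc hu.cont_tt,
    fun x h1 t h2 => hu.deriv_x x h1 _ (ht h2), fun x h1 t h2 => hu.deriv_xx x h1 _ (ht h2),
    fun x h1 t h2 => by simpa using! (hu.deriv_t x h1 _ (ht h2)).comp t (hd t),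
    fun x h1 t h2 => by simpa using! ((hu.deriv_tt x h1 _ (ht h2)).comp t (hd t)).neg,
    fun x h1 t h2 => hu.equation x h1 _ (ht h2)⟩

theorem integral_congr_Ioo {f g : ℝ → ℝ} {a b : ℝ} (hab : a ≤ b) (h : ∀ x ∈ Ioo a b, f x = g x) :
    ∫ x in a..b, f x = ∫ x in a..b, g x := by
  rw [intervalIntegral.integral_of_le hab, intervalIntegral.integral_of_le hab,
    integral_Ioc_eq_integral_Ioo, integral_Ioc_eq_integral_Ioo]
  exact setIntegral_congr_fun measurableSet_Ioo h

theorem ContinuousOn.slice_fst {w : ℝ → ℝ → ℝ} {A B : Set ℝ}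
    (hw : ContinuousOn (Function.uncurry w) (A ×ˢ B)) {t : ℝ} (ht : t ∈ B) :
    ContinuousOn (fun x => w x t) A :=
  hw.comp (f := fun x => (x, t)) (by fun_prop) fun _ hx => ⟨hx, ht⟩

theorem ContinuousOn.slice_snd {w : ℝ → ℝ → ℝ} {A B : Set ℝ}
    (hw : ContinuousOn (Function.uncurry w) (A ×ˢ B)) {x : ℝ} (hx : x ∈ A) :
    ContinuousOn (fun t => w x t) B :=
  hw.comp (f := fun t => (x, t)) (by fun_prop) fun _ ht => ⟨hx, ht⟩

/-- Green's identity for a wave `u` with zero Cauchy data at `t = 0` and at `x = X`, and a wave `v`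
vanishing at the final moment `t = T`. -/
theorem WaveOn.green {u ux uxx ut utt v vx vxx vt vtt : ℝ → ℝ → ℝ}
    (hu : WaveOn ρ q X T u ux uxx ut utt) (hv : WaveOn ρ q X T v vx vxx vt vtt)
    (hX : 0 ≤ X) (hT : 0 ≤ T) (hρ : ContinuousOn ρ (Icc 0 X))
    (hu0 : ∀ x ∈ Ioo 0 X, u x 0 = 0) (hut0 : ∀ x ∈ Ioo 0 X, ut x 0 = 0)
    (huX : ∀ t ∈ Ioo 0 T, u X t = 0) (huxX : ∀ t ∈ Ioo 0 T, ux X t = 0)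
    (hvT : ∀ x ∈ Ioo 0 X, v x T = 0) :
    ∫ x in (0 : ℝ)..X, ρ x * (vt x T * u x T) =
      ∫ t in (0 : ℝ)..T, (v 0 t * ux 0 t - vx 0 t * u 0 t) := by
  have h0X : (0 : ℝ) ∈ Icc 0 X := ⟨le_rfl, hX⟩
  have h0T : (0 : ℝ) ∈ Icc 0 T := ⟨le_rfl, hT⟩
  have hXX : X ∈ Icc 0 X := ⟨hX, le_rfl⟩
  have hTT : T ∈ Icc 0 T := ⟨hT, le_rfl⟩
  have hρ' : ContinuousOn (fun p : ℝ × ℝ => ρ p.1) (Icc 0 X ×ˢ Icc 0 T) :=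
    hρ.comp continuousOn_fst fun _ hp => (mem_prod.1 hp).1
  have hF : ContinuousOn (Function.uncurry fun x t => ρ x * (vtt x t * u x t - v x t * utt x t))
      (Icc 0 X ×ˢ Icc 0 T) :=
    hρ'.mul ((hv.cont_tt.mul hu.cont).sub (hv.cont.mul hu.cont_tt))
  have hG : ContinuousOn (Function.uncurry fun x t => vxx x t * u x t - v x t * uxx x t)
      (Icc 0 X ×ˢ Icc 0 T) := (hv.cont_xx.mul hu.cont).sub (hv.cont.mul hu.cont_xx)
  have hFt : ∀ x ∈ Ioo 0 X, ∫ t in (0 : ℝ)..T, ρ x * (vtt x t * u x t - v x t * utt x t) =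
      ρ x * (vt x T * u x T) := by
    intro x hx
    have hx' := Ioo_subset_Icc_self hx
    have hc : ContinuousOn (fun t => vt x t * u x t - v x t * ut x t) (Icc 0 T) :=
      ((ContinuousOn.slice_snd hv.cont_t hx').mul (ContinuousOn.slice_snd hu.cont hx')).sub
        ((ContinuousOn.slice_snd hv.cont hx').mul (ContinuousOn.slice_snd hu.cont_t hx'))
    have hint : IntervalIntegrable (fun t => vtt x t * u x t - v x t * utt x t) volume 0 T :=
      ContinuousOn.intervalIntegrable_of_Icc hT
        (((ContinuousOn.slice_snd hv.cont_tt hx').mul (ContinuousOn.slice_snd hu.cont hx')).sub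
        ((ContinuousOn.slice_snd hv.cont hx').mul (ContinuousOn.slice_snd hu.cont_tt hx')))
    rw [intervalIntegral.integral_const_mul,
      intervalIntegral.integral_eq_sub_of_hasDerivAt_of_le hT hc (fun t ht => ?_) hint]
    · rw [hvT x hx, hu0 x hx, hut0 x hx]; ring
    · have := ((hv.deriv_tt x hx t ht).mul (hu.deriv_t x hx t ht)).sub
        ((hv.deriv_t x hx t ht).mul (hu.deriv_tt x hx t ht))
      exact this.congr_deriv (by ring)
  have hGx : ∀ t ∈ Ioo 0 T, ∫ x in (0 : ℝ)..X, (vxx x t * u x t - v x t * uxx x t) =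
      v 0 t * ux 0 t - vx 0 t * u 0 t := by
    intro t ht
    have ht' := Ioo_subset_Icc_self ht
    have hc : ContinuousOn (fun x => vx x t * u x t - v x t * ux x t) (Icc 0 X) :=
      ((ContinuousOn.slice_fst hv.cont_x ht').mul (ContinuousOn.slice_fst hu.cont ht')).sub
        ((ContinuousOn.slice_fst hv.cont ht').mul (ContinuousOn.slice_fst hu.cont_x ht'))
    have hint : IntervalIntegrable (fun x => vxx x t * u x t - v x t * uxx x t) volume 0 X :=
      ContinuousOn.intervalIntegrable_of_Icc hX (ContinuousOn.slice_fst hG ht')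
    rw [intervalIntegral.integral_eq_sub_of_hasDerivAt_of_le hX hc (fun x hx => ?_) hint]
    · rw [huX t ht, huxX t ht]; ring
    · have := ((hv.deriv_xx x hx t ht).mul (hu.deriv_x x hx t ht)).sub
        ((hv.deriv_x x hx t ht).mul (hu.deriv_xx x hx t ht))
      exact this.congr_deriv (by ring)
  calc ∫ x in (0 : ℝ)..X, ρ x * (vt x T * u x T)
      = ∫ x in (0 : ℝ)..X, ∫ t in (0 : ℝ)..T, ρ x * (vtt x t * u x t - v x t * utt x t) :=
        integral_congr_Ioo hX fun x hx => (hFt x hx).symm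
    _ = ∫ x in (0 : ℝ)..X, ∫ t in (0 : ℝ)..T, (vxx x t * u x t - v x t * uxx x t) :=
        integral_congr_Ioo hX fun x hx => integral_congr_Ioo hT fun t ht => by
          have h1 := hu.equation x hx t ht
          have h2 := hv.equation x hx t ht
          linear_combination u x t * h2 - v x t * h1
    _ = ∫ t in (0 : ℝ)..T, ∫ x in (0 : ℝ)..X, (vxx x t * u x t - v x t * uxx x t) := by
        refine intervalIntegral_intervalIntegral_swap ?_
        rw [uIoc_of_le hX, uIoc_of_le hT]
        exact (hG.integrableOn_compact (isCompact_Icc.prod isCompact_Icc)).mono_set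
          (prod_mono Ioc_subset_Icc_self Ioc_subset_Icc_self)
    _ = _ := integral_congr_Ioo hT hGx

/-- Partial derivatives of a `Cⁿ⁺¹` function on a closed rectangle or quadrant, one-sided on the
boundary. -/
theorem exists_partials {A B : Set ℝ} (hA : UniqueDiffOn ℝ A) (hB : UniqueDiffOn ℝ B) {n : ℕ}
    {F : ℝ → ℝ → ℝ} (hF : ContDiffOn ℝ (n + 1) (Function.uncurry F) (A ×ˢ B)) :
    ∃ F₁ F₂ : ℝ → ℝ → ℝ, ContDiffOn ℝ n (Function.uncurry F₁) (A ×ˢ B) ∧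
      ContDiffOn ℝ n (Function.uncurry F₂) (A ×ˢ B) ∧
      (∀ x ∈ A, ∀ t ∈ B, HasDerivWithinAt (fun x => F x t) (F₁ x t) A x) ∧
      ∀ x ∈ A, ∀ t ∈ B, HasDerivWithinAt (fun t => F x t) (F₂ x t) B t := by
  have hS : UniqueDiffOn ℝ (A ×ˢ B) := hA.prod hB
  have hD := hF.fderivWithin hS (m := n) le_rfl
  have hd : ∀ x ∈ A, ∀ t ∈ B, HasFDerivWithinAt (Function.uncurry F)
      (fderivWithin ℝ (Function.uncurry F) (A ×ˢ B) (x, t)) (A ×ˢ B) (x, t) := fun x hx t ht =>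
    (hF.differentiableOn (by simp) (x, t) ⟨hx, ht⟩).hasFDerivWithinAt
  refine ⟨fun x t => fderivWithin ℝ (Function.uncurry F) (A ×ˢ B) (x, t) (1, 0),
    fun x t => fderivWithin ℝ (Function.uncurry F) (A ×ˢ B) (x, t) (0, 1),
    hD.clm_apply contDiffOn_const, hD.clm_apply contDiffOn_const, fun x hx t ht => ?_,
    fun x hx t ht => ?_⟩
  · exact (hd x hx t ht).comp_hasDerivWithinAt x
      ((hasDerivWithinAt_id x A).prodMk (hasDerivWithinAt_const x A t))
      (show MapsTo (fun y => (y, t)) A (A ×ˢ B) from fun y hy => ⟨hy, ht⟩)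
  · exact (hd x hx t ht).comp_hasDerivWithinAt t
      ((hasDerivWithinAt_const t B x).prodMk (hasDerivWithinAt_id t B))
      (show MapsTo (fun y => (x, y)) B (A ×ˢ B) from fun y hy => ⟨hx, hy⟩)

/-- A classical solution of the Neumann problem is a wave on every rectangle. -/
theorem IsClassicalWave.exists_waveOn {f : ℝ → ℝ} {u : ℝ → ℝ → ℝ} (hu : IsClassicalWave ρ q f u) :
    ∃ ux uxx ut utt : ℝ → ℝ → ℝ, (∀ X T, WaveOn ρ q X T u ux uxx ut utt) ∧
      (∀ t ≥ 0, ux 0 t = f t) ∧ (∀ x ≥ 0, ut x 0 = 0) ∧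
      (∀ x > 0, ∀ t ≥ 0, HasDerivAt (fun x => u x t) (ux x t) x) ∧
      (∀ x ≥ 0, ∀ t > 0, HasDerivAt (fun t => u x t) (ut x t) t) := by
  have hU := uniqueDiffOn_Ici (0 : ℝ)
  have h2 : ContDiffOn ℝ ((1 : ℕ) + 1) (Function.uncurry u) (Ici 0 ×ˢ Ici 0) := by
    have := hu.contDiffOn
    simpa [one_add_one_eq_two] using! this
  obtain ⟨ux, ut, hux, hut, dx, dt⟩ := exists_partials hU hU h2
  have hux' : ContDiffOn ℝ ((0 : ℕ) + 1) (Function.uncurry ux) (Ici 0 ×ˢ Ici 0) := by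
    simpa using hux
  have hut' : ContDiffOn ℝ ((0 : ℕ) + 1) (Function.uncurry ut) (Ici 0 ×ˢ Ici 0) := by
    simpa using hut
  obtain ⟨uxx, -, huxx, -, dxx, -⟩ := exists_partials hU hU hux'
  obtain ⟨-, utt, -, hutt, -, dtt⟩ := exists_partials hU hU hut'
  have dx' : ∀ x > 0, ∀ t ≥ 0, HasDerivAt (fun x => u x t) (ux x t) x := fun x hx t ht =>
    (dx x (mem_Ici.2 hx.le) t ht).hasDerivAt (Ici_mem_nhds hx)
  have dt' : ∀ x ≥ 0, ∀ t > 0, HasDerivAt (fun t => u x t) (ut x t) t := fun x hx t ht =>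
    (dt x hx t (mem_Ici.2 ht.le)).hasDerivAt (Ici_mem_nhds ht)
  have dxx' : ∀ x > 0, ∀ t ≥ 0, HasDerivAt (fun x => ux x t) (uxx x t) x := fun x hx t ht =>
    (dxx x (mem_Ici.2 hx.le) t ht).hasDerivAt (Ici_mem_nhds hx)
  have dtt' : ∀ x ≥ 0, ∀ t > 0, HasDerivAt (fun t => ut x t) (utt x t) t := fun x hx t ht =>
    (dtt x hx t (mem_Ici.2 ht.le)).hasDerivAt (Ici_mem_nhds ht)
  refine ⟨ux, uxx, ut, utt, fun X T => ?_, fun t ht => ?_, fun x hx => ?_, dx', dt'⟩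
  · have hs : Icc 0 X ×ˢ Icc 0 T ⊆ Ici (0 : ℝ) ×ˢ Ici (0 : ℝ) :=
      prod_mono Icc_subset_Ici_self Icc_subset_Ici_self
    refine ⟨h2.continuousOn.mono hs, hux.continuousOn.mono hs, huxx.continuousOn.mono hs,
      hut.continuousOn.mono hs, hutt.continuousOn.mono hs, fun x hx t ht => dx' x hx.1 t ht.1.le,
      fun x hx t ht => dxx' x hx.1 t ht.1.le, fun x hx t ht => dt' x hx.1.le t ht.1,
      fun x hx t ht => dtt' x hx.1.le t ht.1, fun x hx t ht => ?_⟩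
    have e := hu.equation x hx.1 t ht.1
    rwa [iteratedDeriv_two_eq_of_mem_nhds (Ioi_mem_nhds ht.1)
        (fun s hs => dt' x hx.1.le s hs) (dtt' x hx.1.le t ht.1),
      iteratedDeriv_two_eq_of_mem_nhds (Ioi_mem_nhds hx.1)
        (fun s hs => dx' s hs t ht.1.le) (dxx' x hx.1 t ht.1.le)] at e
  · rw [← hu.boundary t ht]
    exact ((dx 0 self_mem_Ici t ht).derivWithin (hU 0 self_mem_Ici)).symm
  · exact ((dt x hx 0 self_mem_Ici).derivWithin (hU 0 self_mem_Ici)).symm.trans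
      (hu.initial_velocity x hx)

/-! ### Duhamel waves -/

theorem duhamel_eq_zero {r : ℝ → ℝ → ℝ} {f : ℝ → ℝ} {ε x t : ℝ} (hε : 0 < ε)
    (hf : ∀ s < ε, f s = 0) (h : t - eikonal ρ x < ε) : duhamel ρ r f x t = 0 := by
  refine (intervalIntegral.integral_congr fun s hs => ?_).trans intervalIntegral.integral_zero
  have : s < ε := lt_of_le_of_lt hs.2 (max_lt hε h)
  simp [hf s this]

/-- The wave of a control vanishing near `t = 0` has zero Cauchy data at the front. -/
theorem IsDensity.duhamel_front (hρ : IsDensity ρ) {r : ℝ → ℝ → ℝ} {f : ℝ → ℝ} {ε : ℝ}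
    (hε : 0 < ε) (hf : ∀ s < ε, f s = 0) (hT : 0 < T) {t : ℝ} (ht : t ≤ T) :
    (fun x => duhamel ρ r f x t) =ᶠ[𝓝 (front ρ T)] fun _ => 0 := by
  have hX := hρ.front_pos hT
  have hc : ContinuousAt (eikonal ρ) (front ρ T) :=
    (hρ.hasDerivAt_eikonal hX).continuousAt
  have : ∀ᶠ x in 𝓝 (front ρ T), T - ε < eikonal ρ x :=
    hc.eventually (lt_mem_nhds (by rw [hρ.eikonal_front hT.le]; linarith))
  filter_upwards [this] with x hx
  exact duhamel_eq_zero hε hf (by linarith)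

/-- `k` is a continuous kernel with continuous time derivative `k'`, not vanishing on the front,
and `r` coincides with `k` behind the front. -/
structure IsFrontKernel (ρ : ℝ → ℝ) (r k k' : ℝ → ℝ → ℝ) : Prop where
  cont : Continuous (Function.uncurry k)
  hasDerivAt : ∀ x t, HasDerivAt (k x) (k' x t) t
  cont_deriv : Continuous (Function.uncurry k')
  ne_zero : ∀ x ≥ 0, k x (eikonal ρ x) ≠ 0
  eq : ∀ x ≥ 0, ∀ t ≥ eikonal ρ x, r x t = k x t

namespace IsFrontKernel

variable {r k k' : ℝ → ℝ → ℝ}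

theorem duhamel_eq (hk : IsFrontKernel ρ r k k') {f : ℝ → ℝ} {x t : ℝ} (hx : 0 ≤ x)
    (ht : eikonal ρ x ≤ t) :
    duhamel ρ r f x t = ∫ s in (0 : ℝ)..(t - eikonal ρ x), k x (t - s) * f s := by
  refine intervalIntegral.integral_congr fun s hs => ?_
  rw [uIcc_of_le (by linarith)] at hs
  rw [hk.eq x hx (t - s) (by linarith [hs.2])]

/-- Integration by parts in the Duhamel integral; the boundary term is the jump at the front. -/
theorem integral_deriv_eq (hk : IsFrontKernel ρ r k k') {f : ℝ → ℝ} (hf : ContDiff ℝ ∞ f)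
    (hf0 : f 0 = 0) (x t a : ℝ) :
    ∫ s in (0 : ℝ)..a, k x (t - s) * deriv f s =
      k x (t - a) * f a + ∫ s in (0 : ℝ)..a, k' x (t - s) * f s := by
  have hts : Continuous fun s : ℝ => t - s := by fun_prop
  have hd : ∀ s, HasDerivAt (fun s => k x (t - s)) (-k' x (t - s)) s := fun s => by
    simpa using! (hk.hasDerivAt x (t - s)).comp s ((hasDerivAt_id s).const_sub t)
  rw [intervalIntegral.integral_mul_deriv_eq_deriv_mul (u := fun s => k x (t - s)) (v := f)
    (u' := fun s => -k' x (t - s)) (fun s _ => hd s)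
    (fun s _ => (hf.differentiable (by simp) s).hasDerivAt)
    (((hk.cont_deriv.uncurry_left x).comp hts).neg.intervalIntegrable _ _)
    ((hf.continuous_deriv (by simp)).intervalIntegrable _ _)]
  simp only [hf0, neg_mul, intervalIntegral.integral_neg]
  ring

/-- The velocity of the wave with the control `f` is the wave with the control `f'`. -/
theorem hasDerivAt_duhamel (hk : IsFrontKernel ρ r k k') {f : ℝ → ℝ}
    (hf : ContDiff ℝ ∞ f) {ε : ℝ} (hε : 0 < ε) (hfε : ∀ s < ε, f s = 0) {x : ℝ} (hx : 0 ≤ x) (t : ℝ) :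
    HasDerivAt (fun t => duhamel ρ r f x t) (duhamel ρ r (deriv f) x t) t := by
  have hfε' : ∀ s < ε, deriv f s = 0 := fun s hs => by
    have : f =ᶠ[𝓝 s] fun _ => 0 := by filter_upwards [Iio_mem_nhds hs] with y hy using hfε y hy
    rw [this.deriv_eq]; simp
  -- the same formula with `k` in place of `r`, valid also ahead of the front
  have key : ∀ g : ℝ → ℝ, (∀ s < ε, g s = 0) → ∀ t, duhamel ρ r g x t =
      ∫ s in (0 : ℝ)..(t - eikonal ρ x), k x (t - s) * g s := by
    intro g hg t
    rcases le_or_gt (eikonal ρ x) t with h | h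
    · exact hk.duhamel_eq hx h
    · rw [duhamel_eq_zero hε hg (by linarith)]
      refine ((intervalIntegral.integral_congr fun s hs => ?_).trans
        intervalIntegral.integral_zero).symm
      rw [uIcc_of_ge (by linarith)] at hs
      simp [hg s (by linarith [hs.2])]
  rw [show (fun t => duhamel ρ r f x t) = _ from funext (key f hfε), key _ hfε']
  have hp : Continuous fun p : ℝ × ℝ => p.1 - p.2 := by fun_prop
  have := hasDerivAt_integral_param_endpoint (F := fun t s => k x (t - s) * f s)
    (F' := fun t s => k' x (t - s) * f s) (fun t s => ?_) ?_ ?_ 0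
    ((hasDerivAt_id t).sub_const (eikonal ρ x))
  · refine this.congr_deriv ?_
    rw [hk.integral_deriv_eq hf (hfε 0 hε)]
    simp only [id]; ring
  · have := ((hk.hasDerivAt x (t - s)).comp t ((hasDerivAt_id t).sub_const s)).mul_const (f s)
    simpa using! this
  · exact ((hk.cont.uncurry_left x).comp hp).mul (hf.continuous.comp continuous_snd)
  · exact ((hk.cont_deriv.uncurry_left x).comp hp).mul (hf.continuous.comp continuous_snd)

end IsFrontKernel

end

section

/-! ### The operators of the system -/

variable {ρ q : ℝ → ℝ} {T : ℝ} {r k k' : ℝ → ℝ → ℝ}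

/-- A test control is the derivative of a smooth control vanishing near `t = 0`, which is its image
under `integOp`. -/
theorem IsTest.exists_primitive {g : ℝ → ℝ} (hg : IsTest T g) :
    ∃ G : ℝ → ℝ, ContDiff ℝ ∞ G ∧ _root_.deriv G = g ∧ (∃ ε > 0, ∀ t < ε, G t = 0) ∧
      integOp T (toOuter T g) = toOuter T G := by
  have hgc := hg.contDiff.continuous
  have hd : ∀ t, HasDerivAt (fun t => ∫ s in (0 : ℝ)..t, g s) (g t) t := fun t =>
    intervalIntegral.integral_hasDerivAt_right (hgc.intervalIntegrable _ _)
      (hgc.stronglyMeasurableAtFilter _ _) hgc.continuousAt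
  have hdg : _root_.deriv (fun t => ∫ s in (0 : ℝ)..t, g s) = g := funext fun t => (hd t).deriv
  have hG : ContDiff ℝ ∞ fun t => ∫ s in (0 : ℝ)..t, g s :=
    contDiff_infty_iff_deriv.2 ⟨fun t => (hd t).differentiableAt, by rw [hdg]; exact hg.contDiff⟩
  refine ⟨_, hG, hdg, ?_, ?_⟩
  · obtain ⟨ε, hε, h0, -⟩ := hg.vanishes
    refine ⟨ε, hε, fun t ht => ?_⟩
    refine (intervalIntegral.integral_congr fun s hs => ?_).trans intervalIntegral.integral_zero
    exact h0 s (lt_of_le_of_lt hs.2 (max_lt hε ht))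
  · ext1
    filter_upwards [coeFn_integOp (toOuter T g), coeFn_toOuter (T := T) hG.continuous.continuousOn,
      ae_mem_timeMeasure] with t h1 h2 ht
    have := integral_congr_toOuter hg.continuousOn (fun _ => 1)
      (⟨le_rfl, ht.1.le.trans ht.2.le⟩ : (0 : ℝ) ∈ Icc 0 T) (Ioo_subset_Icc_self ht)
    simp only [one_mul] at this
    rw [h1, h2, this]

/-- The operators of the system at time `T`: the control operator `W`, the response operator `R`,
and the velocity operator `B`, i.e. the extension of `W d/dt`, with its explicit form. -/
structure SystemOperators (ρ : ℝ → ℝ) (r k k' : ℝ → ℝ → ℝ) (T : ℝ) (W B : Outer T →L[ℝ] Inner ρ T)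
    (R : Outer T →L[ℝ] Outer T) : Prop where
  control : IsControlOperator ρ r T W
  response : IsResponseOperator ρ r T R
  bijective : Function.Bijective B
  comp_integOp : ∀ f, B (integOp T f) = W f
  velocity : ∀ f : Outer T, B f =ᵐ[spaceMeasure ρ T] fun x =>
    k x (eikonal ρ x) * f (T - eikonal ρ x) +
      ∫ s in (0 : ℝ)..(T - eikonal ρ x), k' x (T - s) * f s
  response_comm : ∀ f, R (integOp T f) = integOp T (R f)

theorem duhamel_toOuter {F : ℝ → ℝ} (hF : ContinuousOn F (Icc 0 T)) {x t : ℝ}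
    (hx : 0 ≤ eikonal ρ x) (ht : eikonal ρ x ≤ t) (htT : t ≤ T) :
    duhamel ρ r (toOuter T F) x t = duhamel ρ r F x t :=
  integral_congr_toOuter hF _ ⟨le_rfl, (hx.trans ht).trans htT⟩ ⟨by linarith, by linarith⟩

theorem IsDensity.eikonal_lt (hρ : IsDensity ρ) (hT : 0 < T) {x : ℝ}
    (hx : x ∈ Ioo 0 (front ρ T)) : eikonal ρ x < T :=
  (hρ.eikonal_lt_iff_lt_front hx.1.le hT.le).2 hx.2

/-- The operators of the system exist, and `B` is bijective: in the variable `T - τ(x)` it is a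
Volterra operator of the second kind, whose coefficient is the nonvanishing jump of `r` at the
front. -/
theorem IsFrontKernel.exists_operators (hk : IsFrontKernel ρ r k k') (hρ : IsDensity ρ)
    (hT : 0 < T) : ∃ W B R, SystemOperators ρ r k k' T W B R := by
  have hX := hρ.continuous_front
  have hfr : Continuous fun t => front ρ (T - t) := hX.comp (by fun_prop)
  -- the velocity operator is a Volterra operator of the second kind in the variable `T - τ(x)`
  have hβ : Continuous fun t => k (front ρ (T - t)) (max (T - t) 0) :=
    hk.cont.comp (hfr.prodMk (by fun_prop))
  have hβ0 : ∀ t, k (front ρ (T - t)) (max (T - t) 0) ≠ 0 := fun t => by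
    have h1 := hk.ne_zero _ (front_nonneg ρ (T - t))
    rcases le_total 0 (T - t) with h | h
    · rw [hρ.eikonal_front h] at h1
      rwa [max_eq_left h]
    · rw [hρ.front_of_nonpos h, eikonal_zero] at h1
      rwa [hρ.front_of_nonpos h, max_eq_right h]
  have hκ : Continuous (Function.uncurry fun t s => k' (front ρ (T - t)) (T - s)) :=
    hk.cont_deriv.comp ((hfr.comp continuous_fst).prodMk (by fun_prop))
  have hω : Continuous (Function.uncurry fun t s => k (front ρ (T - t)) (T - s)) :=
    hk.cont.comp ((hfr.comp continuous_fst).prodMk (by fun_prop))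
  have hr : Continuous (Function.uncurry fun t s => k 0 (t - s)) :=
    hk.cont.comp (continuous_const.prodMk (by fun_prop))
  obtain ⟨L, hLb, hL⟩ := exists_volterra_second_kind T hβ hβ0 hκ
  obtain ⟨Φ, hΦb, hΦ⟩ := hρ.exists_transport hT
  set V := volterraOp T fun t s => k (front ρ (T - t)) (T - s) with hVdef
  have hV := coeFn_volterraOp (T := T) hω
  set R := volterraOp T fun t s => k 0 (t - s) with hRdef
  have hRf := coeFn_volterraOp (T := T) hr
  have hB : ∀ f : Outer T, Φ (L f) =ᵐ[spaceMeasure ρ T] fun x =>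
      k x (eikonal ρ x) * f (T - eikonal ρ x) +
        ∫ s in (0 : ℝ)..(T - eikonal ρ x), k' x (T - s) * f s := fun f => by
    filter_upwards [hΦ (L f), hρ.ae_delay hT (hL f), ae_mem_spaceMeasure ρ T] with x h1 h2 hx
    rw [h1, h2, sub_sub_cancel, hρ.front_eikonal hx.1.le, max_eq_left (hρ.eikonal_nonneg hx.1.le)]
  have hW : IsControlOperator ρ r T (Φ.comp V) := fun f => by
    filter_upwards [hΦ (V f), hρ.ae_delay hT (hV f), ae_mem_spaceMeasure ρ T] with x h1 h2 hx
    rw [ContinuousLinearMap.comp_apply, h1, h2, hk.duhamel_eq hx.1.le (hρ.eikonal_lt hT hx).le,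
      sub_sub_cancel, hρ.front_eikonal hx.1.le]
  have hR : IsResponseOperator ρ r T R := fun f => by
    filter_upwards [hRf f, ae_mem_timeMeasure] with t h1 ht
    rw [h1, hk.duhamel_eq le_rfl (by rw [eikonal_zero]; exact ht.1.le), eikonal_zero, sub_zero]
  refine ⟨Φ.comp V, Φ.comp L, R, hW, hR, hΦb.comp hLb, fun f => ?_, hB, fun f => ?_⟩
  -- the identity `B ∘ integOp = W` is integration by parts on the primitives of test controls
  · have : (Φ.comp L).comp (integOp T) = Φ.comp V := by
      refine ext_test fun g hg => ?_
      obtain ⟨G, hG, hGg, ⟨ε, hε, hGε⟩, hGint⟩ := hg.exists_primitive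
      rw [ContinuousLinearMap.comp_apply, hGint]
      ext1
      have hGc : ContinuousOn G (Icc 0 T) := hG.continuous.continuousOn
      filter_upwards [hB (toOuter T G), hW (toOuter T g), ae_mem_spaceMeasure ρ T,
        hρ.ae_delay hT (coeFn_toOuter hGc)] with x h1 h2 hx h3
      have hτ := hρ.eikonal_lt hT hx
      have hτ0 := hρ.eikonal_nonneg hx.1.le
      rw [ContinuousLinearMap.comp_apply, h1, h2, duhamel_toOuter hg.continuousOn hτ0 hτ.le le_rfl,
        hk.duhamel_eq hx.1.le hτ.le, h3, integral_congr_toOuter hGc _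
          ⟨le_rfl, hT.le⟩ ⟨by linarith, by linarith⟩, ← hGg, hk.integral_deriv_eq hG (hGε 0 hε),
        sub_sub_cancel]
    exact DFunLike.congr_fun this f
  -- `R` commutes with integration since `u_t^f = u^{f'}`
  · have : R.comp (integOp T) = (integOp T).comp R := by
      refine ext_test fun g hg => ?_
      obtain ⟨G, hG, hGg, ⟨ε, hε, hGε⟩, hGint⟩ := hg.exists_primitive
      rw [ContinuousLinearMap.comp_apply, hGint]
      ext1
      have hGc : ContinuousOn G (Icc 0 T) := hG.continuous.continuousOn
      obtain ⟨δ, hδ, hgδ, -⟩ := hg.vanishes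
      filter_upwards [hR (toOuter T G), coeFn_integOp (R (toOuter T g)), ae_mem_timeMeasure]
        with t h1 h2 ht
      have hd : ∀ s, HasDerivAt (fun s => duhamel ρ r G 0 s) (duhamel ρ r g 0 s) s := fun s => by
        rw [← hGg]; exact hk.hasDerivAt_duhamel hG hε hGε le_rfl s
      have hc : Continuous fun s => duhamel ρ r g 0 s := continuous_iff_continuousAt.2 fun s =>
        (hk.hasDerivAt_duhamel hg.contDiff hδ hgδ le_rfl s).continuousAt
      have h3 := intervalIntegral.integral_eq_sub_of_hasDerivAt (a := 0) (b := t)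
        (fun s _ => hd s) (hc.intervalIntegrable _ _)
      have h4 : duhamel ρ r G 0 0 = 0 := by simp [duhamel, eikonal_zero]
      have h5 : R (toOuter T g) =ᵐ[timeMeasure T] fun s => duhamel ρ r g 0 s := by
        filter_upwards [hR (toOuter T g), ae_mem_timeMeasure] with s hs hsT
        rw [hs, duhamel_toOuter hg.continuousOn (by rw [eikonal_zero])
          (by rw [eikonal_zero]; exact hsT.1.le) hsT.2.le]
      rw [h1, duhamel_toOuter hGc (by rw [eikonal_zero]) (by rw [eikonal_zero]; exact ht.1.le)
        ht.2.le, ContinuousLinearMap.comp_apply, h2, integral_congr_timeMeasure h5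
        ⟨le_rfl, hT.le⟩ (Ioo_subset_Icc_self ht), h3, h4, sub_zero]
    exact DFunLike.congr_fun this f

theorem IsDensity.inner_state_eq (hρ : IsDensity ρ) {Y Z : Inner ρ T} {y z : ℝ → ℝ}
    (hY : Y =ᵐ[spaceMeasure ρ T] y) (hZ : Z =ᵐ[spaceMeasure ρ T] z) :
    ⟪Y, Z⟫ = ∫ x in (0 : ℝ)..front ρ T, ρ x * (y x * z x) := by
  have h1 : ⟪Y, Z⟫ = ∫ x, y x * z x ∂spaceMeasure ρ T := by
    rw [L2.inner_def]
    refine integral_congr_ae ?_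
    filter_upwards [hY, hZ] with x h1 h2
    simp [h1, h2, mul_comm]
  rw [h1, integral_withDensity_eq_integral_toReal_smul₀ hρ.measurable_density
    (Eventually.of_forall fun x => ENNReal.ofReal_lt_top),
    intervalIntegral.integral_of_le (front_nonneg ρ T), integral_Ioc_eq_integral_Ioo]
  refine setIntegral_congr_fun measurableSet_Ioo fun x hx => ?_
  simp only [smul_eq_mul]
  rw [ENNReal.toReal_ofReal (hρ.pos x hx.1.le).le]

theorem IsDensity.exists_state (hρ : IsDensity ρ) (hT : 0 < T) {y : ℝ → ℝ}
    (hy : ContinuousOn y (Icc 0 (front ρ T))) : ∃ Y : Inner ρ T, Y =ᵐ[spaceMeasure ρ T] y := by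
  obtain ⟨Φ, -, hΦ⟩ := hρ.exists_transport hT
  have hc : ContinuousOn (fun t => y (front ρ (T - t))) (Icc 0 T) := by
    refine hy.comp ((hρ.continuous_front.comp (by fun_prop)).continuousOn) fun t ht =>
      ⟨front_nonneg ρ _, hρ.monotone_front (by linarith [ht.1])⟩
  refine ⟨Φ (toOuter T fun t => y (front ρ (T - t))), ?_⟩
  filter_upwards [hΦ (toOuter T fun t => y (front ρ (T - t))), hρ.ae_delay hT (coeFn_toOuter hc),
    ae_mem_spaceMeasure ρ T] with x h1 h2 hx
  rw [h1, h2, sub_sub_cancel, hρ.front_eikonal hx.1.le]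

/-- Green's identity for a Duhamel wave, which has zero Cauchy data at `t = 0` and at the front
`x = x(T)`. -/
theorem IsFundamentalSolution.green (hr : IsFundamentalSolution ρ q r) (hρ : IsDensity ρ)
    (hT : 0 < T) {v vx vxx vt vtt : ℝ → ℝ → ℝ} (hv : WaveOn ρ q (front ρ T) T v vx vxx vt vtt)
    (hvT : ∀ x ∈ Ioo 0 (front ρ T), v x T = 0) {f : ℝ → ℝ} (hf : ContDiff ℝ ∞ f) {ε : ℝ}
    (hε : 0 < ε) (hfε : ∀ t < ε, f t = 0) :
    ∫ x in (0 : ℝ)..front ρ T, ρ x * (vt x T * duhamel ρ r f x T) =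
      ∫ t in (0 : ℝ)..T, (v 0 t * f t - vx 0 t * duhamel ρ r f 0 t) := by
  have hu := hr.duhamel_solves f hf ⟨ε, hε, hfε⟩
  obtain ⟨ux, uxx, ut, utt, hw, hux0, hut0, hdx, -⟩ := hu.exists_waveOn
  have hX := hρ.front_pos hT
  have hfront : ∀ t ∈ Ioo 0 T, (fun x => duhamel ρ r f x t) =ᶠ[𝓝 (front ρ T)] fun _ => 0 :=
    fun t ht => hρ.duhamel_front hε hfε hT ht.2.le
  rw [(hw (front ρ T) T).green hv hX.le hT.le (hρ.continuousOn.mono Icc_subset_Ici_self)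
    (fun x hx => hu.initial x hx.1.le) (fun x hx => hut0 x hx.1.le)
    (fun t ht => (hfront t ht).eq_of_nhds) (fun t ht => ?_) hvT]
  · exact integral_congr_Ioo hT.le fun t ht => by rw [hux0 t ht.1.le]
  · exact (hdx _ hX t ht.1.le).unique
      ((hasDerivAt_const (front ρ T) (0 : ℝ)).congr_of_eventuallyEq (hfront t ht))

/-- The even continuation of a test control with respect to the final moment `T`. -/
theorem IsTest.reflect (hT : 0 < T) {g : ℝ → ℝ} (hg : IsTest T g) :
    ContDiff ℝ ∞ (fun t => g t + g (2 * T - t)) ∧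
      ∃ ε > 0, ∀ t < ε, g t + g (2 * T - t) = 0 := by
  refine ⟨hg.contDiff.add (hg.contDiff.comp (by fun_prop)), ?_⟩
  obtain ⟨ε, hε, h0, h1⟩ := hg.vanishes
  exact ⟨ε, hε, fun t ht => by rw [h0 t ht, h1 _ (by linarith), add_zero]⟩

theorem IsTest.deriv_reflect {g : ℝ → ℝ} (hg : IsTest T g) (t : ℝ) :
    _root_.deriv (fun t => g t + g (2 * T - t)) t =
      _root_.deriv g t - _root_.deriv g (2 * T - t) := by
  have h2 : HasDerivAt (fun t => g (2 * T - t)) (-_root_.deriv g (2 * T - t)) t := by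
    simpa using! (hg.hasDerivAt (2 * T - t)).comp t ((hasDerivAt_id t).const_sub (2 * T))
  exact ((hg.hasDerivAt t).add h2).deriv.trans (by ring)

/-- The odd part with respect to `t = T` of the wave with the evenly continued control `g` satisfies
the homogeneous Neumann condition, vanishes at `t = T`, and has there twice the velocity of the wave
with the control `g`. -/
theorem IsFrontKernel.exists_reflected_wave (hk : IsFrontKernel ρ r k k')
    (hr : IsFundamentalSolution ρ q r) (hρ : IsDensity ρ) (hT : 0 < T) {g : ℝ → ℝ}
    (hg : IsTest T g) :
    ∃ v vx vxx vt vtt : ℝ → ℝ → ℝ, WaveOn ρ q (front ρ T) T v vx vxx vt vtt ∧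
      (∀ x, v x T = 0) ∧ (∀ t ∈ Ioo 0 T, vx 0 t = 0) ∧
      (∀ x ∈ Ioo 0 (front ρ T), vt x T = 2 * duhamel ρ r (deriv g) x T) ∧
      ∀ t, v 0 t = duhamel ρ r (fun t => g t + g (2 * T - t)) 0 t -
        duhamel ρ r (fun t => g t + g (2 * T - t)) 0 (2 * T - t) := by
  obtain ⟨hF, ε, hε, hFε⟩ := hg.reflect hT
  obtain ⟨ux, uxx, ut, utt, hw, hux0, -, -, hdt⟩ := (hr.duhamel_solves _ hF ⟨ε, hε, hFε⟩).exists_waveOn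
  have h2T : 2 * T - T = T := by ring
  refine ⟨_, _, _, _, _, ((hw (front ρ T) (2 * T)).sub (hw (front ρ T) (2 * T)).reverse).mono le_rfl
    (by linarith), fun x => ?_, fun t ht => ?_, fun x hx => ?_, fun t => rfl⟩
  · simp only [h2T, sub_self]
  · rw [hux0 t ht.1.le, hux0 _ (by linarith [ht.1, ht.2]), sub_sub_cancel]
    ring
  · have h1 := (hdt x hx.1.le T hT).unique (hk.hasDerivAt_duhamel hF hε hFε hx.1.le T)
    have hτ := hρ.eikonal_lt hT hx
    have h2 : duhamel ρ r (deriv fun t => g t + g (2 * T - t)) x T = duhamel ρ r (deriv g) x T := by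
      refine intervalIntegral.integral_congr fun s hs => ?_
      rw [uIcc_of_le (by linarith)] at hs
      rw [hg.deriv_reflect, hg.deriv.apply_of_ge (t := 2 * T - s) (by linarith [hs.2, hρ.eikonal_nonneg hx.1.le]),
        sub_zero]
    simp only [h2T]
    rw [h1, h2]; ring

end

section

/-! ### Uniqueness of the fundamental solution -/

variable {ρ q : ℝ → ℝ} {T : ℝ} {r k k' : ℝ → ℝ → ℝ}

theorem IsDensity.eqOn_of_ae_eq (hρ : IsDensity ρ) (hT : 0 < T) {y z : ℝ → ℝ}
    (hy : ContinuousOn y (Icc 0 (front ρ T))) (hz : ContinuousOn z (Icc 0 (front ρ T)))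
    (h : y =ᵐ[spaceMeasure ρ T] z) : EqOn y z (Icc 0 (front ρ T)) := by
  have h1 := (ae_withDensity_iff' hρ.measurable_density).1 h
  have h2 : y =ᵐ[volume.restrict (Ioo 0 (front ρ T))] z := by
    filter_upwards [h1, ae_restrict_mem measurableSet_Ioo] with x hx hxX
    exact hx (by simpa using hρ.pos x hxX.1.le)
  rw [Measure.restrict_congr_set Ioo_ae_eq_Icc] at h2
  exact Measure.eqOn_Icc_of_ae_eq volume (hρ.front_pos hT).ne h2 hy hz

theorem eqOn_of_ae_eq_timeMeasure (hT : 0 < T) {y z : ℝ → ℝ}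
    (hy : ContinuousOn y (Icc 0 T)) (hz : ContinuousOn z (Icc 0 T))
    (h : y =ᵐ[timeMeasure T] z) : EqOn y z (Icc 0 T) := by
  rw [timeMeasure, Measure.restrict_congr_set Ioo_ae_eq_Icc] at h
  exact Measure.eqOn_Icc_of_ae_eq volume hT.ne h hy hz

theorem eq_of_inner_test {f f' : Outer T}
    (h : ∀ g, IsTest T g → ⟪toOuter T g, f⟫ = ⟪toOuter T g, f'⟫) : f = f' := by
  rw [← sub_eq_zero]
  refine eq_zero_of_forall_test _ fun g hg => ?_
  rw [← inner_toOuter hg.continuousOn, inner_sub_right, h g hg, sub_self]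

theorem SystemOperators.apply_test {W B : Outer T →L[ℝ] Inner ρ T} {R : Outer T →L[ℝ] Outer T}
    (h : SystemOperators ρ r k k' T W B R) (hρ : IsDensity ρ) (hT : 0 < T) {g : ℝ → ℝ}
    (hg : IsTest T g) : W (toOuter T g) =ᵐ[spaceMeasure ρ T] fun x => duhamel ρ r g x T := by
  filter_upwards [h.control (toOuter T g), ae_mem_spaceMeasure ρ T] with x h1 hx
  rw [h1, duhamel_toOuter hg.continuousOn (hρ.eikonal_nonneg hx.1.le) (hρ.eikonal_lt hT hx).le le_rfl]

theorem SystemOperators.velocity_test {W B : Outer T →L[ℝ] Inner ρ T} {R : Outer T →L[ℝ] Outer T}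
    (h : SystemOperators ρ r k k' T W B R) (hρ : IsDensity ρ) (hT : 0 < T) {g : ℝ → ℝ}
    (hg : IsTest T g) :
    B (toOuter T g) =ᵐ[spaceMeasure ρ T] fun x => duhamel ρ r (deriv g) x T := by
  rw [← integOp_deriv_test hg, h.comp_integOp]
  exact h.apply_test hρ hT hg.deriv

theorem SystemOperators.response_test {W B : Outer T →L[ℝ] Inner ρ T} {R : Outer T →L[ℝ] Outer T}
    (h : SystemOperators ρ r k k' T W B R) {g : ℝ → ℝ}
    (hg : IsTest T g) : R (toOuter T g) =ᵐ[timeMeasure T] fun t => duhamel ρ r g 0 t := by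
  filter_upwards [h.response (toOuter T g), ae_mem_timeMeasure] with t h1 ht
  rw [h1, duhamel_toOuter hg.continuousOn (by rw [eikonal_zero])
    (by rw [eikonal_zero]; exact ht.1.le) ht.2.le]

theorem IsClassicalWave.continuousOn_slice {f : ℝ → ℝ} {u : ℝ → ℝ → ℝ}
    (hu : IsClassicalWave ρ q f u) (hT : 0 ≤ T) (X : ℝ) :
    ContinuousOn (fun x => u x T) (Icc 0 X) :=
  hu.contDiffOn.continuousOn.comp (f := fun x => (x, T)) (by fun_prop) fun _ hx => ⟨hx.1, hT⟩

/-- Two fundamental solutions give the same wave, since the difference of the waves is orthogonal to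
all the velocities `u_t^g(·,T)`, which are dense by controllability. -/
theorem IsFundamentalSolution.duhamel_eqOn {r₀ : ℝ → ℝ → ℝ} (hr : IsFundamentalSolution ρ q r)
    (hr₀ : IsFundamentalSolution ρ q r₀) (hk : IsFrontKernel ρ r₀ k k') (hρ : IsDensity ρ)
    (hT : 0 < T) {f : ℝ → ℝ} (hf : ContDiff ℝ ∞ f) {ε : ℝ} (hε : 0 < ε) (hfε : ∀ t < ε, f t = 0) :
    EqOn (fun x => duhamel ρ r f x T) (fun x => duhamel ρ r₀ f x T) (Icc 0 (front ρ T)) := by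
  obtain ⟨W, B, R, hsys⟩ := hk.exists_operators hρ hT
  have hu := (hr.duhamel_solves f hf ⟨ε, hε, hfε⟩).continuousOn_slice hT.le (front ρ T)
  have hu₀ := (hr₀.duhamel_solves f hf ⟨ε, hε, hfε⟩).continuousOn_slice hT.le (front ρ T)
  obtain ⟨Z, hZ⟩ := hρ.exists_state hT (hu.sub hu₀)
  have hX := hρ.front_pos hT
  have hBZ : ContinuousLinearMap.adjoint B Z = 0 := by
    refine eq_of_inner_test fun g hg => ?_
    rw [ContinuousLinearMap.adjoint_inner_right, inner_zero_right,
      hρ.inner_state_eq (hsys.velocity_test hρ hT hg) hZ]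
    obtain ⟨v, vx, vxx, vt, vtt, hv, hvT, hvx, hvt, -⟩ := hk.exists_reflected_wave hr₀ hρ hT hg
    have h1 := hr.green hρ hT hv (fun x _ => hvT x) hf hε hfε
    have h2 := hr₀.green hρ hT hv (fun x _ => hvT x) hf hε hfε
    have h3 : ∫ t in (0 : ℝ)..T, (v 0 t * f t - vx 0 t * duhamel ρ r f 0 t) =
        ∫ t in (0 : ℝ)..T, (v 0 t * f t - vx 0 t * duhamel ρ r₀ f 0 t) :=
      integral_congr_Ioo hT.le fun t ht => by rw [hvx t ht, zero_mul, zero_mul]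
    have hρc : ContinuousOn ρ (Icc 0 (front ρ T)) := hρ.continuousOn.mono Icc_subset_Ici_self
    have hvtc : ContinuousOn (fun x => vt x T) (Icc 0 (front ρ T)) :=
      ContinuousOn.slice_fst hv.cont_t ⟨hT.le, le_rfl⟩
    have h4 : ∫ x in (0 : ℝ)..front ρ T, ρ x * (duhamel ρ r₀ (deriv g) x T *
        (duhamel ρ r f x T - duhamel ρ r₀ f x T)) = 2⁻¹ *
        ((∫ x in (0 : ℝ)..front ρ T, ρ x * (vt x T * duhamel ρ r f x T)) -
          ∫ x in (0 : ℝ)..front ρ T, ρ x * (vt x T * duhamel ρ r₀ f x T)) := by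
      have hi : ∀ {z : ℝ → ℝ}, ContinuousOn z (Icc 0 (front ρ T)) →
          IntervalIntegrable (fun x => ρ x * (vt x T * z x)) volume 0 (front ρ T) := fun hz =>
        (hρc.mul (hvtc.mul hz)).intervalIntegrable_of_Icc hX.le
      rw [← intervalIntegral.integral_sub (hi hu) (hi hu₀), ← intervalIntegral.integral_const_mul]
      refine integral_congr_Ioo hX.le fun x hx => ?_
      rw [hvt x hx]; ring
    exact h4.trans (by rw [h1, h2, h3, sub_self, mul_zero])
  have hZ0 : Z = 0 := by
    obtain ⟨f', hf'⟩ := hsys.bijective.2 Z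
    rw [← inner_self_eq_zero (𝕜 := ℝ)]
    nth_rw 1 [← hf']
    rw [← ContinuousLinearMap.adjoint_inner_right, hBZ, inner_zero_right]
  have h0 : (fun x => duhamel ρ r f x T - duhamel ρ r₀ f x T) =ᵐ[spaceMeasure ρ T] fun _ => 0 := by
    refine hZ.symm.trans ?_
    rw [hZ0]
    exact Lp.coeFn_zero ℝ 2 _
  intro x hx
  exact sub_eq_zero.1 (hρ.eqOn_of_ae_eq hT (hu.sub hu₀) continuousOn_const h0 hx)

/-- Every fundamental solution coincides behind the front with a given one, and therefore inherits its
kernel. -/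
theorem IsFundamentalSolution.isFrontKernel {r₀ : ℝ → ℝ → ℝ} (hr : IsFundamentalSolution ρ q r)
    (hr₀ : IsFundamentalSolution ρ q r₀) (hk : IsFrontKernel ρ r₀ k k') (hρ : IsDensity ρ) :
    IsFrontKernel ρ r k k' := by
  refine ⟨hk.cont, hk.hasDerivAt, hk.cont_deriv, hk.ne_zero, fun x hx t ht => ?_⟩
  have hτ := hρ.eikonal_nonneg hx
  set S : ℝ := t + 1 - eikonal ρ x with hS
  have hS0 : 0 < S := by linarith
  have hT : 0 < t + 1 := by linarith
  have hxX : x ∈ Icc 0 (front ρ (t + 1)) :=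
    ⟨hx, ((hρ.eikonal_lt_iff_lt_front hx hT.le).1 (by linarith)).le⟩
  have hrc : ContinuousOn (fun s => r x (t + 1 - s)) (Icc 0 S) :=
    hr.contDiffOn.continuousOn.comp (f := fun s => (x, t + 1 - s)) (by fun_prop)
      fun s hs => ⟨hx, show eikonal ρ x ≤ t + 1 - s by linarith [hs.2]⟩
  have hkc : ContinuousOn (fun s => k x (t + 1 - s)) (Icc 0 S) :=
    ((hk.cont.uncurry_left x).comp (by fun_prop : Continuous fun s : ℝ => t + 1 - s)).continuousOn
  have hD : ContinuousOn (fun s => r x (t + 1 - s) - k x (t + 1 - s)) (Icc 0 S) := hrc.sub hkc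
  have h0 : toOuter S (fun s => r x (t + 1 - s) - k x (t + 1 - s)) = 0 := by
    refine eq_zero_of_forall_test _ fun g hg => ?_
    obtain ⟨ε, hε, hgε, -⟩ := hg.vanishes
    have h1 := hr.duhamel_eqOn hr₀ hk hρ hT hg.contDiff hε hgε hxX
    simp only at h1
    rw [hk.duhamel_eq hx (by linarith), ← hS, duhamel, ← hS] at h1
    rw [← intervalIntegral_eq_timeMeasure hS0.le, integral_congr_toOuter hD _
      ⟨le_rfl, hS0.le⟩ ⟨hS0.le, le_rfl⟩]
    have h2 : ∀ s, g s * (r x (t + 1 - s) - k x (t + 1 - s)) =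
      r x (t + 1 - s) * g s - k x (t + 1 - s) * g s := fun s => by ring
    simp_rw [h2]
    have hi : ∀ {z : ℝ → ℝ}, ContinuousOn z (Icc 0 S) →
        IntervalIntegrable (fun s => z s * g s) volume 0 S := fun hz =>
      (hz.mul hg.continuousOn).intervalIntegrable_of_Icc hS0.le
    rw [intervalIntegral.integral_sub (hi hrc) (hi hkc), h1, sub_self]
  have h1 := (coeFn_toOuter hD).symm
  rw [h0] at h1
  have h2 := eqOn_of_ae_eq_timeMeasure hS0 hD continuousOn_const
    (h1.trans (Lp.coeFn_zero ℝ 2 _)) (⟨zero_le_one, by linarith⟩ : (1 : ℝ) ∈ Icc 0 S)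
  simp only [add_sub_cancel_right] at h2
  exact sub_eq_zero.1 h2

/-! ### The special boundary control problem -/

namespace SystemOperators

variable {W B : Outer T →L[ℝ] Inner ρ T} {R : Outer T →L[ℝ] Outer T}

theorem extendsVelocity (h : SystemOperators ρ r k k' T W B R) : ExtendsVelocity W B := by
  intro f g hfg
  rw [(isTimeDeriv_iff f g).1 hfg, h.comp_integOp]

theorem eq_of_extendsVelocity (h : SystemOperators ρ r k k' T W B R)
    {B' : Outer T →L[ℝ] Inner ρ T} (hB' : ExtendsVelocity W B') : B' = B :=
  ext_comp_integOp fun f => (hB' _ f ((isTimeDeriv_iff _ _).2 rfl)).trans (h.comp_integOp f).symm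

/-- The operator `-(d/dt) C d/dt` equals `B†B`. -/
theorem adjoint_integOp_sandwich (h : SystemOperators ρ r k k' T W B R) (f : Outer T) :
    ContinuousLinearMap.adjoint (integOp T) ((ContinuousLinearMap.adjoint B).comp B (integOp T f)) =
      connecting W f := by
  have hW : W = B.comp (integOp T) := ContinuousLinearMap.ext fun f => (h.comp_integOp f).symm
  rw [connecting, hW, ContinuousLinearMap.adjoint_comp]
  rfl

theorem extendsSandwich (h : SystemOperators ρ r k k' T W B R) (hT : 0 < T) :
    ExtendsSandwich (connecting W) ((ContinuousLinearMap.adjoint B).comp B) := by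
  intro f g hfg
  rw [isAdjointTimeDeriv_iff hT, (isTimeDeriv_iff f g).1 hfg, h.adjoint_integOp_sandwich]

theorem eq_of_extendsSandwich (h : SystemOperators ρ r k k' T W B R) (hT : 0 < T)
    {A' : Outer T →L[ℝ] Outer T} (hA' : ExtendsSandwich (connecting W) A') :
    A' = (ContinuousLinearMap.adjoint B).comp B := by
  refine ext_comp_integOp fun f => adjoint_integOp_injective ?_
  rw [h.adjoint_integOp_sandwich,
    ← (isAdjointTimeDeriv_iff hT _ _).1 (hA' _ f ((isTimeDeriv_iff _ _).2 rfl))]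

theorem adjoint_injective (h : SystemOperators ρ r k k' T W B R) :
    Function.Injective (ContinuousLinearMap.adjoint B) := by
  refine (injective_iff_map_eq_zero _).2 fun Z hZ => ?_
  obtain ⟨f, rfl⟩ := h.bijective.2 Z
  rw [← inner_self_eq_zero (𝕜 := ℝ), ← ContinuousLinearMap.adjoint_inner_right, hZ,
    inner_zero_right]

end SystemOperators

/-- The separated solution `(t - T) y(x)` is a wave if `-y'' + q y = 0`. -/
theorem exists_waveOn_separated {X : ℝ} (hX : 0 < X) {y : ℝ → ℝ} (hy : ContDiffOn ℝ 2 y (Icc 0 X))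
    (hq : ∀ x ∈ Ioo 0 X, -iteratedDeriv 2 y x + q x * y x = 0) :
    ∃ vxx : ℝ → ℝ → ℝ, WaveOn ρ q X T (fun x t => (t - T) * y x)
      (fun x t => (t - T) * derivWithin y (Icc 0 X) x) vxx (fun x _ => y x) fun _ _ => 0 := by
  have hU := uniqueDiffOn_Icc hX
  have h1 : ContDiffOn ℝ 1 (derivWithin y (Icc 0 X)) (Icc 0 X) :=
    hy.derivWithin hU (by norm_num [one_add_one_eq_two])
  have h2 : ContinuousOn (derivWithin (derivWithin y (Icc 0 X)) (Icc 0 X)) (Icc 0 X) :=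
    h1.continuousOn_derivWithin hU le_rfl
  have hd : ∀ x ∈ Ioo 0 X, HasDerivAt y (derivWithin y (Icc 0 X) x) x := fun x hx =>
    ((hy.differentiableOn (by simp) x (Ioo_subset_Icc_self hx)).hasDerivWithinAt).hasDerivAt
      (Icc_mem_nhds hx.1 hx.2)
  have hd2 : ∀ x ∈ Ioo 0 X, HasDerivAt (derivWithin y (Icc 0 X))
      (derivWithin (derivWithin y (Icc 0 X)) (Icc 0 X) x) x := fun x hx =>
    ((h1.differentiableOn (by simp) x (Ioo_subset_Icc_self hx)).hasDerivWithinAt).hasDerivAt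
      (Icc_mem_nhds hx.1 hx.2)
  have hc : ∀ {z : ℝ → ℝ}, ContinuousOn z (Icc 0 X) →
      ContinuousOn (fun p : ℝ × ℝ => z p.1) (Icc 0 X ×ˢ Icc 0 T) := fun hz =>
    hz.comp continuousOn_fst fun _ hp => (mem_prod.1 hp).1
  have ht : ContinuousOn (fun p : ℝ × ℝ => p.2 - T) (Icc 0 X ×ˢ Icc 0 T) := by fun_prop
  refine ⟨fun x t => (t - T) * derivWithin (derivWithin y (Icc 0 X)) (Icc 0 X) x,
    ht.mul (hc hy.continuousOn), ht.mul (hc h1.continuousOn), ht.mul (hc h2),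
    hc hy.continuousOn, continuousOn_const, fun x hx t _ => (hd x hx).const_mul _,
    fun x hx t _ => (hd2 x hx).const_mul _, fun x _ t _ => ?_, fun x _ t _ => hasDerivAt_const _ _,
    fun x hx t _ => ?_⟩
  · simpa using! ((hasDerivAt_id t).sub_const T).mul_const (y x)
  · have e := hq x hx
    rw [iteratedDeriv_two_eq_of_mem_nhds (Ioo_mem_nhds hx.1 hx.2) hd (hd2 x hx)] at e
    linear_combination (t - T) * e

theorem coeFn_one : one T =ᵐ[timeMeasure T] fun _ => 1 := Lp.coeFn_const ..

/-- The equation of the special boundary control problem. Green's identity for the wave and for the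
separated solution `(t - T) y(x)` gives `W†Y = y(0) (t - T) - y'(0) R†(t - T)`. Since
`t - T = -V†1`, where `V` is the integration, `W = B V` and `V R = R V`, the factor `V†` cancels. -/
theorem SystemOperators.adjoint_state {W B : Outer T →L[ℝ] Inner ρ T} {R : Outer T →L[ℝ] Outer T}
    (h : SystemOperators ρ r k k' T W B R) (hr : IsFundamentalSolution ρ q r) (hρ : IsDensity ρ)
    (hT : 0 < T) {y : ℝ → ℝ} (hy : ContDiffOn ℝ 2 y (Icc 0 (front ρ T)))
    (hq : ∀ x ∈ Ioo 0 (front ρ T), -iteratedDeriv 2 y x + q x * y x = 0) {Y : Inner ρ T}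
    (hY : Y =ᵐ[spaceMeasure ρ T] y) :
    ContinuousLinearMap.adjoint B Y = (-y 0) • one T +
      (derivWithin y (Icc 0 (front ρ T)) 0) • ContinuousLinearMap.adjoint R (one T) := by
  set y₁ := derivWithin y (Icc 0 (front ρ T)) 0 with hy₁
  obtain ⟨vxx, hv⟩ := exists_waveOn_separated (ρ := ρ) (T := T) (hρ.front_pos hT) hy hq
  refine adjoint_integOp_injective (eq_of_inner_test fun g hg => ?_)
  obtain ⟨ε, hε, hgε, -⟩ := hg.vanishes
  have hadj : ContinuousLinearMap.adjoint (integOp T) (one T) =ᵐ[timeMeasure T] fun t => T - t := by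
    filter_upwards [coeFn_adjoint_integOp (one T), ae_mem_timeMeasure] with t h1 ht
    rw [h1, integral_congr_timeMeasure coeFn_one (Ioo_subset_Icc_self ht) ⟨hT.le, le_rfl⟩]
    simp
  have hRg := h.response_test hg
  have hRi : Integrable (fun t => (T - t) * R (toOuter T g) t) (timeMeasure T) :=
    ((memLp_of_continuousOn (by fun_prop : ContinuousOn (fun t => T - t) (Icc 0 T))).integrable_mul
      (Lp.memLp (R (toOuter T g))))
  have hgi : Integrable (fun t => (T - t) * g t) (timeMeasure T) :=
    (((by fun_prop : Continuous fun t : ℝ => T - t).mul hg.contDiff.continuous).continuousOn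
      (s := Icc 0 T)).integrableOn_Icc.mono_set Ioo_subset_Icc_self
  have e1 : ⟪toOuter T g, ContinuousLinearMap.adjoint (integOp T) (ContinuousLinearMap.adjoint B Y)⟫ =
      ∫ t in (0 : ℝ)..T, ((t - T) * y 0 * g t - (t - T) * y₁ * duhamel ρ r g 0 t) := by
    rw [ContinuousLinearMap.adjoint_inner_right, ContinuousLinearMap.adjoint_inner_right,
      h.comp_integOp, real_inner_comm, hρ.inner_state_eq hY (h.apply_test hρ hT hg),
      hr.green hρ hT hv (fun x _ => by simp) hg.contDiff hε hgε]
  have e2 : ⟪toOuter T g, ContinuousLinearMap.adjoint (integOp T)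
      ((-y 0) • one T + y₁ • ContinuousLinearMap.adjoint R (one T))⟫ =
      (-y 0) * (∫ t, (T - t) * g t ∂timeMeasure T) +
        y₁ * ∫ t, (T - t) * R (toOuter T g) t ∂timeMeasure T := by
    rw [ContinuousLinearMap.adjoint_inner_right, inner_add_right, inner_smul_right, inner_smul_right,
      ContinuousLinearMap.adjoint_inner_right, h.response_comm,
      ← ContinuousLinearMap.adjoint_inner_right (integOp T),
      ← ContinuousLinearMap.adjoint_inner_right (integOp T), inner_toOuter hg.continuousOn,
      inner_outer_eq]
    congr 2
    · refine integral_congr_ae ?_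
      filter_upwards [hadj] with t ht
      rw [ht, mul_comm]
    · refine integral_congr_ae ?_
      filter_upwards [hadj] with t ht
      rw [ht, mul_comm]
  rw [e1, e2, intervalIntegral_eq_timeMeasure hT.le, ← integral_const_mul, ← integral_const_mul,
    ← integral_add (hgi.const_mul _) (hRi.const_mul _)]
  refine integral_congr_ae ?_
  filter_upwards [hRg] with t ht
  rw [ht]; ring

end

section

/-! ### The operator `-(d/dt) C d/dt` through the response function -/

variable {ρ q : ℝ → ℝ} {T : ℝ} {r k k' : ℝ → ℝ → ℝ}

/-- The velocity at `x = 0`, at the moments `t` and `2T - t`, of the wave with the evenly continued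
test control `f`. -/
theorem IsFrontKernel.velocity_reflect (hk : IsFrontKernel ρ r k k') {f : ℝ → ℝ} (hT : 0 < T)
    (hf : IsTest T f) {t : ℝ} (ht : t ∈ Ioo 0 T) :
    duhamel ρ r (deriv fun t => f t + f (2 * T - t)) 0 t +
      duhamel ρ r (deriv fun t => f t + f (2 * T - t)) 0 (2 * T - t) =
    2 * (k 0 0 * f t + ∫ s in (0 : ℝ)..T, 2⁻¹ * (k' 0 |t - s| + k' 0 (2 * T - t - s)) * f s) := by
  obtain ⟨hF, ε, hε, hFε⟩ := hf.reflect hT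
  have hd : Continuous (k' 0) := hk.cont_deriv.uncurry_left 0
  have hfc := hf.contDiff.continuous
  have key : ∀ t ≥ 0, duhamel ρ r (deriv fun t => f t + f (2 * T - t)) 0 t =
      k 0 0 * (f t + f (2 * T - t)) + ∫ s in (0 : ℝ)..t, k' 0 (t - s) * (f s + f (2 * T - s)) := by
    intro t ht
    rw [hk.duhamel_eq le_rfl (by rwa [eikonal_zero]), eikonal_zero, sub_zero,
      hk.integral_deriv_eq hF (hFε 0 hε), sub_self]
  have hc1 : ∀ c : ℝ, Continuous fun s => k' 0 (c - s) * f s := fun c =>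
    (hd.comp (by fun_prop)).mul hfc
  have hc2 : Continuous fun s => k' 0 |t - s| * f s := (hd.comp (by fun_prop)).mul hfc
  have h1 : ∫ s in (0 : ℝ)..t, k' 0 (t - s) * (f s + f (2 * T - s)) =
      ∫ s in (0 : ℝ)..t, k' 0 |t - s| * f s := by
    refine integral_congr_Ioo ht.1.le fun s hs => ?_
    rw [hf.apply_of_ge (t := 2 * T - s) (by linarith [hs.2, ht.2]), add_zero,
      abs_of_pos (by linarith [hs.2])]
  have h2 : ∫ s in (0 : ℝ)..(2 * T - t), k' 0 (2 * T - t - s) * (f s + f (2 * T - s)) =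
      (∫ s in (0 : ℝ)..T, k' 0 (2 * T - t - s) * f s) + ∫ s in t..T, k' 0 |t - s| * f s := by
    have hc3 : Continuous fun s => k' 0 (2 * T - t - s) * (f s + f (2 * T - s)) :=
      (hd.comp (by fun_prop)).mul (hfc.add (hfc.comp (by fun_prop)))
    rw [← intervalIntegral.integral_add_adjacent_intervals (b := T) (hc3.intervalIntegrable _ _)
      (hc3.intervalIntegrable _ _)]
    congr 1
    · refine integral_congr_Ioo hT.le fun s hs => ?_
      rw [hf.apply_of_ge (t := 2 * T - s) (by linarith [hs.2]), add_zero]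
    · have e := intervalIntegral.integral_comp_sub_left (a := t) (b := T)
        (fun s => k' 0 (2 * T - t - s) * (f s + f (2 * T - s))) (2 * T)
      rw [show 2 * T - T = T by ring] at e
      rw [← e]
      refine integral_congr_Ioo ht.2.le fun s hs => ?_
      rw [hf.apply_of_ge (t := 2 * T - s) (by linarith [hs.2]), zero_add, sub_sub_cancel,
        abs_of_neg (by linarith [hs.1])]
      congr 2; ring
  have h3 : ∫ s in (0 : ℝ)..T, 2⁻¹ * (k' 0 |t - s| + k' 0 (2 * T - t - s)) * f s =
      2⁻¹ * (((∫ s in (0 : ℝ)..t, k' 0 |t - s| * f s) + ∫ s in t..T, k' 0 |t - s| * f s) +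
        ∫ s in (0 : ℝ)..T, k' 0 (2 * T - t - s) * f s) := by
    rw [intervalIntegral.integral_add_adjacent_intervals (hc2.intervalIntegrable _ _)
      (hc2.intervalIntegrable _ _), ← intervalIntegral.integral_add (hc2.intervalIntegrable _ _)
      ((hc1 _).intervalIntegrable _ _), ← intervalIntegral.integral_const_mul]
    refine intervalIntegral.integral_congr fun s _ => ?_
    ring
  rw [key t ht.1.le, key (2 * T - t) (by linarith [ht.1, ht.2]), h1, h2, h3, sub_sub_cancel,
    hf.apply_of_ge (t := 2 * T - t) (by linarith [ht.2])]
  ring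

/-- The kernel `½ (d(|t - s|) + d(2T - t - s))`. -/
theorem continuous_reflected_kernel {d : ℝ → ℝ} (hd : Continuous d) (T : ℝ) :
    Continuous (Function.uncurry fun t s => 2⁻¹ * (d |t - s| + d (2 * T - t - s))) :=
  continuous_const.mul ((hd.comp (by fun_prop)).add (hd.comp (by fun_prop)))

/-- The operator `-(d/dt) C d/dt` is an integral operator of the second kind, with the kernel
expressed through the derivative of the response function. For test controls, `2 ⟪Bg, Bf⟫` is computed
by Green's identity for the wave with the control `g'` and the reflected wave of `f`. -/
theorem SystemOperators.adjoint_comp {W B : Outer T →L[ℝ] Inner ρ T} {R : Outer T →L[ℝ] Outer T}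
    (h : SystemOperators ρ r k k' T W B R) (hk : IsFrontKernel ρ r k k')
    (hr : IsFundamentalSolution ρ q r) (hρ : IsDensity ρ) (hT : 0 < T) (f : Outer T) :
    ContinuousLinearMap.adjoint B (B f) =ᵐ[timeMeasure T] fun t =>
      -k 0 0 * f t - ∫ s in (0 : ℝ)..T, 2⁻¹ * (k' 0 |t - s| + k' 0 (2 * T - t - s)) * f s := by
  have hd : Continuous (k' 0) := hk.cont_deriv.uncurry_left 0
  have hκ := continuous_reflected_kernel hd T
  set κ : ℝ → ℝ → ℝ := fun t s => 2⁻¹ * (k' 0 |t - s| + k' 0 (2 * T - t - s))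
  set S : Outer T →L[ℝ] Outer T := (-k 0 0) • ContinuousLinearMap.id ℝ (Outer T) - kernelOp T κ
    with hS
  have hSf : ∀ f : Outer T, S f =ᵐ[timeMeasure T] fun t =>
      -k 0 0 * f t - ∫ s in (0 : ℝ)..T, κ t s * f s := fun f => by
    have e : S f = (-k 0 0) • f - kernelOp T κ f := rfl
    filter_upwards [Lp.coeFn_sub ((-k 0 0) • f) (kernelOp T κ f), Lp.coeFn_smul (-k 0 0) f,
      coeFn_kernelOp (isBoundedKernel_of_continuous hκ) f] with t h1 h2 h3
    rw [e, h1, Pi.sub_apply, h2, h3, Pi.smul_apply, smul_eq_mul,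
      intervalIntegral_eq_timeMeasure hT.le]
  suffices hBS : (ContinuousLinearMap.adjoint B).comp B = S by
    rw [← ContinuousLinearMap.comp_apply, hBS]; exact hSf f
  refine ext_test fun f hf => eq_of_inner_test fun g hg => ?_
  obtain ⟨v, vx, vxx, vt, vtt, hv, hvT, hvx, hvt, hv0⟩ := hk.exists_reflected_wave hr hρ hT hf
  obtain ⟨hF, ε, hε, hFε⟩ := hf.reflect hT
  obtain ⟨δ, hδ, hgδ, -⟩ := hg.deriv.vanishes
  have h1 := hr.green hρ hT hv (fun x _ => hvT x) hg.deriv.contDiff hδ hgδ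
  have hvd : ∀ t, HasDerivAt (v 0) (duhamel ρ r (deriv fun t => f t + f (2 * T - t)) 0 t +
      duhamel ρ r (deriv fun t => f t + f (2 * T - t)) 0 (2 * T - t)) t := fun t => by
    have hP := hk.hasDerivAt_duhamel hF hε hFε le_rfl
    have h2 : HasDerivAt (fun t => duhamel ρ r (fun t => f t + f (2 * T - t)) 0 (2 * T - t))
        (-duhamel ρ r (deriv fun t => f t + f (2 * T - t)) 0 (2 * T - t)) t := by
      simpa using! (hP (2 * T - t)).comp t ((hasDerivAt_id t).const_sub (2 * T))
    rw [show v 0 = _ from funext hv0]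
    exact ((hP t).sub h2).congr_deriv (by ring)
  set Q : ℝ → ℝ := fun t => duhamel ρ r (deriv fun t => f t + f (2 * T - t)) 0 t +
      duhamel ρ r (deriv fun t => f t + f (2 * T - t)) 0 (2 * T - t) with hQ
  have hQc : Continuous Q := by
    have hFd : ContDiff ℝ ∞ (deriv fun t => f t + f (2 * T - t)) :=
      (contDiff_infty_iff_deriv.1 hF).2
    have hFε' : ∀ s < ε, deriv (fun t => f t + f (2 * T - t)) s = 0 := fun s hs => by
      have : (fun t => f t + f (2 * T - t)) =ᶠ[𝓝 s] fun _ => 0 := by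
        filter_upwards [Iio_mem_nhds hs] with y hy using hFε y hy
      rw [this.deriv_eq]; simp
    have hc : Continuous fun t => duhamel ρ r (deriv fun t => f t + f (2 * T - t)) 0 t :=
      continuous_iff_continuousAt.2 fun s =>
        (hk.hasDerivAt_duhamel hFd hε hFε' le_rfl s).continuousAt
    exact hc.add (hc.comp (by fun_prop : Continuous fun t : ℝ => 2 * T - t))
  have h2 : ∫ t in (0 : ℝ)..T, (v 0 t * deriv g t - vx 0 t * duhamel ρ r (deriv g) 0 t) =
      -∫ t in (0 : ℝ)..T, Q t * g t := by
    rw [integral_congr_Ioo hT.le (g := fun t => v 0 t * deriv g t)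
      fun t ht => by rw [hvx t ht, zero_mul, sub_zero],
      intervalIntegral.integral_mul_deriv_eq_deriv_mul (fun t _ => hvd t)
        (fun t _ => hg.hasDerivAt t) (hQc.intervalIntegrable _ _)
        (hg.deriv.contDiff.continuous.intervalIntegrable _ _),
      hg.apply_zero, hg.apply_of_ge le_rfl, mul_zero, mul_zero, sub_self, zero_sub]
  have h3 : ∫ x in (0 : ℝ)..front ρ T, ρ x * (duhamel ρ r (deriv g) x T * duhamel ρ r (deriv f) x T)
      = 2⁻¹ * ∫ x in (0 : ℝ)..front ρ T, ρ x * (vt x T * duhamel ρ r (deriv g) x T) := by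
    rw [← intervalIntegral.integral_const_mul]
    refine integral_congr_Ioo (hρ.front_pos hT).le fun x hx => ?_
    rw [hvt x hx]; ring
  rw [ContinuousLinearMap.comp_apply, ContinuousLinearMap.adjoint_inner_right,
    hρ.inner_state_eq (h.velocity_test hρ hT hg) (h.velocity_test hρ hT hf), h3, h1, h2,
    inner_toOuter hg.continuousOn, intervalIntegral_eq_timeMeasure hT.le, ← integral_neg,
    ← integral_const_mul]
  refine integral_congr_ae ?_
  filter_upwards [hSf (toOuter T f), coeFn_toOuter hf.continuousOn, ae_mem_timeMeasure]
    with t h4 h5 ht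
  rw [h4, h5, integral_congr_toOuter hf.continuousOn _ ⟨le_rfl, hT.le⟩ ⟨hT.le, le_rfl⟩, hQ]
  simp only
  rw [hk.velocity_reflect hT hf ht]
  simp only [κ]
  ring

end

section

/-! ### Integral equations on a variable interval -/

/-- The solutions `p(ξ,·)` of the equations `a p - ∫₀^ξ κ(·,s) p(s) ds = F` with a fixed right-hand
side are differentiable in `ξ`, provided the equations are stable uniformly for bounded `ξ`. -/
theorem hasDerivWithinAt_solution {a : ℝ} {κ : ℝ → ℝ → ℝ} (hκ : Continuous (Function.uncurry κ))
    {F : ℝ → ℝ} {p : ℝ → ℝ → ℝ} (hpc : ∀ ξ > 0, Continuous (p ξ))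
    (hp : ∀ ξ > 0, ∀ s, a * p ξ s - ∫ σ in (0 : ℝ)..ξ, κ s σ * p ξ σ = F s)
    (hstab : ∀ S > 0, ∃ C, ∀ ξ ∈ Ioc 0 S, ∀ h : ℝ → ℝ, Continuous h → ∀ M > 0,
      (∀ s ∈ Icc 0 ξ, |a * h s - ∫ σ in (0 : ℝ)..ξ, κ s σ * h σ| ≤ M) → ∀ s ∈ Icc 0 ξ, |h s| ≤ C * M)
    {ξ : ℝ} (hξ : 0 < ξ) {G : ℝ → ℝ} (hGc : Continuous G)
    (hG : ∀ s, a * G s - ∫ σ in (0 : ℝ)..ξ, κ s σ * G σ = κ s ξ) {s : ℝ} (hs : s ∈ Icc 0 ξ) :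
    HasDerivWithinAt (fun η => p η s) (p ξ ξ * G s) (Ici s) ξ := by
  have hP := hpc ξ hξ
  -- the linear approximation `w η` solves the equation on `[0,η]` up to a small residual
  set w : ℝ → ℝ → ℝ := fun η σ => p ξ σ + (η - ξ) * (p ξ ξ * G σ) with hw
  have hwc : Continuous (Function.uncurry w) :=
    (hP.comp continuous_snd).add ((continuous_fst.sub continuous_const).mul
      (continuous_const.mul (hGc.comp continuous_snd)))
  have hκs : ∀ s, Continuous (κ s) := fun s => hκ.uncurry_left s
  have hi : ∀ s {z : ℝ → ℝ} (b c : ℝ), Continuous z →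
      IntervalIntegrable (fun σ => κ s σ * z σ) volume b c := fun s z b c hz =>
    ((hκs s).mul hz).intervalIntegrable _ _
  have hres : ∀ η > 0, ∀ s, a * (w η s - p η s) - ∫ σ in (0 : ℝ)..η, κ s σ * (w η σ - p η σ) =
      -∫ σ in ξ..η, (κ s σ * w η σ - p ξ ξ * κ s ξ) := by
    intro η hη s
    have hwη : Continuous (w η) := hwc.uncurry_left η
    have e1 : ∫ σ in (0 : ℝ)..η, κ s σ * (w η σ - p η σ) =
        (∫ σ in (0 : ℝ)..η, κ s σ * w η σ) - ∫ σ in (0 : ℝ)..η, κ s σ * p η σ := by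
      rw [← intervalIntegral.integral_sub (hi s _ _ hwη) (hi s _ _ (hpc η hη))]
      simp_rw [mul_sub]
    have e2 : ∫ σ in (0 : ℝ)..ξ, κ s σ * w η σ = (∫ σ in (0 : ℝ)..ξ, κ s σ * p ξ σ) +
        (η - ξ) * p ξ ξ * ∫ σ in (0 : ℝ)..ξ, κ s σ * G σ := by
      rw [← intervalIntegral.integral_const_mul, ← intervalIntegral.integral_add (hi s _ _ hP)
        ((hi s _ _ hGc).const_mul _)]
      refine intervalIntegral.integral_congr fun σ _ => ?_
      simp only [hw]; ring
    have e3 : ∫ σ in ξ..η, (κ s σ * w η σ - p ξ ξ * κ s ξ) =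
        (∫ σ in ξ..η, κ s σ * w η σ) - (η - ξ) * (p ξ ξ * κ s ξ) := by
      rw [intervalIntegral.integral_sub (hi s _ _ hwη) (by simp), intervalIntegral.integral_const,
        smul_eq_mul]
    have e4 := intervalIntegral.integral_add_adjacent_intervals (hi s 0 ξ hwη) (hi s ξ η hwη)
    have e5 := hp η hη s
    have e6 := hp ξ hξ s
    have e7 := hG s
    rw [e1, e3]
    have e8 : w η s = p ξ s + (η - ξ) * (p ξ ξ * G s) := rfl
    rw [e8]
    linear_combination e4 - e2 - e5 + e6 + (η - ξ) * p ξ ξ * e7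
  rw [hasDerivWithinAt_iff_isLittleO, Asymptotics.isLittleO_iff]
  intro c hc
  obtain ⟨C, hC⟩ := hstab (2 * ξ) (by linarith)
  set ε : ℝ := c / max C 1 with hε
  have hm : 0 < max C 1 := lt_max_of_lt_right one_pos
  have hε0 : 0 < ε := div_pos hc hm
  have hΨ : Continuous fun z : (ℝ × ℝ) × ℝ =>
      κ z.2 z.1.2 * w z.1.1 z.1.2 - p ξ ξ * κ z.2 ξ :=
    ((hκ.comp (continuous_snd.prodMk (continuous_snd.comp continuous_fst))).mul
      (hwc.comp continuous_fst)).sub (continuous_const.mul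
        (hκ.comp (continuous_snd.prodMk continuous_const)))
  have hev : ∀ᶠ z : ℝ × ℝ in 𝓝 (ξ, ξ), ∀ s ∈ Icc 0 (2 * ξ),
      |κ s z.2 * w z.1 z.2 - p ξ ξ * κ s ξ| < ε := by
    refine isCompact_Icc.eventually_forall_of_forall_eventually fun s _ => ?_
    have h0 : |κ s ξ * w ξ ξ - p ξ ξ * κ s ξ| < ε := by
      have : κ s ξ * w ξ ξ - p ξ ξ * κ s ξ = 0 := by simp only [hw]; ring
      rwa [this, abs_zero]
    exact (hΨ.abs.continuousAt (x := ((ξ, ξ), s))).eventually (gt_mem_nhds h0)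
  obtain ⟨δ, hδ, hball⟩ := Metric.eventually_nhds_iff.1 hev
  have hev2 : ∀ᶠ η in 𝓝[Ici s] ξ, |η - ξ| < min δ ξ := by
    refine nhdsWithin_le_nhds ?_
    have : Tendsto (fun η => |η - ξ|) (𝓝 ξ) (𝓝 0) := by
      have : Continuous fun η => |η - ξ| := by fun_prop
      simpa using this.tendsto ξ
    exact this.eventually (gt_mem_nhds (lt_min hδ hξ))
  filter_upwards [hev2, self_mem_nhdsWithin] with η hη hsη
  have hη1 := hη.trans_le (min_le_left _ _)
  have hη2 := abs_lt.1 (hη.trans_le (min_le_right _ _))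
  have hη0 : 0 < η := by linarith [hη2.1]
  rcases eq_or_ne η ξ with rfl | hne
  · simp
  have hpos : 0 < |η - ξ| := abs_pos.2 (sub_ne_zero.2 hne)
  have hb := hC η ⟨hη0, by linarith [hη2.2]⟩ (fun s => w η s - p η s)
    ((hwc.uncurry_left η).sub (hpc η hη0)) (ε * |η - ξ|) (mul_pos hε0 hpos) (fun s hs => ?_) s
    ⟨hs.1, hsη⟩
  · have e : p η s - p ξ s - (η - ξ) • (p ξ ξ * G s) = -(w η s - p η s) := by
      simp only [hw, smul_eq_mul]; ring
    rw [e, norm_neg, Real.norm_eq_abs, Real.norm_eq_abs]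
    refine hb.trans ((mul_le_mul_of_nonneg_right (le_max_left C 1)
      (mul_pos hε0 hpos).le).trans (le_of_eq ?_))
    rw [hε, ← mul_assoc, mul_div_cancel₀ _ hm.ne']
  · rw [hres η hη0 s, abs_neg]
    rw [← Real.norm_eq_abs]
    refine intervalIntegral.norm_integral_le_of_norm_le_const (C := ε) fun σ hσ => ?_
    refine (hball (y := (η, σ)) ?_ s ⟨hs.1, by linarith [hs.2, hη2.2]⟩).le
    rw [Prod.dist_eq]
    refine max_lt hη1 ?_
    have h1 : |σ - ξ| ≤ |η - ξ| := abs_sub_left_of_mem_uIcc (uIoc_subset_uIcc hσ)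
    exact h1.trans_lt hη1

/-! ### The folded integral equations -/

/-- The kernel `½ (d(|s - σ|) + d(s + σ))`. -/
noncomputable def evenKernel (d : ℝ → ℝ) (s σ : ℝ) : ℝ := 2⁻¹ * (d |s - σ| + d (s + σ))

theorem continuous_evenKernel {d : ℝ → ℝ} (hd : Continuous d) :
    Continuous (Function.uncurry (evenKernel d)) :=
  continuous_const.mul ((hd.comp (by fun_prop)).add (hd.comp (by fun_prop)))

/-- The substitution `s = T - t` makes the kernel of `B†B` independent of `T`. -/
theorem integral_reflected_kernel (d P : ℝ → ℝ) (T s : ℝ) :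
    ∫ σ in (0 : ℝ)..T, 2⁻¹ * (d |T - s - σ| + d (2 * T - (T - s) - σ)) * P (T - σ) =
      ∫ σ in (0 : ℝ)..T, evenKernel d s σ * P σ := by
  have e := intervalIntegral.integral_comp_sub_left (a := 0) (b := T)
    (fun σ => evenKernel d s σ * P σ) T
  rw [sub_self, sub_zero] at e
  rw [← e]
  refine intervalIntegral.integral_congr fun σ _ => ?_
  simp only [evenKernel]
  rw [abs_sub_comm, show σ - (T - s) = s - (T - σ) by ring,
    show 2 * T - (T - s) - σ = s + (T - σ) by ring]

theorem continuous_integral_outer {T : ℝ} (hT : 0 ≤ T) {κ : ℝ → ℝ → ℝ}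
    (hκ : Continuous (Function.uncurry κ)) (f : Outer T) :
    Continuous fun t => ∫ s in (0 : ℝ)..T, κ t s * f s := by
  have hf := intervalIntegrable_outer f (⟨le_rfl, hT⟩ : (0 : ℝ) ∈ Icc 0 T) ⟨hT, le_rfl⟩
  refine continuous_iff_continuousAt.2 fun t₀ => ?_
  obtain ⟨C, hC⟩ := ((isCompact_Icc (a := t₀ - 1) (b := t₀ + 1)).prod
    (isCompact_Icc (a := 0) (b := T))).exists_bound_of_continuousOn hκ.continuousOn
  refine intervalIntegral.continuousAt_of_dominated_interval (bound := fun s => C * ‖f s‖)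
    (Eventually.of_forall fun t => ?_) ?_ (hf.norm.const_mul C)
    (Eventually.of_forall fun s _ => ?_)
  · exact ((hκ.uncurry_left t).aestronglyMeasurable).mul
      (intervalIntegrable_iff.1 hf).aestronglyMeasurable
  · filter_upwards [Icc_mem_nhds (by linarith : t₀ - 1 < t₀) (by linarith : t₀ < t₀ + 1)] with t ht
    refine Eventually.of_forall fun s hs => ?_
    rw [uIoc_of_le hT] at hs
    rw [norm_mul]
    exact mul_le_mul_of_nonneg_right (hC (t, s) ⟨ht, Ioc_subset_Icc_self hs⟩) (norm_nonneg _)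
  · exact ((hκ.uncurry_right s).mul continuous_const).continuousAt

namespace SystemOperators

variable {ρ q : ℝ → ℝ} {T : ℝ} {r k k' : ℝ → ℝ → ℝ} {W B : Outer T →L[ℝ] Inner ρ T}
  {R : Outer T →L[ℝ] Outer T}

theorem exists_adjoint_eq (h : SystemOperators ρ r k k' T W B R) (z : Outer T) :
    ∃ f, ContinuousLinearMap.adjoint B (B f) = z := by
  set e := ContinuousLinearEquiv.ofBijective B (LinearMap.ker_eq_bot.2 h.bijective.1)
    (LinearMap.range_eq_top.2 h.bijective.2)
  obtain ⟨f, hf⟩ := h.bijective.2 (ContinuousLinearMap.adjoint (e.symm : _ →L[ℝ] Outer T) z)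
  refine ⟨f, ?_⟩
  have h1 : (e.symm : Inner ρ T →L[ℝ] Outer T).comp B = ContinuousLinearMap.id ℝ _ :=
    ContinuousLinearMap.ext fun g => e.symm_apply_apply g
  rw [hf, ← ContinuousLinearMap.comp_apply, ← ContinuousLinearMap.adjoint_comp, h1]
  exact ContinuousLinearMap.ext_iff.1 ContinuousLinearMap.adjoint_id z

/-- Coercivity of `B†B`. -/
theorem exists_norm_sq_le (h : SystemOperators ρ r k k' T W B R) :
    ∃ D > 0, ∀ f : Outer T, ⟪f, f⟫ ≤ D * ⟪f, ContinuousLinearMap.adjoint B (B f)⟫ := by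
  set e := ContinuousLinearEquiv.ofBijective B (LinearMap.ker_eq_bot.2 h.bijective.1)
    (LinearMap.range_eq_top.2 h.bijective.2)
  refine ⟨‖(e.symm : Inner ρ T →L[ℝ] Outer T)‖ ^ 2 + 1, by positivity, fun f => ?_⟩
  rw [ContinuousLinearMap.adjoint_inner_right, real_inner_self_eq_norm_sq,
    real_inner_self_eq_norm_sq]
  have h1 : ‖f‖ ≤ ‖(e.symm : Inner ρ T →L[ℝ] Outer T)‖ * ‖B f‖ := by
    have := (e.symm : Inner ρ T →L[ℝ] Outer T).le_opNorm (B f)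
    rwa [show (e.symm : Inner ρ T →L[ℝ] Outer T) (B f) = f from e.symm_apply_apply f] at this
  have h2 := pow_le_pow_left₀ (norm_nonneg f) h1 2
  rw [mul_pow] at h2
  nlinarith [sq_nonneg ‖B f‖]

/-- The equation `a p - ∫₀^T κ(·,s) p(s) ds = F` is solvable in continuous functions, and the solution
determines the control `f(t) = p(T - t)` with `B†B f = F(T - ·)`. -/
theorem exists_continuous_solution (h : SystemOperators ρ r k k' T W B R)
    (hk : IsFrontKernel ρ r k k') (hr : IsFundamentalSolution ρ q r) (hρ : IsDensity ρ) (hT : 0 < T)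
    {F : ℝ → ℝ} (hF : Continuous F) :
    ∃ P : ℝ → ℝ, Continuous P ∧
      (∀ s, -k 0 0 * P s - ∫ σ in (0 : ℝ)..T, evenKernel (k' 0) s σ * P σ = F s) ∧
      ∃ f : Outer T, (f =ᵐ[timeMeasure T] fun t => P (T - t)) ∧
        ContinuousLinearMap.adjoint B (B f) = toOuter T fun t => F (T - t) := by
  have hd : Continuous (k' 0) := hk.cont_deriv.uncurry_left 0
  have hk0 : k 0 0 ≠ 0 := by simpa [eikonal_zero] using hk.ne_zero 0 le_rfl
  have hFc : Continuous fun t => F (T - t) := hF.comp (by fun_prop)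
  obtain ⟨f, hf⟩ := h.exists_adjoint_eq (toOuter T fun t => F (T - t))
  have hκ := continuous_reflected_kernel hd T
  have hI := (continuous_integral_outer hT.le hκ f).comp (by fun_prop : Continuous fun s => T - s)
  set I : ℝ → ℝ := fun t =>
    ∫ σ in (0 : ℝ)..T, 2⁻¹ * (k' 0 |t - σ| + k' 0 (2 * T - t - σ)) * f σ with hIdef
  have hfP : f =ᵐ[timeMeasure T] fun t => (F (T - t) + I (T - (T - t))) / -k 0 0 := by
    filter_upwards [h.adjoint_comp hk hr hρ hT f, coeFn_toOuter (T := T) hFc.continuousOn]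
      with t h1 h2
    rw [hf, h2] at h1
    rw [sub_sub_cancel, eq_div_iff (neg_ne_zero.2 hk0), h1]
    ring
  refine ⟨fun s => (F s + I (T - s)) / -k 0 0, (hF.add hI).div_const _, fun s => ?_, f, hfP, hf⟩
  have e : I (T - s) = ∫ σ in (0 : ℝ)..T, evenKernel (k' 0) s σ * ((F σ + I (T - σ)) / -k 0 0) := by
    rw [← integral_reflected_kernel (k' 0) (fun s => (F s + I (T - s)) / -k 0 0), hIdef]
    refine integral_congr_timeMeasure (T := T) ?_ ⟨le_rfl, hT.le⟩ ⟨hT.le, le_rfl⟩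
    filter_upwards [hfP] with σ hσ
    rw [hσ]
  rw [← e]
  field_simp
  ring

end SystemOperators

/-- Stability of the folded equations, uniform for bounded `ξ`: a continuous function on `[0,ξ]`,
extended by zero to `[0,S]`, is estimated through the coercivity of `B†B` on `L₂(0,S)`. -/
theorem IsFrontKernel.stability {ρ q : ℝ → ℝ} {r k k' : ℝ → ℝ → ℝ} (hk : IsFrontKernel ρ r k k')
    (hr : IsFundamentalSolution ρ q r) (hρ : IsDensity ρ) {S : ℝ} (hS : 0 < S) :
    ∃ C, ∀ ξ ∈ Ioc 0 S, ∀ h : ℝ → ℝ, Continuous h → ∀ M > 0,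
      (∀ s ∈ Icc 0 ξ, |-k 0 0 * h s - ∫ σ in (0 : ℝ)..ξ, evenKernel (k' 0) s σ * h σ| ≤ M) →
        ∀ s ∈ Icc 0 ξ, |h s| ≤ C * M := by
  obtain ⟨W, B, R, hsys⟩ := hk.exists_operators hρ hS
  obtain ⟨D, hD, hDf⟩ := hsys.exists_norm_sq_le
  have hk0 : k 0 0 ≠ 0 := by simpa [eikonal_zero] using hk.ne_zero 0 le_rfl
  have hκ := continuous_evenKernel (hk.cont_deriv.uncurry_left 0)
  obtain ⟨K, hK⟩ := ((isCompact_Icc (a := 0) (b := S)).prod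
    (isCompact_Icc (a := 0) (b := S))).exists_bound_of_continuousOn hκ.continuousOn
  have hK0 : 0 ≤ K := (norm_nonneg _).trans (hK (0, 0) ⟨⟨le_rfl, hS.le⟩, ⟨le_rfl, hS.le⟩⟩)
  refine ⟨(1 + K * (D * S)) / |k 0 0|, fun ξ hξ h hh M hM hres => ?_⟩
  set E : ℝ → ℝ := {x | x ≤ ξ}.indicator h with hE
  have hEm : MemLp (fun t => E (S - t)) 2 (timeMeasure S) := by
    have : (fun t => E (S - t)) = {t | S - ξ ≤ t}.indicator fun t => h (S - t) := by
      ext t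
      by_cases ht : S - t ≤ ξ
      · rw [hE, indicator_of_mem (by exact ht), indicator_of_mem (by exact (by linarith : S - ξ ≤ t))]
      · rw [hE, indicator_of_notMem (by exact ht),
          indicator_of_notMem (by exact fun h : S - ξ ≤ t => ht (by linarith))]
    rw [this]
    exact (memLp_of_continuousOn (hh.comp (by fun_prop :
      Continuous fun t => S - t)).continuousOn).indicator measurableSet_Ici
  have hcut : ∀ Φ : ℝ → ℝ, ∫ s in (0 : ℝ)..S, Φ s * E s = ∫ s in (0 : ℝ)..ξ, Φ s * h s := by
    intro Φ
    rw [← intervalIntegral.integral_indicator (f := fun s => Φ s * h s)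
      (⟨hξ.1.le, hξ.2⟩ : ξ ∈ Icc 0 S)]
    refine intervalIntegral.integral_congr fun s _ => ?_
    by_cases hs : s ≤ ξ
    · simp only [hE]; rw [indicator_of_mem (by exact hs), indicator_of_mem (by exact hs)]
    · simp only [hE]; rw [indicator_of_notMem (by exact hs), indicator_of_notMem (by exact hs), mul_zero]
  have hE2 : ∀ s, s ≤ ξ → E s = h s := fun s hs => indicator_of_mem (by exact hs) _
  have hres_c : Continuous fun s => -k 0 0 * h s - ∫ σ in (0 : ℝ)..ξ, evenKernel (k' 0) s σ * h σ :=
    (continuous_const.mul hh).sub (intervalIntegral.continuous_parametric_intervalIntegral_of_continuous'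
      (hκ.mul (hh.comp continuous_snd)) _ _)
  have hrefl : ∀ Φ : ℝ → ℝ, ∫ t, Φ (S - t) ∂timeMeasure S = ∫ s in (0 : ℝ)..S, Φ s := fun Φ => by
    rw [← intervalIntegral_eq_timeMeasure hS.le, intervalIntegral.integral_comp_sub_left, sub_self,
      sub_zero]
  set f : Outer S := hEm.toLp _
  have hf : f =ᵐ[timeMeasure S] fun t => E (S - t) := hEm.coeFn_toLp
  have h1 : ⟪f, f⟫ = ∫ s in (0 : ℝ)..ξ, h s ^ 2 := by
    rw [inner_outer_eq]
    calc ∫ t, f t * f t ∂timeMeasure S = ∫ t, E (S - t) * E (S - t) ∂timeMeasure S :=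
          integral_congr_ae (by filter_upwards [hf] with t ht; rw [ht])
      _ = ∫ s in (0 : ℝ)..ξ, E s * h s := (hrefl fun s => E s * E s).trans (hcut E)
      _ = _ := integral_congr_Ioo hξ.1.le fun s hs => by rw [hE2 s hs.2.le]; ring
  have h2 : ⟪f, ContinuousLinearMap.adjoint B (B f)⟫ = ∫ s in (0 : ℝ)..ξ,
      (-k 0 0 * h s - ∫ σ in (0 : ℝ)..ξ, evenKernel (k' 0) s σ * h σ) * h s := by
    rw [inner_outer_eq]
    calc ∫ t, f t * ContinuousLinearMap.adjoint B (B f) t ∂timeMeasure S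
        = ∫ t, (-k 0 0 * E (S - t) - ∫ σ in (0 : ℝ)..S, evenKernel (k' 0) (S - t) σ * E σ) *
            E (S - t) ∂timeMeasure S := by
          refine integral_congr_ae ?_
          filter_upwards [hf, hsys.adjoint_comp hk hr hρ hS f] with t h1 h2
          rw [h1, h2, h1, ← integral_reflected_kernel (k' 0) E S (S - t), sub_sub_cancel, mul_comm]
          congr 2
          refine integral_congr_timeMeasure (T := S) ?_ ⟨le_rfl, hS.le⟩ ⟨hS.le, le_rfl⟩
          filter_upwards [hf] with σ hσ
          rw [hσ]
      _ = ∫ s in (0 : ℝ)..ξ, (-k 0 0 * E s - ∫ σ in (0 : ℝ)..S, evenKernel (k' 0) s σ * E σ) * h s :=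
          (hrefl fun s => (-k 0 0 * E s - ∫ σ in (0 : ℝ)..S, evenKernel (k' 0) s σ * E σ) * E s).trans
            (hcut _)
      _ = _ := integral_congr_Ioo hξ.1.le fun s hs => by rw [hE2 s hs.2.le, hcut]
  set I : ℝ := ∫ s in (0 : ℝ)..ξ, |h s| with hI
  set J : ℝ := ∫ s in (0 : ℝ)..ξ, h s ^ 2 with hJ
  have hh2 : Continuous fun s => h s ^ 2 := hh.pow 2
  have hIi : IntervalIntegrable (fun s => |h s|) volume 0 ξ := hh.abs.intervalIntegrable _ _
  have h3 : J ≤ D * (M * I) := by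
    have h4 := hDf f
    rw [h1, h2] at h4
    refine h4.trans (mul_le_mul_of_nonneg_left ?_ hD.le)
    rw [hI, ← intervalIntegral.integral_const_mul]
    refine intervalIntegral.integral_mono_on hξ.1.le ((hres_c.mul hh).intervalIntegrable _ _)
      (hIi.const_mul M) fun s hs => ?_
    refine (le_abs_self _).trans ?_
    rw [abs_mul]
    exact mul_le_mul_of_nonneg_right (hres s hs) (abs_nonneg _)
  have h5 : 2 * (D * M) * I ≤ J + (D * M) ^ 2 * ξ := by
    have e : J + (D * M) ^ 2 * ξ = ∫ s in (0 : ℝ)..ξ, (h s ^ 2 + (D * M) ^ 2) := by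
      rw [intervalIntegral.integral_add (hh2.intervalIntegrable _ _)
        intervalIntegrable_const]
      simp [hJ, mul_comm]
    rw [e, hI, ← intervalIntegral.integral_const_mul]
    refine intervalIntegral.integral_mono_on hξ.1.le (hIi.const_mul _)
      ((hh2.add continuous_const).intervalIntegrable _ _) fun s _ => ?_
    nlinarith [sq_nonneg (|h s| - D * M), sq_abs (h s)]
  have h6 : I ≤ D * M * S := by
    have hDM : 0 < D * M := mul_pos hD hM
    have : D * M * I ≤ D * M * (D * M * S) := by
      nlinarith [mul_le_mul_of_nonneg_left hξ.2 (mul_pos hDM hDM).le]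
    exact le_of_mul_le_mul_left this hDM
  intro s hs
  have h7 : |∫ σ in (0 : ℝ)..ξ, evenKernel (k' 0) s σ * h σ| ≤ K * I := by
    rw [hI, ← intervalIntegral.integral_const_mul]
    rw [← Real.norm_eq_abs]
    refine intervalIntegral.norm_integral_le_of_norm_le hξ.1.le
      (Eventually.of_forall fun σ hσ => ?_) (hIi.const_mul K)
    rw [norm_mul]
    exact mul_le_mul_of_nonneg_right (hK (s, σ) ⟨⟨hs.1, hs.2.trans hξ.2⟩, hσ.1.le, hσ.2.trans hξ.2⟩)
      (norm_nonneg _)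
  have h8 : |k 0 0| * |h s| ≤ M + K * I := by
    rw [← abs_mul, ← abs_neg, ← neg_mul]
    calc |-k 0 0 * h s| = |(-k 0 0 * h s - ∫ σ in (0 : ℝ)..ξ, evenKernel (k' 0) s σ * h σ) +
          ∫ σ in (0 : ℝ)..ξ, evenKernel (k' 0) s σ * h σ| := by rw [sub_add_cancel]
      _ ≤ _ := (abs_add_le _ _).trans (add_le_add (hres s hs) h7)
  rw [div_mul_eq_mul_div, le_div_iff₀ (abs_pos.2 hk0)]
  nlinarith [mul_le_mul_of_nonneg_left h6 hK0]

end

section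

/-! ### The Krein and Pariiskii equations -/

variable {ρ q : ℝ → ℝ} {T : ℝ} {r k k' : ℝ → ℝ → ℝ}

/-- Folding of an integral of an even function over `[-ξ,ξ]` with a difference kernel. -/
theorem integral_even_eq {d P : ℝ → ℝ} (hd : Continuous d) (hP : Continuous P) {ξ : ℝ}
    (hξ : 0 ≤ ξ) (t : ℝ) :
    ∫ s in (-ξ)..ξ, d |t - s| * P |s| = 2 * ∫ s in (0 : ℝ)..ξ, evenKernel d |t| s * P s := by
  have hc : Continuous fun s => d |t - s| * P |s| :=
    (hd.comp (by fun_prop)).mul (hP.comp (by fun_prop))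
  have hc' : Continuous fun s => d |t - -s| * P |-s| :=
    (hd.comp (by fun_prop)).mul (hP.comp (by fun_prop))
  have e := intervalIntegral.integral_comp_neg (a := 0) (b := ξ) (fun s => d |t - s| * P |s|)
  rw [neg_zero] at e
  rw [← intervalIntegral.integral_add_adjacent_intervals (b := 0) (hc.intervalIntegrable _ _)
    (hc.intervalIntegrable _ _), ← e, ← intervalIntegral.integral_add (hc'.intervalIntegrable _ _)
    (hc.intervalIntegrable _ _), ← intervalIntegral.integral_const_mul]
  refine integral_congr_Ioo hξ fun s hs => ?_
  have hs := hs.1.le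
  rw [abs_neg, evenKernel, sub_neg_eq_add, abs_of_nonneg hs]
  rcases le_total 0 t with ht | ht
  · rw [abs_of_nonneg ht, abs_of_nonneg (add_nonneg ht hs)]; ring
  · rw [abs_of_nonpos ht, abs_of_nonpos (by linarith : t - s ≤ 0), ← abs_neg (t + s),
      show -(t + s) = -t - s by ring, show -(t - s) = -t + s by ring]
    ring

namespace IsFrontKernel

theorem apply_zero (hk : IsFrontKernel ρ r k k') {t : ℝ} (ht : 0 ≤ t) : r 0 t = k 0 t :=
  hk.eq 0 le_rfl t (by rwa [eikonal_zero])

theorem responseDeriv_eq (hk : IsFrontKernel ρ r k k') {t : ℝ} (ht : 0 ≤ t) :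
    responseDeriv r t = k' 0 t := by
  have e : EqOn (fun s => r 0 s) (k 0) (Ici 0) := fun s hs => hk.apply_zero hs
  rw [responseDeriv, derivWithin_congr e (hk.apply_zero ht)]
  exact (hk.hasDerivAt 0 t).hasDerivWithinAt.derivWithin (uniqueDiffOn_Ici 0 t ht)

/-- The folded equation on `[0,ξ]` for `P` is the equation on `[-ξ,ξ]` for the even function
`P(|·|)`. -/
theorem even_equation (hk : IsFrontKernel ρ r k k') {P : ℝ → ℝ} (hP : Continuous P) {ξ : ℝ}
    (hξ : 0 ≤ ξ) (t : ℝ) :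
    -r 0 0 * P |t| - 1 / 2 * ∫ s in (-ξ)..ξ, responseDeriv r |t - s| * P |s| =
      -k 0 0 * P |t| - ∫ s in (0 : ℝ)..ξ, evenKernel (k' 0) |t| s * P s := by
  have e : ∀ s, responseDeriv r |t - s| = k' 0 |t - s| := fun s => hk.responseDeriv_eq (abs_nonneg _)
  simp_rw [e]
  rw [integral_even_eq (hk.cont_deriv.uncurry_left 0) hP hξ, hk.apply_zero le_rfl]
  ring

end IsFrontKernel

namespace SystemOperators

variable {W B : Outer T →L[ℝ] Inner ρ T} {R : Outer T →L[ℝ] Outer T}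

theorem adjoint_response_one (h : SystemOperators ρ r k k' T W B R) (hk : IsFrontKernel ρ r k k') :
    ContinuousLinearMap.adjoint R (one T) =ᵐ[timeMeasure T]
      fun t => ∫ s in (0 : ℝ)..(T - t), k 0 s := by
  have hc : Continuous (Function.uncurry fun t s => k 0 (t - s)) :=
    hk.cont.comp (continuous_const.prodMk (by fun_prop))
  have hR : R = kernelOp T (triangle fun t s => k 0 (t - s)) := by
    ext1 f; ext1
    filter_upwards [h.response f, coeFn_volterraOp hc f, ae_mem_timeMeasure] with t h1 h2 ht
    rw [h1, ← volterraOp, h2, hk.duhamel_eq le_rfl (by rw [eikonal_zero]; exact ht.1.le),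
      eikonal_zero, sub_zero]
  have hb := isBoundedKernel_triangle (T := T) hc
  rw [hR, adjoint_kernelOp hb]
  filter_upwards [coeFn_kernelOp hb.swap (one T), ae_mem_timeMeasure] with t h1 ht
  rw [h1, integral_triangle_swap _ _ ht]
  have e : ∫ s in t..T, k 0 (s - t) * one T s = ∫ s in t..T, k 0 (s - t) * 1 :=
    integral_congr_timeMeasure (by filter_upwards [coeFn_one] with s hs; rw [hs])
      (Ioo_subset_Icc_self ht) ⟨ht.1.le.trans ht.2.le, le_rfl⟩
  rw [e]
  simp only [mul_one]
  rw [intervalIntegral.integral_comp_sub_right (fun s => k 0 s) t, sub_self]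

/-- A state `Y` with `B†Y = F(T - ·)` is reached as a velocity with a continuous control. -/
theorem exists_steering_control (h : SystemOperators ρ r k k' T W B R)
    (hk : IsFrontKernel ρ r k k') (hr : IsFundamentalSolution ρ q r) (hρ : IsDensity ρ) (hT : 0 < T)
    {F : ℝ → ℝ} (hF : Continuous F) {Y : Inner ρ T}
    (hY : ContinuousLinearMap.adjoint B Y =ᵐ[timeMeasure T] fun t => F (T - t)) :
    ∃ P : ℝ → ℝ, Continuous P ∧
      (∀ s, -k 0 0 * P s - ∫ σ in (0 : ℝ)..T, evenKernel (k' 0) s σ * P σ = F s) ∧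
      ∃ f : Outer T, (f =ᵐ[timeMeasure T] fun t => P (T - t)) ∧ B f = Y := by
  obtain ⟨P, hP, hPe, f, hf, hBf⟩ := h.exists_continuous_solution hk hr hρ hT hF
  refine ⟨P, hP, hPe, f, hf, h.adjoint_injective (hBf.trans ?_)⟩
  ext1
  exact (coeFn_toOuter (hF.comp (by fun_prop)).continuousOn).trans hY.symm

/-- The state at the front is determined by the initial value of the control. -/
theorem state_front (h : SystemOperators ρ r k k' T W B R) (hk : IsFrontKernel ρ r k k')
    (hρ : IsDensity ρ) (hT : 0 < T) {φ y : ℝ → ℝ} (hφ : Continuous φ) (hy : Continuous y)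
    {f : Outer T} (hf : f =ᵐ[timeMeasure T] φ) (hB : B f =ᵐ[spaceMeasure ρ T] y) :
    y (front ρ T) = k (front ρ T) T * φ 0 := by
  have hτ := hρ.continuous_eikonal_max
  have hz : Continuous fun x => k x (eikonal ρ (max x 0)) * φ (T - eikonal ρ (max x 0)) +
      ∫ s in (0 : ℝ)..(T - eikonal ρ (max x 0)), k' x (T - s) * φ s := by
    refine ((hk.cont.comp (continuous_id.prodMk hτ)).mul
      (hφ.comp (continuous_const.sub hτ))).add ?_
    refine intervalIntegral.continuous_parametric_intervalIntegral_of_continuous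
      (f := fun x s => k' x (T - s) * φ s) ?_ (continuous_const.sub hτ)
    exact (hk.cont_deriv.comp (by fun_prop : Continuous fun p : ℝ × ℝ => (p.1, T - p.2))).mul
      (hφ.comp continuous_snd)
  have hae : y =ᵐ[spaceMeasure ρ T] fun x =>
      k x (eikonal ρ (max x 0)) * φ (T - eikonal ρ (max x 0)) +
        ∫ s in (0 : ℝ)..(T - eikonal ρ (max x 0)), k' x (T - s) * φ s := by
    filter_upwards [hB, h.velocity f, hρ.ae_delay hT hf, ae_mem_spaceMeasure ρ T] with x h1 h2 h3 hx
    have hτ0 := hρ.eikonal_nonneg hx.1.le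
    have hτT := hρ.eikonal_lt hT hx
    rw [← h1, h2, h3, max_eq_left hx.1.le]
    congr 1
    exact integral_congr_timeMeasure (by filter_upwards [hf] with s hs; rw [hs])
      ⟨le_rfl, hT.le⟩ ⟨by linarith, by linarith⟩
  have hX := front_nonneg ρ T
  have := hρ.eqOn_of_ae_eq hT hy.continuousOn hz.continuousOn hae ⟨hX, le_rfl⟩
  simpa [max_eq_left hX, hρ.eikonal_front hT.le] using this

end SystemOperators

theorem evenShift_eq (p : ℝ → ℝ → ℝ) (ξ t : ℝ) :
    evenShift (fun ξ t => p ξ (ξ - t)) ξ t = p ξ |t| := by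
  rw [evenShift, sub_sub_cancel]

/-- The Krein equation: for `y = -1` the right-hand side `-y(0) 1 + y'(0) R†1` equals `1`. -/
theorem exists_krein {W B : ∀ T : ℝ, Outer T →L[ℝ] Inner ρ T} {R : ∀ T : ℝ, Outer T →L[ℝ] Outer T}
    (h : ∀ T > 0, SystemOperators ρ r k k' T (W T) (B T) (R T)) (hk : IsFrontKernel ρ r k k')
    (hr : IsFundamentalSolution ρ q r) (hρ : IsDensity ρ) (hq : ∀ x ≥ 0, q x = 0) :
    ∃ φ : ℝ → ℝ → ℝ, ∀ ξ > 0, ContinuousOn (φ ξ) (Icc 0 ξ) ∧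
      (∃ f : Outer ξ, (f =ᵐ[timeMeasure ξ] φ ξ) ∧
        (B ξ f =ᵐ[spaceMeasure ρ ξ] fun _ => (-1 : ℝ))) ∧
      ∀ t ∈ Icc (-ξ) ξ, -r 0 0 * evenShift φ ξ t - (1 / 2) * ∫ s in (-ξ)..ξ,
        responseDeriv r |t - s| * evenShift φ ξ s = 1 := by
  have key : ∀ ξ, ∃ P : ℝ → ℝ, 0 < ξ → Continuous P ∧
      (∀ s, -k 0 0 * P s - ∫ σ in (0 : ℝ)..ξ, evenKernel (k' 0) s σ * P σ = 1) ∧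
      ∃ f : Outer ξ, (f =ᵐ[timeMeasure ξ] fun t => P (ξ - t)) ∧
        (B ξ f =ᵐ[spaceMeasure ρ ξ] fun _ => (-1 : ℝ)) := by
    intro ξ
    rcases le_or_gt ξ 0 with hξ | hξ
    · exact ⟨0, fun h => absurd h hξ.not_gt⟩
    obtain ⟨Y, hY⟩ := hρ.exists_state hξ (y := fun _ => -1) continuousOn_const
    have h1 := (h ξ hξ).adjoint_state hr hρ hξ contDiffOn_const
      (fun x hx => by simp [iteratedDeriv_const, hq x hx.1.le]) hY
    obtain ⟨P, hP, hPe, f, hf, hB⟩ := (h ξ hξ).exists_steering_control hk hr hρ hξ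
      (F := fun _ => 1) continuous_const (Y := Y) (by
        rw [h1]
        simpa using! coeFn_one)
    exact ⟨P, fun _ => ⟨hP, hPe, f, hf, hB ▸ hY⟩⟩
  choose p hp using key
  refine ⟨fun ξ t => p ξ (ξ - t), fun ξ hξ => ?_⟩
  obtain ⟨hP, hPe, hf⟩ := hp ξ hξ
  refine ⟨(hP.comp (by fun_prop : Continuous fun t => ξ - t)).continuousOn, hf, fun t _ => ?_⟩
  simp only [evenShift_eq]
  rw [hk.even_equation hP hξ.le, hPe]

/-- The Pariiskii equations: for `y = -x` the right-hand side `-y(0) 1 + y'(0) R†1` equals `-R†1`.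
The derivative of the solution in `ξ` is `p(ξ,ξ) G`, where `G` solves the equation with the
right-hand side `κ(·,ξ)`; and `p(ξ,ξ) ≠ 0` because the velocity `-x` does not vanish at the front. -/
theorem exists_pariiskii {W B : ∀ T : ℝ, Outer T →L[ℝ] Inner ρ T}
    {R : ∀ T : ℝ, Outer T →L[ℝ] Outer T}
    (h : ∀ T > 0, SystemOperators ρ r k k' T (W T) (B T) (R T)) (hk : IsFrontKernel ρ r k k')
    (hr : IsFundamentalSolution ρ q r) (hρ : IsDensity ρ) (hq : ∀ x ≥ 0, q x = 0) :
    ∃ φ : ℝ → ℝ → ℝ, ∀ ξ > 0, ContinuousOn (φ ξ) (Icc 0 ξ) ∧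
      (∃ f : Outer ξ, (f =ᵐ[timeMeasure ξ] φ ξ) ∧ (B ξ f =ᵐ[spaceMeasure ρ ξ] fun x => -x)) ∧
      (∀ t ∈ Icc (-ξ) ξ, -r 0 0 * evenShift φ ξ t - (1 / 2) * ∫ s in (-ξ)..ξ,
        responseDeriv r |t - s| * evenShift φ ξ s = -∫ s in (0 : ℝ)..|t|, r 0 s) ∧
      evenShift φ ξ ξ ≠ 0 ∧
      (∀ t ∈ Icc (-ξ) ξ, DifferentiableWithinAt ℝ (fun η => evenShift φ η t) (Ici |t|) ξ) ∧
      ContinuousOn (logShift φ ξ) (Icc (-ξ) ξ) ∧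
      ∀ t ∈ Icc (-ξ) ξ, -r 0 0 * logShift φ ξ t - (1 / 2) * (∫ s in (-ξ)..ξ,
          responseDeriv r |t - s| * logShift φ ξ s)
        - (1 / 2) * (responseDeriv r (ξ + t) + responseDeriv r (ξ - t)) = 0 := by
  have hd : Continuous (k' 0) := hk.cont_deriv.uncurry_left 0
  have hk0 : Continuous (k 0) := hk.cont.uncurry_left 0
  have hF : Continuous fun s => -∫ σ in (0 : ℝ)..s, k 0 σ :=
    (intervalIntegral.continuous_primitive (fun _ _ => hk0.intervalIntegrable _ _) 0).neg
  have key : ∀ ξ, ∃ P : ℝ → ℝ, 0 < ξ → Continuous P ∧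
      (∀ s, -k 0 0 * P s - ∫ σ in (0 : ℝ)..ξ, evenKernel (k' 0) s σ * P σ =
        -∫ σ in (0 : ℝ)..s, k 0 σ) ∧
      ∃ f : Outer ξ, (f =ᵐ[timeMeasure ξ] fun t => P (ξ - t)) ∧
        (B ξ f =ᵐ[spaceMeasure ρ ξ] fun x => -x) := by
    intro ξ
    rcases le_or_gt ξ 0 with hξ | hξ
    · exact ⟨0, fun h => absurd h hξ.not_gt⟩
    have hX := hρ.front_pos hξ
    obtain ⟨Y, hY⟩ := hρ.exists_state hξ (y := fun x => -x) (by fun_prop)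
    have h1 := (h ξ hξ).adjoint_state hr hρ hξ (y := fun x => -x) (by fun_prop)
      (fun x hx => by simp [iteratedDeriv_succ, hq x hx.1.le]) hY
    have h2 : derivWithin (fun x : ℝ => -x) (Icc 0 (front ρ ξ)) 0 = -1 := by
      simpa using! ((hasDerivAt_id (0 : ℝ)).neg.hasDerivWithinAt
        (s := Icc 0 (front ρ ξ))).derivWithin (uniqueDiffOn_Icc hX 0 ⟨le_rfl, hX.le⟩)
    obtain ⟨P, hP, hPe, f, hf, hB⟩ := (h ξ hξ).exists_steering_control hk hr hρ hξ hF (Y := Y) (by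
      rw [h1, h2, neg_zero, neg_zero, zero_smul, zero_add, neg_one_smul]
      filter_upwards [Lp.coeFn_neg (ContinuousLinearMap.adjoint (R ξ) (one ξ)),
        (h ξ hξ).adjoint_response_one hk] with t h3 h4
      rw [h3, Pi.neg_apply, h4])
    exact ⟨P, fun _ => ⟨hP, hPe, f, hf, hB ▸ hY⟩⟩
  choose p hp using key
  have hpe : ∀ η t, evenShift (fun ξ t => p ξ (ξ - t)) η t = p η |t| := evenShift_eq p
  refine ⟨fun ξ t => p ξ (ξ - t), fun ξ hξ => ?_⟩
  obtain ⟨hP, hPe, f, hf, hB⟩ := hp ξ hξ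
  have hc : Continuous fun t => p ξ (ξ - t) := hP.comp (by fun_prop)
  -- otherwise the velocity `-x` would vanish at the front `x = x(ξ) > 0`
  have hne : p ξ ξ ≠ 0 := fun h0 => by
    have h1 := (h ξ hξ).state_front hk hρ hξ hc continuous_neg hf hB
    rw [sub_zero, h0, mul_zero, neg_eq_zero] at h1
    exact (hρ.front_pos hξ).ne' h1
  obtain ⟨G, hG, hGe, -⟩ := (h ξ hξ).exists_continuous_solution hk hr hρ hξ
    (F := fun s => evenKernel (k' 0) s ξ) ((continuous_evenKernel hd).uncurry_right ξ)
  have hderiv : ∀ t ∈ Icc (-ξ) ξ, HasDerivWithinAt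
      (fun η => evenShift (fun ξ t => p ξ (ξ - t)) η t) (p ξ ξ * G |t|) (Ici |t|) ξ := by
    intro t ht
    simp only [hpe]
    exact hasDerivWithinAt_solution (continuous_evenKernel hd) (fun ξ hξ => (hp ξ hξ).1)
      (fun ξ hξ => (hp ξ hξ).2.1) (fun S hS => hk.stability hr hρ hS) hξ hG hGe
      ⟨abs_nonneg t, abs_le.2 ht⟩
  have hlog : ∀ t ∈ Icc (-ξ) ξ, logShift (fun ξ t => p ξ (ξ - t)) ξ t = G |t| := by
    intro t ht
    rw [logShift, (hderiv t ht).derivWithin (uniqueDiffOn_Ici |t| ξ (abs_le.2 ht)), hpe,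
      abs_of_pos hξ, inv_mul_cancel_left₀ hne]
  refine ⟨hc.continuousOn, ⟨f, hf, hB⟩, fun t _ => ?_, by rwa [hpe, abs_of_pos hξ],
    fun t ht => (hderiv t ht).differentiableWithinAt,
    (hG.comp continuous_abs).continuousOn.congr hlog, fun t ht => ?_⟩
  · simp only [hpe]
    rw [hk.even_equation hP hξ.le, hPe]
    congr 1
    refine intervalIntegral.integral_congr fun s hs => ?_
    rw [uIcc_of_le (abs_nonneg t)] at hs
    exact (hk.apply_zero hs.1).symm
  · have e : ∫ s in (-ξ)..ξ, responseDeriv r |t - s| * logShift (fun ξ t => p ξ (ξ - t)) ξ s =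
        ∫ s in (-ξ)..ξ, responseDeriv r |t - s| * G |s| :=
      integral_congr_Ioo (by linarith) fun s hs => by rw [hlog s (Ioo_subset_Icc_self hs)]
    rw [e, hlog t ht, hk.even_equation hG hξ.le, hGe, hk.responseDeriv_eq (by linarith [ht.1]),
      hk.responseDeriv_eq (by linarith [ht.2]), evenKernel]
    rcases le_total 0 t with h0 | h0
    · rw [abs_of_nonneg h0, abs_of_nonpos (by linarith [ht.2]), neg_sub, add_comm t ξ]; ring
    · rw [abs_of_nonpos h0, abs_of_nonpos (by linarith [ht.1]),
        show -(-t - ξ) = ξ + t by ring, show -t + ξ = ξ - t by ring]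
      ring

end

end NeumannWave

theorem mainTheorem6
    (ρ q : ℝ → ℝ)
    (hρ : ContDiffOn ℝ ∞ ρ (Set.Ici 0)) (hρpos : ∀ x ≥ 0, 0 < ρ x)
    (hτ : Filter.Tendsto (NeumannWave.eikonal ρ) Filter.atTop Filter.atTop)
    (hq : ContDiffOn ℝ ∞ q (Set.Ici 0)) :
    (∃ r : ℝ → ℝ → ℝ, NeumannWave.IsFundamentalSolution ρ q r) ∧
    ∀ r : ℝ → ℝ → ℝ, NeumannWave.IsFundamentalSolution ρ q r →
      ∃ (W B : ∀ T : ℝ, NeumannWave.Outer T →L[ℝ] NeumannWave.Inner ρ T)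
        (R A : ∀ T : ℝ, NeumannWave.Outer T →L[ℝ] NeumannWave.Outer T),
        -- the operators of the system, with `B` and `A` the extensions by continuity
        -- of `W d/dt` and `-(d/dt) C (d/dt)`
        (∀ T > 0,
          NeumannWave.IsControlOperator ρ r T (W T) ∧
          NeumannWave.IsResponseOperator ρ r T (R T) ∧
          NeumannWave.ExtendsVelocity (W T) (B T) ∧
          (∀ B' : NeumannWave.Outer T →L[ℝ] NeumannWave.Inner ρ T,
            NeumannWave.ExtendsVelocity (W T) B' → B' = B T) ∧
          NeumannWave.ExtendsSandwich (NeumannWave.connecting (W T)) (A T) ∧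
          (∀ A' : NeumannWave.Outer T →L[ℝ] NeumannWave.Outer T,
            NeumannWave.ExtendsSandwich (NeumannWave.connecting (W T)) A' → A' = A T) ∧
          Function.Bijective (B T)) ∧
        -- the special boundary control problem
        (∀ T > 0, ∀ y : ℝ → ℝ,
          ContDiffOn ℝ 2 y (Set.Icc 0 (NeumannWave.front ρ T)) →
          (∀ x ∈ Set.Ioo 0 (NeumannWave.front ρ T),
            -iteratedDeriv 2 y x + q x * y x = 0) →
          ∃ (Y : NeumannWave.Inner ρ T) (f : NeumannWave.Outer T),
            (Y =ᵐ[NeumannWave.spaceMeasure ρ T] y) ∧ B T f = Y ∧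
            ∀ f' : NeumannWave.Outer T,
              A T f' = (-y 0) • NeumannWave.one T
                + (derivWithin y (Set.Icc 0 (NeumannWave.front ρ T)) 0) •
                  (ContinuousLinearMap.adjoint (R T)) (NeumannWave.one T)
              ↔ f' = f) ∧
        ((∀ x ≥ 0, q x = 0) →
          -- the target `y = -1` and the Krein equation
          (∃ φ : ℝ → ℝ → ℝ, ∀ ξ > 0,
            ContinuousOn (φ ξ) (Set.Icc 0 ξ) ∧
            (∃ f : NeumannWave.Outer ξ, (f =ᵐ[NeumannWave.timeMeasure ξ] φ ξ) ∧
              (B ξ f =ᵐ[NeumannWave.spaceMeasure ρ ξ] fun _ => (-1 : ℝ))) ∧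
            ∀ t ∈ Set.Icc (-ξ) ξ,
              -r 0 0 * NeumannWave.evenShift φ ξ t
                - (1 / 2) * ∫ s in (-ξ)..ξ,
                    NeumannWave.responseDeriv r |t - s| * NeumannWave.evenShift φ ξ s = 1) ∧
          -- the target `y = -x` and the Pariiskii equation
          (∃ φ : ℝ → ℝ → ℝ, ∀ ξ > 0,
            ContinuousOn (φ ξ) (Set.Icc 0 ξ) ∧
            (∃ f : NeumannWave.Outer ξ, (f =ᵐ[NeumannWave.timeMeasure ξ] φ ξ) ∧
              (B ξ f =ᵐ[NeumannWave.spaceMeasure ρ ξ] fun x => -x)) ∧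
            (∀ t ∈ Set.Icc (-ξ) ξ,
              -r 0 0 * NeumannWave.evenShift φ ξ t
                - (1 / 2) * ∫ s in (-ξ)..ξ,
                    NeumannWave.responseDeriv r |t - s| * NeumannWave.evenShift φ ξ s
                = -∫ s in (0 : ℝ)..|t|, r 0 s) ∧
            NeumannWave.evenShift φ ξ ξ ≠ 0 ∧
            (∀ t ∈ Set.Icc (-ξ) ξ, DifferentiableWithinAt ℝ
              (fun η => NeumannWave.evenShift φ η t) (Set.Ici |t|) ξ) ∧
            ContinuousOn (NeumannWave.logShift φ ξ) (Set.Icc (-ξ) ξ) ∧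
            ∀ t ∈ Set.Icc (-ξ) ξ,
              -r 0 0 * NeumannWave.logShift φ ξ t
                - (1 / 2) * (∫ s in (-ξ)..ξ,
                    NeumannWave.responseDeriv r |t - s| * NeumannWave.logShift φ ξ s)
                - (1 / 2) * (NeumannWave.responseDeriv r (ξ + t)
                    + NeumannWave.responseDeriv r (ξ - t)) = 0)) := by
  have hd : NeumannWave.IsDensity ρ := ⟨hρ.continuousOn, hρpos, hτ⟩
  obtain ⟨k, k', hkC, hk', hk'c, hk0, hr₀⟩ := NeumannWave.exists_fundamentalSolution hρ hd hq
  have hkr₀ : NeumannWave.IsFrontKernel ρ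
      (fun x t => if 0 ≤ x ∧ NeumannWave.eikonal ρ x ≤ t then k x t else 0) k k' :=
    ⟨hkC.continuous, hk', hk'c, hk0, fun x hx t ht => if_pos ⟨hx, ht⟩⟩
  refine ⟨⟨_, hr₀⟩, fun r hr => ?_⟩
  have hk := hr.isFrontKernel hr₀ hkr₀ hd
  have hops : ∀ T : ℝ, ∃ (W B : NeumannWave.Outer T →L[ℝ] NeumannWave.Inner ρ T)
      (R : NeumannWave.Outer T →L[ℝ] NeumannWave.Outer T),
      0 < T → NeumannWave.SystemOperators ρ r k k' T W B R := fun T => by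
    rcases le_or_gt T 0 with hT | hT
    · exact ⟨0, 0, 0, fun h => absurd h hT.not_gt⟩
    · obtain ⟨W, B, R, h⟩ := hk.exists_operators hd hT
      exact ⟨W, B, R, fun _ => h⟩
  choose W B R hsys using hops
  refine ⟨W, B, R, fun T => (ContinuousLinearMap.adjoint (B T)).comp (B T), fun T hT => ?_,
    fun T hT y hy hyq => ?_, fun hq0 => ⟨NeumannWave.exists_krein hsys hk hr hd hq0,
      NeumannWave.exists_pariiskii hsys hk hr hd hq0⟩⟩
  · have h := hsys T hT
    exact ⟨h.control, h.response, h.extendsVelocity, fun B' hB' => h.eq_of_extendsVelocity hB',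
      h.extendsSandwich hT, fun A' hA' => h.eq_of_extendsSandwich hT hA', h.bijective⟩
  · have h := hsys T hT
    obtain ⟨Y, hY⟩ := hd.exists_state hT hy.continuousOn
    obtain ⟨f, hf⟩ := h.bijective.2 Y
    refine ⟨Y, f, hY, hf, fun f' => ?_⟩
    rw [← h.adjoint_state hr hd hT hy hyq hY, ContinuousLinearMap.comp_apply,
      h.adjoint_injective.eq_iff, ← hf, h.bijective.1.eq_iff]
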